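/- Let $\mathbf k$ be a field of characteristic zero and let $\mathcal P=\Gamma(E)/(R)$ be a quadratic operad, generated by a finite-dimensional $\mathbf k[\Sigma_2]$-module $E=\mathcal P(2)$ placed in degree $0$, with a $\Sigma_3$-stable space of relations $R\subset\Gamma(E)(3)$ (for instance a quadratic Koszul operad). Let $\mathcal P^!=\Gamma(E^\vee)/(R^\perp)$ be its quadratic dual, $E^\vee=E^\#\otimes \mathrm{sgn}_2$. **Suspension.** For an operad $\mathcal T$ let $\mathfrak s\mathcal T$ be its operadic suspension, $\mathfrak s\mathcal T(n)=\uparrow^{n-1}\mathcal T(n)\otimes\mathrm{sgn}_n$; the operation $f\circ_i g$ of $\mathfrak s\mathcal T$, with $g$ of arity $n$, is $(-1)^{(i-1)(n-1)}$ times that of $\mathcal T$. The right action of permutations is normalized by $(p\sigma)(x_1,\dots,x_n)=p(x_{\sigma(1)},\dots,x_{\sigma(n)})$ (products of permutations being read from left to right). On $\mathfrak s\mathcal T$ put $f\circ g=\sum_i f\circ_i g$ and $[f,g]=f\circ g-(-1)^{(m-1)(n-1)}g\circ f$ for $f,g$ of arities $m,n$; by averaging, this bracket induces a bracket on the invariants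 $\mathfrak s\mathcal T(n)^{\Sigma_n}$, $n\ge 1$. **Canonical element.** Let $\chi\in\mathfrak s(\mathcal P\otimes\mathcal P^!)(2)^{\Sigma_2}$ be the element corresponding to the identity of $\mathcal P(2)$ under $\mathcal P(2)\otimes\mathcal P^!(2)\cong \mathcal P(2)\otimes\mathcal P(2)^{\#}$. **Cochains.** For a $\mathcal P$-algebra $A$ (a vector space with a homomorphism $\alpha:\mathcal P\to\mathcal End_A$) let $C^{m}_{\mathcal P}(A;A)=\mathfrak s(\mathcal End_A\otimes\mathcal P^!)(m+1)^{\Sigma_{m+1}}$, $m\ge 0$, with the differential $d_{\mathcal P}f=[(\alpha\otimes \mathrm{id})\chi,f]$. **Natural operations.** Let $\mathcal B_{\mathcal P}=\bigoplus_{d}\mathcal B^d_{\mathcal P}$ be the operad of natural operations: $\mathcal B^d_{\mathcal P}(n)$ consists of the $n$-linear operations on $C^*_{\mathcal P}(A;A)$, given for all $\mathcal P$-algebras $A$, whose components $C^{m_1}\otimes\cdots\otimes C^{m_n}\to C^{m_1+\cdots+m_n+d}$ are linear combinations of the operations $U_{(T,\Phi)}$. Here $T$ is a rooted tree with $m_1+\cdots+m_n+d+1$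 labelled input legs, $n$ white vertices $w_1,\dots,w_n$ of arities $m_1+1,\dots,m_n+1$ with linearly ordered inputs, and at least binary black vertices decorated by elements of $\mathcal P$; $\Phi:\mathcal P^!(m_1+1)\otimes\cdots\otimes\mathcal P^!(m_n+1)\to\mathcal P^!(m_1+\cdots+m_n+d+1)$ is a linear map; and $U_{(T,\Phi)}$ is the average over the symmetric group of $(\phi_1\otimes q_1,\dots,\phi_n\otimes q_n)\mapsto T(\phi_1,\dots,\phi_n)\otimes\Phi(q_1,\dots,q_n)$, where $T(\phi_1,\dots,\phi_n)$ is the composition along $T$ with $w_i$ decorated by $\phi_i$. The differential of $\mathcal B_{\mathcal P}$ is $$\delta_{\mathcal P}(U)(f_1,\dots,f_n)=d_{\mathcal P}U(f_1,\dots,f_n)-(-1)^{|U|}\sum_{i}(-1)^{|f_1|+\cdots+|f_{i-1}|}U(f_1,\dots,d_{\mathcal P}f_i,\dots,f_n).$$ **Cup products.** For $n\ge 1$ every $t\in\mathfrak s(\mathcal P\otimes\mathcal P^!)(n)$ determines a natural operation $\mathit{cup}(t)\in\mathcal B^{n-1}_{\mathcal P}(n)$, $(f_1,\dots,f_n)\mapsto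 \mathrm{Aver}\big(((\alpha\otimes\mathrm{id})t)(f_1,\dots,f_n)\big)$, where the composition is that of $\mathfrak s(\mathcal End_A\otimes\mathcal P^!)$. Let $\mathcal Z_{\mathcal P}(n)\subset\mathfrak s(\mathcal P\otimes\mathcal P^!)(n)$ be the set of those $t$ for which $\mathit{cup}(t)$ is a $\delta_{\mathcal P}$-cocycle in $\mathcal B_{\mathcal P}$. **Theorem.** For $n\ge 1$, an element $t\in\mathfrak s(\mathcal P\otimes\mathcal P^!)(n)$ belongs to $\mathcal Z_{\mathcal P}(n)$ if and only if, in $\mathfrak s(\mathcal P\otimes\mathcal P^!)(n+1)$, $$\chi\circ_2 t+(-1)^n\Big(t\circ_1\chi+(t\circ_2\chi)(12)+(t\circ_3\chi)(123)+\cdots+(t\circ_n\chi)(12\cdots n)\Big)=0,$$ where $(12\cdots k)\in\Sigma_{n+1}$ is the cycle $1\mapsto2\mapsto\cdots\mapsto k\mapsto1$ fixing $k+1,\dots,n+1$. -/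

import Mathlib

open scoped TensorProduct

universe u

noncomputable section

/-! ### Symmetric operads -/

/-- When the `i`-th input of an `m`-ary operation is replaced by an `n`-ary operation, the result
has `N = m + n - 1` inputs; `Slot.inner h i y` is the position of the `y`-th input of the inserted
operation. All positions are counted from `0`. -/
def Slot.inner {m n N : ℕ} (h : m + n = N + 1) (i : Fin m) (y : Fin n) : Fin N :=
  ⟨i + y, by omega⟩

/-- The position, after the insertion of an `n`-ary operation at `i`, of an input `x ≠ i` of the
outer `m`-ary operation. -/
def Slot.outer {m n N : ℕ} (h : m + n = N + 1) (i x : Fin m) (hx : x ≠ i) : Fin N :=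
  ⟨if x < i then x else x + n - 1, by
    have hne : (x : ℕ) ≠ i := fun e => hx (Fin.ext e)
    split_ifs with hlt
    · have : (x : ℕ) < i := hlt
      omega
    · have : ¬ (x : ℕ) < i := hlt
      omega⟩

theorem Slot.inner_inj {m n N : ℕ} (h : m + n = N + 1) (i : Fin m) {y y' : Fin n} :
    Slot.inner h i y = Slot.inner h i y' ↔ y = y' := by
  simp only [Slot.inner, Fin.ext_iff]
  omega

theorem Slot.outer_inj {m n N : ℕ} (h : m + n = N + 1) (i : Fin m) {x x' : Fin m}
    (hx : x ≠ i) (hx' : x' ≠ i) :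
    Slot.outer h i x hx = Slot.outer h i x' hx' ↔ x = x' := by
  simp only [Slot.outer, Fin.ext_iff, Fin.lt_def] at *
  split_ifs <;> omega

theorem Slot.inner_ne_outer {m n N : ℕ} (h : m + n = N + 1) (i : Fin m) (y : Fin n)
    {x : Fin m} (hx : x ≠ i) : Slot.inner h i y ≠ Slot.outer h i x hx := by
  simp only [Slot.outer, Slot.inner, Fin.ext_iff, Fin.lt_def, ne_eq] at *
  split_ifs <;> omega

theorem Slot.cases {m n N : ℕ} (h : m + n = N + 1) (i : Fin m) (z : Fin N) :
    (∃ y, z = Slot.inner h i y) ∨ ∃ x, ∃ hx : x ≠ i, z = Slot.outer h i x hx := by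
  by_cases h1 : (z : ℕ) < i
  · refine Or.inr ⟨⟨z, by omega⟩, ?_, ?_⟩
    · simp only [ne_eq, Fin.ext_iff]; omega
    · simp [Slot.outer, Fin.lt_def, h1]
  · by_cases h2 : (z : ℕ) < i + n
    · exact Or.inl ⟨⟨z - i, by omega⟩, by simp only [Slot.inner, Fin.ext_iff]; omega⟩
    · refine Or.inr ⟨⟨z + 1 - n, by omega⟩, ?_, ?_⟩
      · simp only [ne_eq, Fin.ext_iff]; omega
      · simp only [Slot.outer, Fin.ext_iff, Fin.lt_def]
        split_ifs <;> omega

/-- A `k`-linear symmetric operad (in vector spaces), through its partial compositions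
`comp h i p q = p ∘_{i+1} q`.

`act σ p` is `p σ` for the right action of the symmetric group that relabels inputs:
the input of `p σ` that is fed into the `j`-th slot of `p` is the `σ j`-th one, i.e.
`(p σ)(x_1, …, x_n) = p (x_{σ 1}, …, x_{σ n})`; it is a right action for the product of
permutations read from left to right, so `(p σ) τ = p (σ τ)` is `act (τ * σ) p` with
Mathlib's product `τ * σ = τ ∘ σ`. -/
structure Operad (k : Type u) [Field k] where
  obj : ℕ → Type u
  [addCommGroup : ∀ n, AddCommGroup (obj n)]
  [module : ∀ n, Module k (obj n)]
  act : ∀ {n : ℕ}, Equiv.Perm (Fin n) → obj n →ₗ[k] obj n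
  one : obj 1
  comp : ∀ {m n N : ℕ}, m + n = N + 1 → Fin m → obj m →ₗ[k] obj n →ₗ[k] obj N
  act_one : ∀ {n : ℕ} (p : obj n), act 1 p = p
  act_mul : ∀ {n : ℕ} (σ τ : Equiv.Perm (Fin n)) (p : obj n), act (τ * σ) p = act τ (act σ p)
  one_comp : ∀ {n : ℕ} (h : 1 + n = n + 1) (p : obj n), comp h 0 one p = p
  comp_one : ∀ {n : ℕ} (i : Fin n) (p : obj n), comp rfl i p one = p
  /-- sequential associativity -/
  comp_assoc : ∀ {m n l M L N : ℕ} (h₁ : m + n = M + 1) (h₂ : M + l = N + 1)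
    (h₃ : n + l = L + 1) (h₄ : m + L = N + 1) (i : Fin m) (j : Fin n)
    (p : obj m) (q : obj n) (r : obj l),
    comp h₂ (Slot.inner h₁ i j) (comp h₁ i p q) r = comp h₄ i p (comp h₃ j q r)
  /-- parallel associativity -/
  comp_comm : ∀ {m n l M L N : ℕ} (h₁ : m + n = M + 1) (h₂ : M + l = N + 1)
    (h₃ : m + l = L + 1) (h₄ : L + n = N + 1) (i j : Fin m) (hij : i ≠ j)
    (p : obj m) (q : obj n) (r : obj l),
    comp h₂ (Slot.outer h₁ i j hij.symm) (comp h₁ i p q) r =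
      comp h₄ (Slot.outer h₃ j i hij) (comp h₃ j p r) q
  /-- equivariance: `ρ` is the block permutation composed of `σ` and `τ` -/
  comp_act : ∀ {m n N : ℕ} (h : m + n = N + 1) (i : Fin m) (σ : Equiv.Perm (Fin m))
    (τ : Equiv.Perm (Fin n)) (ρ : Equiv.Perm (Fin N)),
    (∀ y, ρ (Slot.inner h i y) = Slot.inner h (σ i) (τ y)) →
    (∀ x (hx : x ≠ i), ρ (Slot.outer h i x hx) =
      Slot.outer h (σ i) (σ x) (fun e => hx (σ.injective e))) →
    ∀ (p : obj m) (q : obj n), comp h (σ i) (act σ p) (act τ q) = act ρ (comp h i p q)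

attribute [instance] Operad.addCommGroup Operad.module

namespace Operad

variable {k : Type u} [Field k]

/-- Homomorphisms of operads. -/
structure Hom (P Q : Operad k) where
  map : ∀ n, P.obj n →ₗ[k] Q.obj n
  map_one : map 1 P.one = Q.one
  map_act : ∀ {n : ℕ} (σ : Equiv.Perm (Fin n)) (p : P.obj n),
    map n (P.act σ p) = Q.act σ (map n p)
  map_comp : ∀ {m n N : ℕ} (h : m + n = N + 1) (i : Fin m) (p : P.obj m) (q : P.obj n),
    map N (P.comp h i p q) = Q.comp h i (map m p) (map n q)

/-- Transport of `T (a)` along an equality of arities. -/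
def reindex (T : Operad k) {a b : ℕ} (h : a = b) : T.obj a →ₗ[k] T.obj b :=
  h ▸ LinearMap.id

end Operad

/-! ### The endomorphism operad -/

section Endomorphisms

variable {k : Type u} [Field k] {A : Type u}

/-- The arguments of the outer map in `f ∘_i g`, evaluated at `v`. -/
def EndOp.args {m n N : ℕ} (h : m + n = N + 1) (i : Fin m)
    (g : (Fin n → A) → A) (v : Fin N → A) (x : Fin m) : A :=
  if hx : x = i then g (fun y => v (Slot.inner h i y)) else v (Slot.outer h i x hx)


theorem EndOp.args_update_inner {m n N : ℕ} (h : m + n = N + 1) (i : Fin m)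
    (g : (Fin n → A) → A) (v : Fin N → A) (y : Fin n) (a : A) :
    EndOp.args h i g (Function.update v (Slot.inner h i y) a) =
      Function.update (EndOp.args h i g v) i
        (g (Function.update (fun y => v (Slot.inner h i y)) y a)) := by
  funext x
  by_cases hx : x = i
  · subst hx
    simp only [EndOp.args, dite_true, Function.update_self]
    congr 1
    funext y'
    by_cases hy : y' = y
    · subst hy; simp
    · rw [Function.update_of_ne hy, Function.update_of_ne]
      rwa [ne_eq, Slot.inner_inj]
  · rw [Function.update_of_ne hx]
    simp only [EndOp.args, dif_neg hx]
    rw [Function.update_of_ne (Slot.inner_ne_outer h i y hx).symm]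

theorem EndOp.args_update_outer {m n N : ℕ} (h : m + n = N + 1) (i : Fin m)
    (g : (Fin n → A) → A) (v : Fin N → A) (x : Fin m) (hx : x ≠ i) (a : A) :
    EndOp.args h i g (Function.update v (Slot.outer h i x hx) a) =
      Function.update (EndOp.args h i g v) x a := by
  funext x'
  by_cases hx' : x' = i
  · subst hx'
    rw [Function.update_of_ne hx.symm]
    simp only [EndOp.args, dite_true]
    congr 1
    funext y
    rw [Function.update_of_ne (Slot.inner_ne_outer h x' y hx)]
  · simp only [EndOp.args, dif_neg hx']
    by_cases e : x' = x
    · subst e; simp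
    · rw [Function.update_of_ne e, Function.update_of_ne]
      · simp [EndOp.args, hx']
      · rwa [ne_eq, Slot.outer_inj]

variable [AddCommGroup A] [Module k A]

/-- `(f ∘_i g)(v_1, …) = f (v_1, …, v_{i-1}, g (v_i, …), …)`. -/
def EndOp.compFun {m n N : ℕ} (h : m + n = N + 1) (i : Fin m)
    (f : MultilinearMap k (fun _ : Fin m => A) A) (g : MultilinearMap k (fun _ : Fin n => A) A) :
    MultilinearMap k (fun _ : Fin N => A) A :=
  MultilinearMap.mk' (fun v => f (EndOp.args h i g v))
    (by
      intro v z a b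
      rcases Slot.cases h i z with ⟨y, rfl⟩ | ⟨x, hx, rfl⟩
      · simp only [EndOp.args_update_inner, MultilinearMap.map_update_add]
      · simp only [EndOp.args_update_outer, MultilinearMap.map_update_add])
    (by
      intro v z c a
      rcases Slot.cases h i z with ⟨y, rfl⟩ | ⟨x, hx, rfl⟩
      · simp only [EndOp.args_update_inner, MultilinearMap.map_update_smul]
      · simp only [EndOp.args_update_outer, MultilinearMap.map_update_smul])

theorem EndOp.compFun_apply {m n N : ℕ} (h : m + n = N + 1) (i : Fin m)
    (f : MultilinearMap k (fun _ : Fin m => A) A) (g : MultilinearMap k (fun _ : Fin n => A) A)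
    (v : Fin N → A) : EndOp.compFun h i f g v = f (EndOp.args h i g v) := rfl

theorem EndOp.args_eq_update {m n N : ℕ} (h : m + n = N + 1) (i : Fin m)
    (g : (Fin n → A) → A) (v : Fin N → A) :
    EndOp.args h i g v = Function.update (EndOp.args h i (fun _ => 0) v) i
      (g (fun y => v (Slot.inner h i y))) := by
  funext x
  by_cases hx : x = i
  · subst hx; simp [EndOp.args]
  · simp [EndOp.args, hx]

variable (k A)

/-- The endomorphism operad of a vector space. -/
def endOperad : Operad k where
  obj n := MultilinearMap k (fun _ : Fin n => A) A
  act σ := (MultilinearMap.domDomCongrLinearEquiv k k A A σ).toLinearMap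
  one := MultilinearMap.ofSubsingleton k A A 0 LinearMap.id
  comp h i := LinearMap.mk₂ k (EndOp.compFun h i)
    (fun f f' g => by ext v; rfl) (fun c f g => by ext v; rfl)
    (fun f g g' => by
      ext v
      simp only [EndOp.compFun_apply, add_apply]
      rw [EndOp.args_eq_update h i g, EndOp.args_eq_update h i g',
        EndOp.args_eq_update h i (⇑(g + g')), ← MultilinearMap.map_update_add]
      rfl)
    (fun c f g => by
      ext v
      simp only [EndOp.compFun_apply, smul_apply]
      rw [EndOp.args_eq_update h i g, EndOp.args_eq_update h i (⇑(c • g)),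
        ← MultilinearMap.map_update_smul]
      rfl)
  act_one p := by ext v; rfl
  act_mul σ τ p := by ext v; rfl
  one_comp h p := by
    ext v
    change EndOp.args h 0 p v 0 = p v
    simp only [EndOp.args, dite_true]
    congr 1
    funext y
    congr 1
    simp [Slot.inner]
  comp_one i p := by
    ext v
    change p (EndOp.args rfl i (fun w => w 0) v) = p v
    congr 1
    funext x
    by_cases hx : x = i
    · subst hx; simp [EndOp.args, Slot.inner]
    · simp only [EndOp.args, dif_neg hx, Slot.outer]
      congr 1
      simp
  comp_assoc h₁ h₂ h₃ h₄ i j p q r := by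
    ext v
    change p (EndOp.args h₁ i q (EndOp.args h₂ (Slot.inner h₁ i j) r v)) =
      p (EndOp.args h₄ i (fun w => q (EndOp.args h₃ j r w)) v)
    congr 1
    funext x
    by_cases hx : x = i
    · subst hx
      simp only [EndOp.args, dite_true]
      congr 1
      funext y
      by_cases hy : y = j
      · subst hy
        simp only [EndOp.args, dite_true]
        congr 1
        funext z
        congr 1
        simp only [Slot.inner, Fin.ext_iff]
        omega
      · rw [dif_neg (by rwa [Slot.inner_inj]), EndOp.args, dif_neg hy]
        congr 1
        simp only [Slot.inner, Slot.outer, Fin.ext_iff, Fin.lt_def] at *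
        split_ifs <;> omega
    · simp only [EndOp.args, dif_neg hx]
      rw [dif_neg (Slot.inner_ne_outer h₁ i j hx).symm]
      congr 1
      simp only [Slot.inner, Slot.outer, Fin.ext_iff, Fin.lt_def] at *
      split_ifs <;> omega
  comp_comm h₁ h₂ h₃ h₄ i j hij p q r := by
    ext v
    change p (EndOp.args h₁ i q (EndOp.args h₂ (Slot.outer h₁ i j hij.symm) r v)) =
      p (EndOp.args h₃ j r (EndOp.args h₄ (Slot.outer h₃ j i hij) q v))
    congr 1
    funext x
    by_cases hx : x = i
    · subst hx
      simp only [EndOp.args, dite_true]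
      rw [dif_neg hij]
      congr 1
      funext y
      rw [dif_neg (Slot.inner_ne_outer h₁ x y hij.symm)]
      congr 1
      simp only [Slot.inner, Slot.outer, Fin.ext_iff, Fin.lt_def] at *
      split_ifs <;> omega
    · by_cases hx' : x = j
      · subst hx'
        simp only [EndOp.args, dite_true]
        rw [dif_neg hx]
        congr 1
        funext y
        rw [dif_neg (Slot.inner_ne_outer h₃ x y hij)]
        congr 1
        simp only [Slot.inner, Slot.outer, Fin.ext_iff, Fin.lt_def] at *
        split_ifs <;> omega
      · simp only [EndOp.args, dif_neg hx, dif_neg hx']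
        rw [dif_neg (by rwa [Slot.outer_inj]), dif_neg (by rwa [Slot.outer_inj])]
        congr 1
        simp only [Slot.outer, Fin.ext_iff, Fin.lt_def] at *
        split_ifs <;> omega
  comp_act h i σ τ ρ h1 h2 p q := by
    ext v
    change p (fun x => EndOp.args h (σ i) (fun w => q (fun y => w (τ y))) v (σ x)) =
      p (EndOp.args h i q (fun z => v (ρ z)))
    congr 1
    funext x
    by_cases hx : x = i
    · subst hx
      simp only [EndOp.args, dite_true]
      congr 1
      funext y
      rw [h1]
    · simp only [EndOp.args, dif_neg hx]
      rw [dif_neg (fun e => hx (σ.injective e)), h2 x hx]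

end Endomorphisms

/-! ### The Hadamard product `(P ⊗ Q)(n) = P(n) ⊗ Q(n)` -/

section Hadamard

variable {k : Type u} [Field k]

/-- The tensor product of two operads, with componentwise structure. -/
def hadamard (P Q : Operad k) : Operad k where
  obj n := P.obj n ⊗[k] Q.obj n
  act σ := TensorProduct.map (P.act σ) (Q.act σ)
  one := P.one ⊗ₜ[k] Q.one
  comp h i := TensorProduct.map₂ (P.comp h i) (Q.comp h i)
  act_one p := by
    induction p with
    | zero => simp
    | tmul x y => simp [P.act_one, Q.act_one]
    | add x y hx hy => rw [map_add, hx, hy]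
  act_mul σ τ p := by
    induction p with
    | zero => simp
    | tmul x y => simp [P.act_mul, Q.act_mul]
    | add x y hx hy => simp only [map_add, hx, hy]
  one_comp h p := by
    induction p with
    | zero => simp
    | tmul x y => simp [TensorProduct.map₂_apply_tmul, P.one_comp, Q.one_comp]
    | add x y hx hy => rw [map_add, hx, hy]
  comp_one i p := by
    induction p with
    | zero => simp
    | tmul x y => simp [TensorProduct.map₂_apply_tmul, P.comp_one, Q.comp_one]
    | add x y hx hy => rw [map_add, LinearMap.add_apply, hx, hy]
  comp_assoc h₁ h₂ h₃ h₄ i j p q r := by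
    induction p with
    | zero => simp
    | add x y hx hy => simp only [map_add, LinearMap.add_apply, hx, hy]
    | tmul p p' =>
      induction q with
      | zero => simp
      | add x y hx hy => simp only [map_add, LinearMap.add_apply, hx, hy]
      | tmul q q' =>
        induction r with
        | zero => simp
        | add x y hx hy => simp only [map_add, hx, hy]
        | tmul r r' =>
          simp only [TensorProduct.map₂_apply_tmul, TensorProduct.map_tmul, P.comp_assoc h₁ h₂ h₃ h₄,
            Q.comp_assoc h₁ h₂ h₃ h₄]
  comp_comm h₁ h₂ h₃ h₄ i j hij p q r := by
    induction p with
    | zero => simp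
    | add x y hx hy => simp only [map_add, LinearMap.add_apply, hx, hy]
    | tmul p p' =>
      induction q with
      | zero => simp
      | add x y hx hy => simp only [map_add, LinearMap.add_apply, hx, hy]
      | tmul q q' =>
        induction r with
        | zero => simp
        | add x y hx hy => simp only [map_add, LinearMap.add_apply, hx, hy]
        | tmul r r' =>
          simp only [TensorProduct.map₂_apply_tmul, TensorProduct.map_tmul, P.comp_comm h₁ h₂ h₃ h₄ i j hij,
            Q.comp_comm h₁ h₂ h₃ h₄ i j hij]
  comp_act h i σ τ ρ h1 h2 p q := by
    induction p with
    | zero => simp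
    | add x y hx hy => simp only [map_add, LinearMap.add_apply, hx, hy]
    | tmul p p' =>
      induction q with
      | zero => simp
      | add x y hx hy => simp only [map_add, hx, hy]
      | tmul q q' =>
        simp only [TensorProduct.map₂_apply_tmul, TensorProduct.map_tmul,
          P.comp_act h i σ τ ρ h1 h2, Q.comp_act h i σ τ ρ h1 h2]

end Hadamard

/-! ### Free operads and quadratic operads -/

/-- A finite-dimensional `k[Σ₂]`-module `E`: the space of generating binary operations, all placed
in degree `0`. The transposition acts by `swap`. -/
structure BinaryGenerators (k : Type u) [Field k] where
  carrier : Type u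
  [addCommGroup : AddCommGroup carrier]
  [module : Module k carrier]
  [finite : Module.Finite k carrier]
  swap : carrier →ₗ[k] carrier
  swap_swap : ∀ e, swap (swap e) = e

attribute [instance] BinaryGenerators.addCommGroup BinaryGenerators.module
  BinaryGenerators.finite

/-- The Czech dual `E^∨ = E^# ⊗ sgn₂`. -/
def BinaryGenerators.dual {k : Type u} [Field k] (E : BinaryGenerators k) :
    BinaryGenerators k where
  carrier := Module.Dual k E.carrier
  swap := -E.swap.dualMap
  swap_swap φ := by
    ext e
    simp [E.swap_swap]

section Presented

variable {k : Type u} [Field k] (E : BinaryGenerators k)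

/-- Formal expressions in the operations of an operad and in generators from `E`, by arity. -/
inductive OpTerm : ℕ → Type u
  | gen (e : E.carrier) : OpTerm 2
  | one : OpTerm 1
  | zero (n : ℕ) : OpTerm n
  | add {n : ℕ} (x y : OpTerm n) : OpTerm n
  | smul {n : ℕ} (c : k) (x : OpTerm n) : OpTerm n
  | act {n : ℕ} (σ : Equiv.Perm (Fin n)) (x : OpTerm n) : OpTerm n
  | comp {m n N : ℕ} (h : m + n = N + 1) (i : Fin m) (x : OpTerm m) (y : OpTerm n) : OpTerm N

variable {E}

/-- The smallest congruence on expressions that makes them an operad, makes `E → (arity 2)` a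
`Σ₂`-equivariant linear map, and kills all ternary expressions in `S`. -/
inductive OpTerm.Rel (S : OpTerm E 3 → Prop) : ∀ {n : ℕ}, OpTerm E n → OpTerm E n → Prop
  | rel (x : OpTerm E 3) : S x → Rel S x (.zero 3)
  | gen_add (e e' : E.carrier) : Rel S (.gen (e + e')) (.add (.gen e) (.gen e'))
  | gen_smul (c : k) (e : E.carrier) : Rel S (.gen (c • e)) (.smul c (.gen e))
  | gen_swap (e : E.carrier) :
      Rel S (.gen (E.swap e)) (.act (Equiv.swap (0 : Fin 2) 1) (.gen e))
  | refl {n : ℕ} (x : OpTerm E n) : Rel S x x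
  | symm {n : ℕ} {x y : OpTerm E n} : Rel S x y → Rel S y x
  | trans {n : ℕ} {x y z : OpTerm E n} : Rel S x y → Rel S y z → Rel S x z
  | add_congr {n : ℕ} {x x' y y' : OpTerm E n} :
      Rel S x x' → Rel S y y' → Rel S (.add x y) (.add x' y')
  | smul_congr {n : ℕ} (c : k) {x x' : OpTerm E n} : Rel S x x' → Rel S (.smul c x) (.smul c x')
  | act_congr {n : ℕ} (σ : Equiv.Perm (Fin n)) {x x' : OpTerm E n} :
      Rel S x x' → Rel S (.act σ x) (.act σ x')
  | comp_congr {m n N : ℕ} (h : m + n = N + 1) (i : Fin m) {x x' : OpTerm E m}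
      {y y' : OpTerm E n} : Rel S x x' → Rel S y y' → Rel S (.comp h i x y) (.comp h i x' y')
  | add_assoc {n : ℕ} (x y z : OpTerm E n) : Rel S (.add (.add x y) z) (.add x (.add y z))
  | add_comm {n : ℕ} (x y : OpTerm E n) : Rel S (.add x y) (.add y x)
  | zero_add {n : ℕ} (x : OpTerm E n) : Rel S (.add (.zero n) x) x
  | zero_smul {n : ℕ} (x : OpTerm E n) : Rel S (.smul 0 x) (.zero n)
  | one_smul {n : ℕ} (x : OpTerm E n) : Rel S (.smul 1 x) x
  | mul_smul {n : ℕ} (c d : k) (x : OpTerm E n) :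
      Rel S (.smul (c * d) x) (.smul c (.smul d x))
  | smul_add {n : ℕ} (c : k) (x y : OpTerm E n) :
      Rel S (.smul c (.add x y)) (.add (.smul c x) (.smul c y))
  | add_smul {n : ℕ} (c d : k) (x : OpTerm E n) :
      Rel S (.smul (c + d) x) (.add (.smul c x) (.smul d x))
  | act_add {n : ℕ} (σ : Equiv.Perm (Fin n)) (x y : OpTerm E n) :
      Rel S (.act σ (.add x y)) (.add (.act σ x) (.act σ y))
  | act_smul {n : ℕ} (σ : Equiv.Perm (Fin n)) (c : k) (x : OpTerm E n) :
      Rel S (.act σ (.smul c x)) (.smul c (.act σ x))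
  | comp_add_left {m n N : ℕ} (h : m + n = N + 1) (i : Fin m) (x x' : OpTerm E m)
      (y : OpTerm E n) :
      Rel S (.comp h i (.add x x') y) (.add (.comp h i x y) (.comp h i x' y))
  | comp_smul_left {m n N : ℕ} (h : m + n = N + 1) (i : Fin m) (c : k) (x : OpTerm E m)
      (y : OpTerm E n) : Rel S (.comp h i (.smul c x) y) (.smul c (.comp h i x y))
  | comp_add_right {m n N : ℕ} (h : m + n = N + 1) (i : Fin m) (x : OpTerm E m)
      (y y' : OpTerm E n) :
      Rel S (.comp h i x (.add y y')) (.add (.comp h i x y) (.comp h i x y'))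
  | comp_smul_right {m n N : ℕ} (h : m + n = N + 1) (i : Fin m) (c : k) (x : OpTerm E m)
      (y : OpTerm E n) : Rel S (.comp h i x (.smul c y)) (.smul c (.comp h i x y))
  | act_one {n : ℕ} (x : OpTerm E n) : Rel S (.act 1 x) x
  | act_mul {n : ℕ} (σ τ : Equiv.Perm (Fin n)) (x : OpTerm E n) :
      Rel S (.act (τ * σ) x) (.act τ (.act σ x))
  | one_comp {n : ℕ} (h : 1 + n = n + 1) (x : OpTerm E n) : Rel S (.comp h 0 .one x) x
  | comp_one {n : ℕ} (i : Fin n) (x : OpTerm E n) : Rel S (.comp rfl i x .one) x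
  | comp_assoc {m n l M L N : ℕ} (h₁ : m + n = M + 1) (h₂ : M + l = N + 1)
      (h₃ : n + l = L + 1) (h₄ : m + L = N + 1) (i : Fin m) (j : Fin n)
      (x : OpTerm E m) (y : OpTerm E n) (z : OpTerm E l) :
      Rel S (.comp h₂ (Slot.inner h₁ i j) (.comp h₁ i x y) z)
        (.comp h₄ i x (.comp h₃ j y z))
  | comp_comm {m n l M L N : ℕ} (h₁ : m + n = M + 1) (h₂ : M + l = N + 1)
      (h₃ : m + l = L + 1) (h₄ : L + n = N + 1) (i j : Fin m) (hij : i ≠ j)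
      (x : OpTerm E m) (y : OpTerm E n) (z : OpTerm E l) :
      Rel S (.comp h₂ (Slot.outer h₁ i j hij.symm) (.comp h₁ i x y) z)
        (.comp h₄ (Slot.outer h₃ j i hij) (.comp h₃ j x z) y)
  | comp_act {m n N : ℕ} (h : m + n = N + 1) (i : Fin m) (σ : Equiv.Perm (Fin m))
      (τ : Equiv.Perm (Fin n)) (ρ : Equiv.Perm (Fin N)) :
      (∀ y, ρ (Slot.inner h i y) = Slot.inner h (σ i) (τ y)) →
      (∀ x (hx : x ≠ i), ρ (Slot.outer h i x hx) =
        Slot.outer h (σ i) (σ x) (fun e => hx (σ.injective e))) →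
      ∀ (x : OpTerm E m) (y : OpTerm E n),
        Rel S (.comp h (σ i) (.act σ x) (.act τ y)) (.act ρ (.comp h i x y))

/-- Expressions modulo the congruence. -/
def OpTerm.Quo (S : OpTerm E 3 → Prop) (n : ℕ) : Type u :=
  Quot (fun x y : OpTerm E n => OpTerm.Rel S x y)

namespace OpTerm.Quo

variable (S : OpTerm E 3 → Prop)

/-- The class of an expression. -/
def mk {n : ℕ} (x : OpTerm E n) : OpTerm.Quo S n := Quot.mk _ x

variable {S}

theorem sound {n : ℕ} {x y : OpTerm E n} (h : OpTerm.Rel S x y) : mk S x = mk S y :=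
  Quot.sound h

instance (n : ℕ) : Zero (OpTerm.Quo S n) := ⟨mk S (.zero n)⟩

instance (n : ℕ) : Add (OpTerm.Quo S n) :=
  ⟨Quot.map₂ .add (fun x _ _ h => .add_congr (.refl x) h) (fun _ _ y h => .add_congr h (.refl y))⟩

instance (n : ℕ) : SMul k (OpTerm.Quo S n) :=
  ⟨fun c => Quot.map (.smul c) (fun _ _ h => .smul_congr c h)⟩

instance (n : ℕ) : Neg (OpTerm.Quo S n) := ⟨fun x => (-1 : k) • x⟩

theorem zero_add' {n : ℕ} (x : OpTerm.Quo S n) : 0 + x = x := by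
  induction x using Quot.ind with
  | mk x => exact sound (.zero_add x)

theorem add_comm' {n : ℕ} (x y : OpTerm.Quo S n) : x + y = y + x := by
  induction x using Quot.ind with
  | mk x =>
    induction y using Quot.ind with
    | mk y => exact sound (.add_comm x y)

theorem neg_add' {n : ℕ} (x : OpTerm.Quo S n) : -x + x = 0 := by
  induction x using Quot.ind with
  | mk x =>
    have h1 : mk S (.add (.smul (-1) x) (.smul 1 x)) = mk S (.zero n) := by
      rw [← sound (.add_smul (-1 : k) 1 x), neg_add_cancel]
      exact sound (.zero_smul x)
    exact (sound (.add_congr (.refl _) (.symm (.one_smul x)))).trans h1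

instance (n : ℕ) : AddCommGroup (OpTerm.Quo S n) where
  add_assoc x y z := by
    induction x using Quot.ind with
    | mk x =>
      induction y using Quot.ind with
      | mk y =>
        induction z using Quot.ind with
        | mk z => exact sound (.add_assoc x y z)
  zero_add := zero_add'
  add_zero x := by rw [add_comm', zero_add']
  add_comm := add_comm'
  neg_add_cancel := neg_add'
  nsmul := nsmulRec
  zsmul := zsmulRec

theorem zero_smul' {n : ℕ} (x : OpTerm.Quo S n) : (0 : k) • x = 0 := by
  induction x using Quot.ind with
  | mk x => exact sound (.zero_smul x)

theorem mul_smul' {n : ℕ} (c d : k) (x : OpTerm.Quo S n) : (c * d) • x = c • d • x := by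
  induction x using Quot.ind with
  | mk x => exact sound (.mul_smul c d x)

instance (n : ℕ) : Module k (OpTerm.Quo S n) where
  one_smul x := by
    induction x using Quot.ind with
    | mk x => exact sound (.one_smul x)
  mul_smul := mul_smul'
  smul_zero c := by
    rw [← zero_smul' (0 : OpTerm.Quo S n), ← mul_smul', mul_zero]
  smul_add c x y := by
    induction x using Quot.ind with
    | mk x =>
      induction y using Quot.ind with
      | mk y => exact sound (.smul_add c x y)
  add_smul c d x := by
    induction x using Quot.ind with
    | mk x => exact sound (.add_smul c d x)
  zero_smul := zero_smul'

end OpTerm.Quo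

/-- The operad generated by `E` subject to the ternary relations `S`. -/
def presentedOperad (S : OpTerm E 3 → Prop) : Operad k where
  obj n := OpTerm.Quo S n
  act σ :=
    { toFun := Quot.map (.act σ) (fun _ _ h => .act_congr σ h)
      map_add' := by
        rintro ⟨x⟩ ⟨y⟩
        exact OpTerm.Quo.sound (.act_add σ x y)
      map_smul' := by
        rintro c ⟨x⟩
        exact OpTerm.Quo.sound (.act_smul σ c x) }
  one := OpTerm.Quo.mk S .one
  comp h i := LinearMap.mk₂ k
    (Quot.map₂ (.comp h i) (fun x _ _ e => .comp_congr h i (.refl x) e)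
      (fun _ _ y e => .comp_congr h i e (.refl y)))
    (by
      rintro ⟨x⟩ ⟨x'⟩ ⟨y⟩
      exact OpTerm.Quo.sound (.comp_add_left h i x x' y))
    (by
      rintro c ⟨x⟩ ⟨y⟩
      exact OpTerm.Quo.sound (.comp_smul_left h i c x y))
    (by
      rintro ⟨x⟩ ⟨y⟩ ⟨y'⟩
      exact OpTerm.Quo.sound (.comp_add_right h i x y y'))
    (by
      rintro c ⟨x⟩ ⟨y⟩
      exact OpTerm.Quo.sound (.comp_smul_right h i c x y))
  act_one := by
    rintro n ⟨x⟩
    exact OpTerm.Quo.sound (.act_one x)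
  act_mul := by
    rintro n σ τ ⟨x⟩
    exact OpTerm.Quo.sound (.act_mul σ τ x)
  one_comp := by
    rintro n h ⟨x⟩
    exact OpTerm.Quo.sound (.one_comp h x)
  comp_one := by
    rintro n i ⟨x⟩
    exact OpTerm.Quo.sound (.comp_one i x)
  comp_assoc := by
    rintro m n l M L N h₁ h₂ h₃ h₄ i j ⟨x⟩ ⟨y⟩ ⟨z⟩
    exact OpTerm.Quo.sound (.comp_assoc h₁ h₂ h₃ h₄ i j x y z)
  comp_comm := by
    rintro m n l M L N h₁ h₂ h₃ h₄ i j hij ⟨x⟩ ⟨y⟩ ⟨z⟩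
    exact OpTerm.Quo.sound (.comp_comm h₁ h₂ h₃ h₄ i j hij x y z)
  comp_act := by
    rintro m n N h i σ τ ρ h1 h2 ⟨x⟩ ⟨y⟩
    exact OpTerm.Quo.sound (.comp_act h i σ τ ρ h1 h2 x y)

/-- The map from generators to binary operations. -/
def genMap (S : OpTerm E 3 → Prop) : E.carrier →ₗ[k] (presentedOperad S).obj 2 where
  toFun e := OpTerm.Quo.mk S (.gen e)
  map_add' e e' := OpTerm.Quo.sound (.gen_add e e')
  map_smul' c e := OpTerm.Quo.sound (.gen_smul c e)

variable (E)

/-- The free operad `Γ(E)`. -/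
def freeOperad : Operad k := presentedOperad (E := E) (fun _ => False)

/-- The linear isomorphism `⨁_{c ∈ C₃} E ⊗ E ≅ Γ(E)(3)`, `(e ⊗ f)_c ↦ (e ∘_1 f) c`, where `c` runs
through the cyclic permutations of three inputs. -/
def freeTernary : (Fin 3 → E.carrier ⊗[k] E.carrier) →ₗ[k] (freeOperad E).obj 3 :=
  ∑ c : Fin 3, (freeOperad E).act (finRotate 3 ^ (c : ℕ)) ∘ₗ
    TensorProduct.lift
      (((freeOperad E).comp (m := 2) (n := 2) (N := 3) rfl 0).compl₁₂ (genMap _) (genMap _)) ∘ₗ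
    LinearMap.proj c

end Presented

/-- Quadratic data: generators `E` and a `Σ₃`-stable space of relations `R ⊆ Γ(E)(3)`. -/
structure QuadraticData (k : Type u) [Field k] where
  gens : BinaryGenerators k
  rels : Submodule k ((freeOperad gens).obj 3)
  rels_act : ∀ (σ : Equiv.Perm (Fin 3)), ∀ x ∈ rels, (freeOperad gens).act σ x ∈ rels

namespace QuadraticData

variable {k : Type u} [Field k] (D : QuadraticData k)

/-- The quadratic operad `P = Γ(E)/(R)`. -/
def operad : Operad k :=
  presentedOperad (E := D.gens) (fun x => OpTerm.Quo.mk (fun _ => False) x ∈ D.rels)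

/-- The evaluation pairing of `E^∨ ⊗ E^∨` with `E ⊗ E`. -/
def evalPairing : D.gens.dual.carrier ⊗[k] D.gens.dual.carrier →ₗ[k]
    Module.Dual k (D.gens.carrier ⊗[k] D.gens.carrier) :=
  TensorProduct.dualDistrib k D.gens.carrier D.gens.carrier

/-- The annihilator `R^⊥ ⊆ Γ(E^∨)(3)` of `R` with respect to the pairing
`⟨(φ ∘_1 ψ) c, (e ∘_1 f) c'⟩ = δ_{c,c'} φ(e) ψ(f)` of `Γ(E^∨)(3)` with `Γ(E)(3)`, where `c, c'`
are cyclic permutations; this is the `sgn₃`-equivariant pairing induced by the evaluation. -/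
def orthogonal : Submodule k ((freeOperad D.gens.dual).obj 3) :=
  Submodule.map (freeTernary D.gens.dual)
    { carrier := {y | ∀ x, freeTernary D.gens x ∈ D.rels →
        ∑ c : Fin 3, D.evalPairing (y c) (x c) = 0}
      zero_mem' := by
        intro x _
        simp
      add_mem' := by
        intro y y' hy hy' x hx
        simp only [Pi.add_apply, map_add, LinearMap.add_apply, Finset.sum_add_distrib,
          hy x hx, hy' x hx, add_zero]
      smul_mem' := by
        intro c y hy x hx
        simp only [Pi.smul_apply, map_smul, LinearMap.smul_apply, ← Finset.smul_sum,
          hy x hx, smul_zero] }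

/-- The quadratic dual `P^! = Γ(E^∨)/(R^⊥)`. -/
def dualOperad : Operad k :=
  presentedOperad (E := D.gens.dual) (fun x => OpTerm.Quo.mk (fun _ => False) x ∈ D.orthogonal)

/-- The operad `P ⊗ P^!`. The suspension `𝔰(P ⊗ P^!)` has the same underlying spaces, its
structure is given by `Operad.suspAct` and `Operad.suspComp` below. -/
abbrev tensorDual : Operad k := hadamard D.operad D.dualOperad

/-- The canonical element `χ`: the identity of `E = P(2)`, as an element of
`E ⊗ E^# = P(2) ⊗ P^!(2)`. -/
def chi : D.tensorDual.obj 2 :=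
  TensorProduct.map (genMap (E := D.gens) _) (genMap (E := D.gens.dual) _)
    (coevaluation k D.gens.carrier 1)

end QuadraticData

/-! ### Operadic suspension -/

namespace Operad

variable {k : Type u} [Field k] (T : Operad k)

/-- The action of a permutation on `𝔰T(n) = ↑^{n-1} T(n) ⊗ sgn_n`. -/
def suspAct {n : ℕ} (σ : Equiv.Perm (Fin n)) : T.obj n →ₗ[k] T.obj n :=
  ((Equiv.Perm.sign σ : ℤ) : k) • T.act σ

/-- The partial composition `f ∘_{i+1} g` of `𝔰T`, which is `(-1)^{i (n-1)}` times that of `T`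
for `g` of arity `n` (as `n + 1` and `n - 1` have the same parity). -/
def suspComp {m n N : ℕ} (h : m + n = N + 1) (i : Fin m) : T.obj m →ₗ[k] T.obj n →ₗ[k] T.obj N :=
  (-1 : k) ^ ((i : ℕ) * (n + 1)) • T.comp h i

theorem suspAct_mul {n : ℕ} (σ τ : Equiv.Perm (Fin n)) (x : T.obj n) :
    T.suspAct (τ * σ) x = T.suspAct τ (T.suspAct σ x) := by
  simp only [suspAct, LinearMap.smul_apply, map_smul, smul_smul, T.act_mul, map_mul,
    Units.val_mul, Int.cast_mul, mul_comm]

/-- The invariants `𝔰T(n)^{Σ_n}`. -/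
def invariants (n : ℕ) : Submodule k (T.obj n) where
  carrier := {x | ∀ σ, T.suspAct σ x = x}
  zero_mem' := fun σ => map_zero _
  add_mem' := fun hx hy σ => by rw [map_add, hx σ, hy σ]
  smul_mem' := fun c x hx σ => by rw [map_smul, hx σ]

/-- The averaging map `𝔰T(n) → 𝔰T(n)^{Σ_n}`. -/
def aver (n : ℕ) : T.obj n →ₗ[k] T.invariants n :=
  LinearMap.codRestrict (T.invariants n)
    ((n.factorial : k)⁻¹ • ∑ σ : Equiv.Perm (Fin n), T.suspAct σ) (by
      intro x τ
      simp only [LinearMap.smul_apply, LinearMap.sum_apply, map_smul, map_sum, ← suspAct_mul]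
      congr 1
      exact Fintype.sum_equiv (Equiv.mulLeft τ) _ _ (fun σ => rfl))

/-- `f ∘ g = ∑_i f ∘_i g` in `𝔰T`. -/
def preLie {m n N : ℕ} (h : m + n = N + 1) : T.obj m →ₗ[k] T.obj n →ₗ[k] T.obj N :=
  ∑ i : Fin m, T.suspComp h i

/-- `[f, g] = f ∘ g - (-1)^{(m-1)(n-1)} g ∘ f` for `f ∈ 𝔰T(m)`, `g ∈ 𝔰T(n)`. -/
def bracket {m n N : ℕ} (h : m + n = N + 1) : T.obj m →ₗ[k] T.obj n →ₗ[k] T.obj N :=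
  T.preLie h - (-1 : k) ^ ((m + 1) * (n + 1)) • (T.preLie ((Nat.add_comm n m).trans h)).flip

/-- Successive insertion in `𝔰T` of `f_1, …, f_n` into the last `n` of the `s + n` inputs of an
operation, from left to right. -/
def graft : ∀ (n s : ℕ) (a : Fin n → ℕ) {N : ℕ}, s + ∑ i, a i = N →
    (T.obj (n + s) →ₗ[k] MultilinearMap k (fun i => T.obj (a i)) (T.obj N))
  | 0, s, a, N, h =>
      (MultilinearMap.constLinearEquivOfIsEmpty (R := k) (S := k)
        (M₁ := fun i => T.obj (a i)) (M₂ := T.obj N)).toLinearMap ∘ₗ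
        T.reindex (by rw [← h]; simp)
  | n + 1, s, a, N, h =>
      (multilinearCurryLeftEquiv k (fun i => T.obj (a i)) (T.obj N)).symm.toLinearMap ∘ₗ
        (T.suspComp (m := n + 1 + s) (n := a 0) (N := n + (s + a 0)) (by omega)
          ⟨s, by omega⟩).compr₂
          (graft n (s + a 0) (fun i => a i.succ) (by rw [← h, Fin.sum_univ_succ]; omega))

/-- The operadic composition `t(f_1, …, f_n)` of `𝔰T`. -/
def suspGamma {n N : ℕ} (a : Fin n → ℕ) (h : ∑ i, a i = N) (t : T.obj n) :
    MultilinearMap k (fun i => T.obj (a i)) (T.obj N) :=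
  T.graft n 0 a ((Nat.zero_add _).trans h) t

end Operad

/-! ### Algebras and the operadic cochain complex -/

/-- A `P`-algebra: a vector space `A` with a homomorphism `α : P → End_A`. -/
structure OpAlgebra {k : Type u} [Field k] (P : Operad k) where
  carrier : Type u
  [addCommGroup : AddCommGroup carrier]
  [module : Module k carrier]
  str : Operad.Hom P (endOperad k carrier)

attribute [instance] OpAlgebra.addCommGroup OpAlgebra.module

namespace QuadraticData

variable {k : Type u} [Field k] (D : QuadraticData k) (A : OpAlgebra D.operad)

/-- The operad `End_A ⊗ P^!`. -/
abbrev coeff : Operad k := hadamard (endOperad k A.carrier) D.dualOperad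

/-- `α ⊗ id : (P ⊗ P^!)(n) → (End_A ⊗ P^!)(n)`. -/
def structureMap (n : ℕ) : D.tensorDual.obj n →ₗ[k] (D.coeff A).obj n :=
  TensorProduct.map (A.str.map n) LinearMap.id

/-- `C^m_P(A;A) = [Lin((↓A)^{⊗(m+1)}, ↓A) ⊗ P^!(m+1)]^{Σ_{m+1}} = 𝔰(End_A ⊗ P^!)(m+1)^{Σ_{m+1}}`. -/
abbrev Cochain (m : ℕ) : Type u := (D.coeff A).invariants (m + 1)

/-- The differential `d_P f = [χ, f]` on `C^m_P(A;A)`; the bracket on invariants is induced from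
that of `𝔰(End_A ⊗ P^!)` by identifying invariants with coinvariants through averaging. -/
def differential (m : ℕ) : D.Cochain A m →ₗ[k] D.Cochain A (m + 1) :=
  (D.coeff A).aver (m + 1 + 1) ∘ₗ
    (D.coeff A).bracket (m := 2) (n := m + 1) (N := m + 1 + 1) (by omega)
      (D.structureMap A 2 D.chi) ∘ₗ
    ((D.coeff A).invariants (m + 1)).subtype

/-- The graded vector space `C^*_P(A;A)`. -/
abbrev Cochains : Type u := DirectSum ℕ (fun m => D.Cochain A m)

/-- The inclusion of `C^m_P(A;A)` into `C^*_P(A;A)`. -/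
abbrev incl (m : ℕ) : D.Cochain A m →ₗ[k] D.Cochains A :=
  DirectSum.lof k ℕ (fun m => D.Cochain A m) m

/-- The differential `d_P` on `C^*_P(A;A)`. -/
def totalDifferential : D.Cochains A →ₗ[k] D.Cochains A :=
  DirectSum.toModule k ℕ _ (fun m => D.incl A (m + 1) ∘ₗ D.differential A m)

/-- The map `f ↦ (-1)^{|f|} f` on `C^*_P(A;A)`. -/
def signMap : D.Cochains A →ₗ[k] D.Cochains A :=
  DirectSum.toModule k ℕ _ (fun m => (-1 : k) ^ m • D.incl A m)

/-! ### Natural operations -/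

/-- An `n`-linear operation on `C^*_P(A;A)`, for every `P`-algebra `A`. -/
abbrev Operation (n : ℕ) : Type (u + 1) :=
  ∀ A : OpAlgebra D.operad, MultilinearMap k (fun _ : Fin n => D.Cochains A) (D.Cochains A)

/-- An operation `C^{m_1} ⊗ ⋯ ⊗ C^{m_n} → C^M`, for every `P`-algebra `A`. -/
abbrev HomogeneousOperation {n : ℕ} (m : Fin n → ℕ) (M : ℕ) : Type (u + 1) :=
  ∀ A : OpAlgebra D.operad, MultilinearMap k (fun i => D.Cochain A (m i)) (D.Cochain A M)

/-- The differential on operations of degree `d`: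
`(δ U)(f_1, …, f_n) = d_P U(f_1, …, f_n)
  - (-1)^d ∑_i (-1)^{|f_1| + ⋯ + |f_{i-1}|} U(f_1, …, d_P f_i, …, f_n)`. -/
def delta {n : ℕ} (d : ℕ) (U : D.Operation n) : D.Operation n := fun A =>
  (D.totalDifferential A).compMultilinearMap (U A) -
    (-1 : k) ^ d • ∑ i : Fin n, (U A).compLinearMap (fun j =>
      if j < i then D.signMap A else if j = i then D.totalDifferential A else LinearMap.id)

end QuadraticData

/-- Rooted trees whose white vertices are labelled by `Fin n`, the vertex `w_i` having arity `ar i`,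
whose input legs are labelled by `Fin a`, and whose black vertices are at least binary and
decorated by elements of `P`. The inputs of each vertex are linearly ordered. -/
inductive DecTree {k : Type u} [Field k] (P : Operad k) {n : ℕ} (ar : Fin n → ℕ) (a : ℕ) : Type u
  | leg (j : Fin a) : DecTree P ar a
  | white (i : Fin n) (sub : Fin (ar i) → DecTree P ar a) : DecTree P ar a
  | black (r : ℕ) (hr : 2 ≤ r) (p : P.obj r) (sub : Fin r → DecTree P ar a) : DecTree P ar a

namespace DecTree

variable {k : Type u} [Field k] {P : Operad k} {n : ℕ} {ar : Fin n → ℕ} {a : ℕ}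

/-- The number of input legs labelled `j`. -/
def legCount (j : Fin a) : DecTree P ar a → ℕ
  | leg j' => if j' = j then 1 else 0
  | white _ sub => ∑ c, (sub c).legCount j
  | black _ _ _ sub => ∑ c, (sub c).legCount j

/-- The number of white vertices labelled `i`. -/
def whiteCount (i : Fin n) : DecTree P ar a → ℕ
  | leg _ => 0
  | white i' sub => (if i' = i then 1 else 0) + ∑ c, (sub c).whiteCount i
  | black _ _ _ sub => ∑ c, (sub c).whiteCount i

/-- Each input leg and each white vertex occurs exactly once. -/
def Proper (T : DecTree P ar a) : Prop :=
  (∀ j, T.legCount j = 1) ∧ ∀ i, T.whiteCount i = 1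

/-- Composition along the tree: the white vertex `w_i` is decorated by `φ i`, the black vertices
act through the `P`-algebra structure, and the inputs are `x`. -/
def eval (A : OpAlgebra P)
    (φ : ∀ i, MultilinearMap k (fun _ : Fin (ar i) => A.carrier) A.carrier)
    (x : Fin a → A.carrier) : DecTree P ar a → A.carrier
  | leg j => x j
  | white i sub => φ i (fun c => (sub c).eval A φ x)
  | black r _ p sub =>
      (show MultilinearMap k (fun _ : Fin r => A.carrier) A.carrier from A.str.map r p)
        (fun c => (sub c).eval A φ x)

end DecTree

namespace QuadraticData

variable {k : Type u} [Field k] (D : QuadraticData k)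

/-- `U = U_{(T,Φ)}` for some tree `T` and linear map
`Φ : P^!(m_1+1) ⊗ ⋯ ⊗ P^!(m_n+1) → P^!(M+1)`: the operation `U` is
`Aver ∘ Ũ ∘ (ι ⊗ ⋯ ⊗ ι)`, where
`Ũ(φ_1 ⊗ q_1, …, φ_n ⊗ q_n) = T(φ_1, …, φ_n) ⊗ Φ(q_1, …, q_n)`. -/
def IsTreeOperation {n : ℕ} (m : Fin n → ℕ) (M : ℕ) (U : D.HomogeneousOperation m M) : Prop :=
  ∃ (T : DecTree D.operad (fun i => m i + 1) (M + 1))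
    (Φ : MultilinearMap k (fun i => D.dualOperad.obj (m i + 1)) (D.dualOperad.obj (M + 1))),
    T.Proper ∧ ∀ A : OpAlgebra D.operad,
      ∃ (G : MultilinearMap k
            (fun i => MultilinearMap k (fun _ : Fin (m i + 1) => A.carrier) A.carrier)
            (MultilinearMap k (fun _ : Fin (M + 1) => A.carrier) A.carrier))
        (V : MultilinearMap k (fun i => (D.coeff A).obj (m i + 1)) ((D.coeff A).obj (M + 1))),
        (∀ φ x, G φ x = T.eval A φ x) ∧
        (∀ φ q, V (fun i => φ i ⊗ₜ[k] q i) = G φ ⊗ₜ[k] Φ q) ∧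
        ∀ f, U A f = (D.coeff A).aver (M + 1) (V (fun i => (f i : (D.coeff A).obj (m i + 1))))

/-- `𝓑^d_P(n)`: the `n`-linear operations of degree `d` all of whose components
`C^{m_1} ⊗ ⋯ ⊗ C^{m_n} → C^{m_1 + ⋯ + m_n + d}` are linear combinations of the `U_{(T,Φ)}`. -/
def naturalOperations (n d : ℕ) : Submodule k (D.Operation n) where
  carrier := {U | ∀ m : Fin n → ℕ,
    ∃ V ∈ Submodule.span k {V | D.IsTreeOperation m (∑ i, m i + d) V},
      ∀ A f, U A (fun i => D.incl A (m i) (f i)) = D.incl A (∑ i, m i + d) (V A f)}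
  zero_mem' := fun m => ⟨0, Submodule.zero_mem _, fun A f => by simp⟩
  add_mem' := by
    intro U U' hU hU' m
    obtain ⟨V, hV, e⟩ := hU m
    obtain ⟨V', hV', e'⟩ := hU' m
    exact ⟨V + V', Submodule.add_mem _ hV hV', fun A f => by simp [e, e']⟩
  smul_mem' := by
    intro c U hU m
    obtain ⟨V, hV, e⟩ := hU m
    exact ⟨c • V, Submodule.smul_mem _ c hV, fun A f => by simp [e]⟩

/-! ### Cup products -/

/-- The operation `cup(t)(f_1, …, f_n) = Aver(t(f_1, …, f_n))` of degree `n - 1` determined by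
`t ∈ 𝔰(P ⊗ P^!)(n)`, which acts through `α ⊗ id` by composition in `𝔰(End_A ⊗ P^!)`. -/
def cup {n : ℕ} (hn : 1 ≤ n) (t : D.tensorDual.obj n) : D.Operation n := fun A =>
  MultilinearMap.fromDFinsuppEquiv (fun _ => ℕ) k (M := fun _ m => D.Cochain A m) (fun m =>
    (D.incl A (∑ i, m i + (n - 1)) ∘ₗ (D.coeff A).aver (∑ i, m i + (n - 1) + 1)).compMultilinearMap
      (((D.coeff A).suspGamma (fun i => m i + 1)
        (by rw [Finset.sum_add_distrib]; simp; omega) (D.structureMap A n t)).compLinearMap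
          (fun i => ((D.coeff A).invariants (m i + 1)).subtype)))

/-- `𝓩_P(n)`: the elements of `𝔰(P ⊗ P^!)(n)` that are `δ_P`-cocycles in `𝓑_P(n)`. -/
def cocycles {n : ℕ} (hn : 1 ≤ n) : Set (D.tensorDual.obj n) :=
  {t | D.cup hn t ∈ D.naturalOperations n (n - 1) ∧ D.delta (n - 1) (D.cup hn t) = 0}

end QuadraticData

end

/-!
Write `X(q, t) = q ∘_2 t + (-1)^n ∑_i (t ∘_i q)(1 2 ⋯ i)` for the element that the theorem claims
to vanish exactly for the cocycles, where `q = χ` (`Operad.cocycleDefect`).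

The cup product of every `t` is a natural operation: for `t = p ⊗ q` its components are the tree
operations of the corolla with black root `p`, or, as unary operations are multiples of the unit,
of the tree with a single white vertex (`QuadraticData.cup_mem_naturalOperations`). So the issue is
the vanishing of the differential of `cup(t)`.

The element `χ` is symmetric, because the sign in `𝔰` cancels the one in `E^∨`. Up to averaging, we
therefore have `[χ, x] = 2 χ ∘_2 x - (-1)^{|x|} x ∘ χ` (`Operad.map_bracket`). In `δ(cup(t))(f_1, …,
f_n)`, insertion of `χ` into all inputs of `t(f_1, …, f_n)` is a graded derivation, and it cancels
against the terms with `f_i ∘ χ`. In the remaining terms `χ` is composed with `t`, and one new input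
is left free; moving that input to the front gives
`δ(cup(t))(f_1, …, f_n) = 2 Aver(X(χ, t)(1, f_1, …, f_n))` (`QuadraticData.delta_cup_apply`). If
`X(χ, t) = 0`, then `cup(t)` is a cocycle.

For the converse, let `A` be the free `P`-algebra on variables `x_0, …, x_n`, and let `f_i` be
`pr_i ⊗ 1`, where `pr_i` is a linear endomorphism of `A` that fixes `x_i` and kills the other
variables. At the arguments `x_0, …, x_n`, the summand of `Aver(X(1, f_1, …, f_n))` that belongs to
a permutation `σ ≠ 1` has a vanishing argument, as `σ` moves one of `1, …, n`; the summand of the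
identity is `X` itself, with its first factor considered as an element of `A`
(`QuadraticData.evalVariables_suspAct_graft`). Since `P(n+1)` embeds into `A`
(`Operad.label_id_injective`), this forces `X = 0`.

The free algebra is realized by operations with labelled inputs, `Operad.LabelledOps`, on which the
generators act by composition. It is an algebra over the quadratic operad since composition with a
ternary operation `p` is well defined, and `0` for `p = 0` (`represents_value`). As every operation
is composed of binary ones (`isBinaryComposite`), evaluating `p` at the variables gives back `p`
(`freeAlgebra_str_apply_variables`).
-/

noncomputable section

/-! ### Block permutations -/

/-- `ρ` is the block permutation composed of `σ`, acting on the inputs of an `m`-ary operation, and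
of `τ`, acting on the block of inputs that an `n`-ary operation inserted at `i` brings in. -/
structure IsBlockPerm {m n N : ℕ} (h : m + n = N + 1) (i : Fin m) (σ : Equiv.Perm (Fin m))
    (τ : Equiv.Perm (Fin n)) (ρ : Equiv.Perm (Fin N)) : Prop where
  inner : ∀ y, ρ (Slot.inner h i y) = Slot.inner h (σ i) (τ y)
  outer : ∀ x (hx : x ≠ i), ρ (Slot.outer h i x hx) =
    Slot.outer h (σ i) (σ x) (fun e => hx (σ.injective e))

namespace IsBlockPerm

variable {m n N : ℕ} {h : m + n = N + 1} {i : Fin m}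

theorem mul {σ σ' : Equiv.Perm (Fin m)} {τ τ' : Equiv.Perm (Fin n)} {ρ ρ' : Equiv.Perm (Fin N)}
    (H' : IsBlockPerm h (σ i) σ' τ' ρ') (H : IsBlockPerm h i σ τ ρ) :
    IsBlockPerm h i (σ' * σ) (τ' * τ) (ρ' * ρ) where
  inner y := by simp only [Equiv.Perm.mul_apply, H.inner, H'.inner]
  outer x hx := by
    simp only [Equiv.Perm.mul_apply, H.outer x hx]
    exact H'.outer _ _

theorem unique {σ : Equiv.Perm (Fin m)} {τ : Equiv.Perm (Fin n)} {ρ ρ' : Equiv.Perm (Fin N)}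
    (H : IsBlockPerm h i σ τ ρ) (H' : IsBlockPerm h i σ τ ρ') : ρ = ρ' := by
  ext1 z
  rcases Slot.cases h i z with ⟨y, rfl⟩ | ⟨x, hx, rfl⟩
  · rw [H.inner, H'.inner]
  · rw [H.outer, H'.outer]

/-- Permuting the inputs of the inserted operation does not change the sign. -/
theorem exists_inner (h : m + n = N + 1) (i : Fin m) (τ : Equiv.Perm (Fin n)) :
    ∃ ρ, IsBlockPerm h i 1 τ ρ ∧ Equiv.Perm.sign ρ = Equiv.Perm.sign τ := by
  induction τ using Equiv.Perm.swap_induction_on with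
  | one => exact ⟨1, ⟨fun y => rfl, fun x hx => rfl⟩, by simp⟩
  | swap_mul τ a b hab ih =>
    obtain ⟨ρ, H, hs⟩ := ih
    refine ⟨Equiv.swap (Slot.inner h i a) (Slot.inner h i b) * ρ, ?_, ?_⟩
    · rw [← one_mul (1 : Equiv.Perm (Fin m))]
      refine mul ⟨fun y => ?_, fun x hx => ?_⟩ H
      · simp only [Equiv.swap_apply_def, Equiv.Perm.one_apply, Slot.inner_inj]
        split_ifs <;> rfl
      · simp only [Equiv.Perm.one_apply]
        exact Equiv.swap_apply_of_ne_of_ne (Slot.inner_ne_outer h i _ hx).symm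
          (Slot.inner_ne_outer h i _ hx).symm
    · rw [Equiv.Perm.sign_mul, Equiv.Perm.sign_mul, hs, Equiv.Perm.sign_swap hab,
        Equiv.Perm.sign_swap (by rwa [ne_eq, Slot.inner_inj])]

/-- An adjacent transposition either exchanges two single inputs, or moves the block past a single
input, which is a cycle of length `n + 1`. -/
theorem exists_swap {m : ℕ} (h : m + 1 + n = N + 1) (i : Fin (m + 1)) (j : Fin m) :
    ∃ ρ, IsBlockPerm h i (Equiv.swap j.castSucc j.succ) 1 ρ ∧ Equiv.Perm.sign ρ =
      -(-1) ^ (((i : ℕ) + (Equiv.swap j.castSucc j.succ i : Fin (m + 1))) * (n + 1)) := by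
  have key : ∀ (i : Fin (m + 1)), i = j.castSucc →
      ∃ ρ, IsBlockPerm h i (Equiv.swap j.castSucc j.succ) 1 ρ ∧
        Equiv.Perm.sign ρ = (-1) ^ n := by
    rintro i rfl
    have : NeZero N := ⟨by have := j.2; omega⟩
    have hle : (⟨j, by have := j.2; omega⟩ : Fin N) ≤ ⟨j + n, by have := j.2; omega⟩ := by
      rw [Fin.le_def]; simp
    have hN : (j : ℕ) + n < N := by have := j.2; omega
    refine ⟨Fin.cycleIcc ⟨j, by omega⟩ ⟨j + n, hN⟩, ⟨fun y => ?_, fun x hx => ?_⟩, ?_⟩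
    · rw [Fin.cycleIcc_of_ge_of_lt (by simp [Slot.inner, Fin.le_def])
        (by simp [Slot.inner, Fin.lt_def])]
      have hlt : (j : ℕ) + y + 1 < N := by have := y.2; omega
      ext
      rw [Fin.val_add_one_of_lt' (by simpa [Slot.inner] using hlt)]
      simp [Slot.inner]
      omega
    · have hx' : (x : ℕ) ≠ j := fun e => hx (Fin.ext e)
      by_cases h1 : (x : ℕ) < j
      · rw [Fin.cycleIcc_of_lt (by simp [Slot.outer, Fin.lt_def, h1])]
        have h2 : Equiv.swap j.castSucc j.succ x = x := by
          apply Equiv.swap_apply_of_ne_of_ne <;> simp [Fin.ext_iff] <;> omega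
        simp only [Slot.outer, h2, Fin.lt_def, Equiv.swap_apply_left, Fin.ext_iff, Fin.val_castSucc,
          Fin.val_succ]
        split_ifs <;> omega
      · by_cases h2 : (x : ℕ) = j + 1
        · obtain rfl : x = j.succ := Fin.ext h2
          have : Slot.outer h j.castSucc j.succ hx = ⟨j + n, hN⟩ := by
            simp only [Slot.outer, Fin.lt_def, Fin.ext_iff, Fin.val_castSucc,
              Fin.val_succ]
            split_ifs <;> omega
          rw [this, Fin.cycleIcc_of_last hle]
          simp only [Slot.outer, Fin.lt_def, Equiv.swap_apply_left, Equiv.swap_apply_right,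
            Fin.ext_iff, Fin.val_castSucc, Fin.val_succ]
          split_ifs <;> omega
        · rw [Fin.cycleIcc_of_gt (by
            simp only [Slot.outer, Fin.lt_def, Fin.val_castSucc]
            split_ifs; omega)]
          have h2 : Equiv.swap j.castSucc j.succ x = x := by
            apply Equiv.swap_apply_of_ne_of_ne <;> simp [Fin.ext_iff] <;> omega
          simp only [Slot.outer, h2, Fin.lt_def, Equiv.swap_apply_left, Fin.ext_iff,
            Fin.val_castSucc, Fin.val_succ]
          split_ifs <;> omega
    · rw [Fin.sign_cycleIcc_of_le hle]
      simp
  have odd_sign : ∀ c : ℕ, -(-1 : ℤˣ) ^ ((c + (c + 1)) * (n + 1)) = (-1) ^ n := by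
    intro c
    rw [pow_mul, Odd.neg_one_pow ⟨c, by ring⟩, pow_succ]
    simp
  by_cases h1 : i = j.castSucc
  · obtain ⟨ρ, H, hs⟩ := key i h1
    refine ⟨ρ, H, ?_⟩
    rw [hs, h1, Equiv.swap_apply_left]
    exact (odd_sign j).symm
  · by_cases h2 : i = j.succ
    · -- the inverse of the previous case
      obtain ⟨ρ, H, hs⟩ := key j.castSucc rfl
      subst h2
      refine ⟨ρ⁻¹, ⟨fun y => ?_, fun x hx => ?_⟩, ?_⟩
      · rw [Equiv.Perm.inv_eq_iff_eq, Equiv.swap_apply_right, H.inner, Equiv.swap_apply_left]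
        rfl
      · rw [Equiv.Perm.inv_eq_iff_eq]
        have hne : Equiv.swap j.castSucc j.succ x ≠ j.castSucc := by
          rw [ne_eq, Equiv.swap_apply_eq_iff, Equiv.swap_apply_left]; exact hx
        have := H.outer (Equiv.swap j.castSucc j.succ x) hne
        simp only [Equiv.swap_apply_left, Equiv.swap_apply_self, Equiv.swap_apply_right] at this ⊢
        exact this.symm
      · rw [Equiv.Perm.sign_inv, hs, Equiv.swap_apply_right, ← odd_sign j]
        congr 3
        exact Nat.add_comm _ _
    · have hfix : Equiv.swap j.castSucc j.succ i = i := Equiv.swap_apply_of_ne_of_ne h1 h2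
      refine ⟨Equiv.swap (Slot.outer h i j.castSucc (Ne.symm h1))
        (Slot.outer h i j.succ (Ne.symm h2)), ⟨fun y => ?_, fun x hx => ?_⟩, ?_⟩
      · simp only [hfix, Equiv.Perm.one_apply]
        exact Equiv.swap_apply_of_ne_of_ne (Slot.inner_ne_outer h i _ _)
          (Slot.inner_ne_outer h i _ _)
      · simp only [hfix]
        simp only [Equiv.swap_apply_def, Slot.outer_inj]
        split_ifs <;> rfl
      · rw [Equiv.Perm.sign_swap (by
          rw [ne_eq, Slot.outer_inj]; simp [Fin.ext_iff]), hfix,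
          Even.neg_one_pow (Even.mul_right ⟨(i : ℕ), rfl⟩ _)]

/-- Permuting the inputs of the outer operation: the block is displaced by `σ i - i` places. -/
theorem exists_outer (h : m + n = N + 1) (σ : Equiv.Perm (Fin m)) (i : Fin m) :
    ∃ ρ, IsBlockPerm h i σ 1 ρ ∧
      Equiv.Perm.sign ρ = Equiv.Perm.sign σ * (-1) ^ (((i : ℕ) + σ i) * (n + 1)) := by
  obtain _ | m := m
  · exact i.elim0
  have hσ : σ ∈ Submonoid.closure
      (Set.range fun i : Fin m => Equiv.swap i.castSucc i.succ) := by
    rw [Equiv.Perm.mclosure_swap_castSucc_succ]; trivial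
  induction hσ using Submonoid.closure_induction generalizing i with
  | mem x hx =>
    obtain ⟨j, rfl⟩ := hx
    obtain ⟨ρ, H, hs⟩ := exists_swap h i j
    refine ⟨ρ, H, ?_⟩
    rw [hs, Equiv.Perm.sign_swap (by simp [Fin.ext_iff])]
    simp
  | one =>
    refine ⟨1, ⟨fun y => rfl, fun x hx => rfl⟩, ?_⟩
    rw [Equiv.Perm.one_apply, Even.neg_one_pow (Even.mul_right ⟨(i : ℕ), rfl⟩ _)]
    simp
  | mul σ' σ _ _ ih' ih =>
    obtain ⟨ρ, H, hs⟩ := ih i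
    obtain ⟨ρ', H', hs'⟩ := ih' (σ i)
    refine ⟨ρ' * ρ, ?_, ?_⟩
    · rw [← one_mul (1 : Equiv.Perm (Fin n))]
      exact mul H' H
    · have e : (((σ i : Fin (m + 1)) : ℕ) + σ' (σ i)) * (n + 1) + ((i : ℕ) + σ i) * (n + 1) =
          2 * ((σ i : ℕ) * (n + 1)) + ((i : ℕ) + (σ' * σ) i) * (n + 1) := by
        rw [Equiv.Perm.mul_apply]; ring
      rw [Equiv.Perm.sign_mul, hs, hs', Equiv.Perm.sign_mul, mul_mul_mul_comm, ← pow_add, e,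
        pow_add, pow_mul]
      simp

/-- Block permutations exist. -/
theorem exists_rel (h : m + n = N + 1) (i : Fin m) (σ : Equiv.Perm (Fin m))
    (τ : Equiv.Perm (Fin n)) : ∃ ρ, IsBlockPerm h i σ τ ρ := by
  obtain ⟨ρ, H, -⟩ := exists_outer h σ i
  obtain ⟨ρ', H', -⟩ := exists_inner h (σ i) τ
  exact ⟨ρ' * ρ, by simpa using mul H' H⟩

theorem sign_eq {σ : Equiv.Perm (Fin m)} {τ : Equiv.Perm (Fin n)} {ρ : Equiv.Perm (Fin N)}
    (H : IsBlockPerm h i σ τ ρ) : Equiv.Perm.sign ρ =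
      Equiv.Perm.sign σ * Equiv.Perm.sign τ * (-1) ^ (((i : ℕ) + σ i) * (n + 1)) := by
  obtain ⟨ρ₁, H₁, hs₁⟩ := exists_outer h σ i
  obtain ⟨ρ₂, H₂, hs₂⟩ := exists_inner h (σ i) τ
  have : ρ = ρ₂ * ρ₁ := unique H (by simpa using mul H₂ H₁)
  rw [this, Equiv.Perm.sign_mul, hs₁, hs₂, mul_left_comm, mul_assoc, mul_left_comm]

end IsBlockPerm

/-! ### The axioms of the suspended operad -/

namespace Operad

variable {k : Type u} [Field k] (T : Operad k)

theorem suspComp_apply {m n N : ℕ} (h : m + n = N + 1) (i : Fin m) (p : T.obj m) (q : T.obj n) :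
    T.suspComp h i p q = (-1 : k) ^ ((i : ℕ) * (n + 1)) • T.comp h i p q := rfl

theorem neg_one_pow_eq_of_mod {a b : ℕ} (h : a % 2 = b % 2) : (-1 : k) ^ a = (-1) ^ b := by
  rw [← Nat.div_add_mod a 2, ← Nat.div_add_mod b 2, h, pow_add, pow_add, pow_mul, pow_mul]
  simp

/-- Sequential associativity in `𝔰T`. -/
theorem suspComp_assoc {m n l M L N : ℕ} (h₁ : m + n = M + 1) (h₂ : M + l = N + 1)
    (h₃ : n + l = L + 1) (h₄ : m + L = N + 1) (i : Fin m) (j : Fin n) (z : Fin M)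
    (hz : (z : ℕ) = i + j) (p : T.obj m) (q : T.obj n) (r : T.obj l) :
    T.suspComp h₂ z (T.suspComp h₁ i p q) r = T.suspComp h₄ i p (T.suspComp h₃ j q r) := by
  obtain rfl : z = Slot.inner h₁ i j := Fin.ext hz
  simp only [suspComp_apply, map_smul, LinearMap.smul_apply, smul_smul,
    T.comp_assoc h₁ h₂ h₃ h₄, ← pow_add]
  congr 1
  have e : (i : ℕ) * (L + 1) + 2 * i = i * (n + 1) + i * (l + 1) := by
    rw [← h₃]; ring
  apply neg_one_pow_eq_of_mod
  have e' : ((Slot.inner h₁ i j : Fin M) : ℕ) * (l + 1) = i * (l + 1) + j * (l + 1) := by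
    simp [Slot.inner, add_mul]
  rw [e']
  omega

/-- Parallel associativity in `𝔰T`: the operations `q` and `r` are interchanged according to the
Koszul rule. -/
theorem suspComp_comm {m n l M L N : ℕ} (h₁ : m + n = M + 1) (h₂ : M + l = N + 1)
    (h₃ : m + l = L + 1) (h₄ : L + n = N + 1) (i j : Fin m) (hij : i < j) (z : Fin M)
    (hz : (z : ℕ) + 1 = j + n) (w : Fin L) (hw : (w : ℕ) = i)
    (p : T.obj m) (q : T.obj n) (r : T.obj l) :
    T.suspComp h₂ z (T.suspComp h₁ i p q) r =
      (-1 : k) ^ ((n + 1) * (l + 1)) • T.suspComp h₄ w (T.suspComp h₃ j p r) q := by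
  have hlt : (i : ℕ) < j := hij
  obtain rfl : z = Slot.outer h₁ i j hij.ne' := by
    simp only [Slot.outer, Fin.ext_iff, Fin.lt_def]
    split_ifs <;> omega
  obtain rfl : w = Slot.outer h₃ j i hij.ne := by
    simp only [Slot.outer, Fin.ext_iff, Fin.lt_def]
    split_ifs; omega
  simp only [suspComp_apply, map_smul, LinearMap.smul_apply, smul_smul,
    T.comp_comm h₁ h₂ h₃ h₄ i j hij.ne, ← pow_add]
  congr 1
  rw [hw]
  apply neg_one_pow_eq_of_mod
  have e : ((Slot.outer h₁ i j hij.ne' : Fin M) : ℕ) * (l + 1) + 2 * (l + 1) =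
      j * (l + 1) + (n + 1) * (l + 1) := by
    rw [← add_mul, ← add_mul]
    congr 1
    omega
  omega

theorem suspAct_one {n : ℕ} (p : T.obj n) : T.suspAct 1 p = p := by
  simp [suspAct, T.act_one]

theorem suspComp_suspAct {m n N : ℕ} {h : m + n = N + 1} {i : Fin m} {σ : Equiv.Perm (Fin m)}
    {τ : Equiv.Perm (Fin n)} {ρ : Equiv.Perm (Fin N)} (H : IsBlockPerm h i σ τ ρ)
    (p : T.obj m) (q : T.obj n) :
    T.suspComp h (σ i) (T.suspAct σ p) (T.suspAct τ q) = T.suspAct ρ (T.suspComp h i p q) := by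
  simp only [suspAct, suspComp_apply, map_smul, LinearMap.smul_apply, smul_smul,
    T.comp_act h i σ τ ρ H.inner H.outer, H.sign_eq]
  congr 1
  push_cast
  rw [add_mul, pow_add]
  have : ((-1 : k) ^ ((i : ℕ) * (n + 1))) * (-1) ^ ((i : ℕ) * (n + 1)) = 1 := by
    rw [← pow_add, ← two_mul, pow_mul]; simp
  linear_combination (-((-1 : k) ^ (((σ i : Fin m) : ℕ) * (n + 1))) *
    ((Equiv.Perm.sign σ : ℤ) : k) * ((Equiv.Perm.sign τ : ℤ) : k)) * this

theorem coe_aver (n : ℕ) (x : T.obj n) : (T.aver n x : T.obj n) =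
    (n.factorial : k)⁻¹ • ∑ σ : Equiv.Perm (Fin n), T.suspAct σ x := by
  change ((n.factorial : k)⁻¹ • ∑ σ : Equiv.Perm (Fin n), T.suspAct σ) x = _
  rw [LinearMap.smul_apply, LinearMap.sum_apply]

theorem aver_suspAct {n : ℕ} (σ : Equiv.Perm (Fin n)) (x : T.obj n) :
    T.aver n (T.suspAct σ x) = T.aver n x := by
  ext
  simp only [coe_aver, ← suspAct_mul]
  congr 1
  exact Fintype.sum_equiv (Equiv.mulRight σ) _ _ (fun _ => rfl)

/-- A linear map that does not distinguish `x` from its translates `x σ`, up to averaging, does not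
distinguish `x` from its average. -/
theorem aver_map_aver [CharZero k] {n N : ℕ} (L : T.obj n →ₗ[k] T.obj N)
    (hL : ∀ σ x, T.aver N (L (T.suspAct σ x)) = T.aver N (L x)) (x : T.obj n) :
    T.aver N (L (T.aver n x : T.obj n)) = T.aver N (L x) := by
  rw [coe_aver, map_smul, map_sum, map_smul, map_sum, Finset.sum_congr rfl fun σ _ => hL σ x,
    Finset.sum_const, Finset.card_univ, Fintype.card_perm, Fintype.card_fin,
    ← Nat.cast_smul_eq_nsmul k, smul_smul, inv_mul_cancel₀, one_smul]
  exact_mod_cast n.factorial_ne_zero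

end Operad

/-! ### Successive insertions -/

namespace Operad

variable {k : Type u} [Field k] (T : Operad k)

theorem reindex_rfl {a : ℕ} (h : a = a) (x : T.obj a) : T.reindex h x = x := rfl

/-- Successive insertion in `𝔰T` of the operations `F 0, …, F (n - 1)`, bundled with their arities,
into the last `n` of the `M = n + s` inputs of an operation. -/
def graftSeq : ∀ (n s : ℕ) (F : Fin n → Σ a, T.obj a) {M N : ℕ}, M = n + s →
    s + ∑ i, (F i).1 = N → (T.obj M →ₗ[k] T.obj N)
  | 0, _, _, _, _, hM, h => T.reindex (by rw [← h, hM]; simp)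
  | n + 1, s, F, M, _, hM, h =>
      graftSeq n (s + (F 0).1) (Fin.tail F) (M := n + (s + (F 0).1)) rfl
        (by rw [← h, Fin.sum_univ_succ]; simp only [Fin.tail]; omega) ∘ₗ
      (T.suspComp (m := M) (n := (F 0).1) (N := n + (s + (F 0).1)) (by omega)
        ⟨s, by omega⟩).flip (F 0).2

theorem graft_apply {n s : ℕ} {a : Fin n → ℕ} {N : ℕ} (h : s + ∑ i, a i = N) (p : T.obj (n + s))
    (f : ∀ i, T.obj (a i)) :
    T.graft n s a h p f = T.graftSeq n s (fun i => ⟨a i, f i⟩) rfl h p := by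
  induction n generalizing s with
  | zero => rfl
  | succ n ih =>
    rw [graft, graftSeq]
    simp only [LinearMap.comp_apply, LinearMap.flip_apply]
    exact ih _ _ _

variable {T}

theorem graftSeq_congr {n s : ℕ} {F F' : Fin n → Σ a, T.obj a} {M N : ℕ} (hF : F = F')
    (hM : M = n + s) (h : s + ∑ i, (F i).1 = N) (h' : s + ∑ i, (F' i).1 = N) (p : T.obj M) :
    T.graftSeq n s F hM h p = T.graftSeq n s F' hM h' p := by
  subst hF; rfl

theorem graftSeq_of_tail_eq {n s : ℕ} {G : Fin (n + 1) → Σ a, T.obj a} {f : Σ a, T.obj a}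
    {F : Fin n → Σ a, T.obj a} (hf : G 0 = f) (hF : Fin.tail G = F) {M N M' s' : ℕ}
    (hM : M = n + 1 + s) (h : s + ∑ i, (G i).1 = N)
    (hs' : s' = s + f.1) (hM' : M' = n + s') (h' : s' + ∑ i, (F i).1 = N)
    (hc : M + f.1 = M' + 1) (i : Fin M) (hi : (i : ℕ) = s) (p : T.obj M) :
    T.graftSeq (n + 1) s G hM h p = T.graftSeq n s' F hM' h' (T.suspComp hc i p f.2) := by
  subst hf hF hs' hM' hi
  rfl

theorem graftSeq_succ {n s : ℕ} (F : Fin (n + 1) → Σ a, T.obj a) {M N M' s' : ℕ}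
    (hM : M = n + 1 + s) (h : s + ∑ i, (F i).1 = N)
    (hs' : s' = s + (F 0).1) (hM' : M' = n + s') (h' : s' + ∑ i, (Fin.tail F i).1 = N)
    (hc : M + (F 0).1 = M' + 1) (i : Fin M) (hi : (i : ℕ) = s) (p : T.obj M) :
    T.graftSeq (n + 1) s F hM h p =
      T.graftSeq n s' (Fin.tail F) hM' h' (T.suspComp hc i p (F 0).2) := by
  exact graftSeq_of_tail_eq rfl rfl hM h hs' hM' h' hc i hi p

theorem graftSeq_update_zero {n s : ℕ} (F : Fin (n + 1) → Σ a, T.obj a) {a : ℕ} (x : T.obj a)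
    {M N M' s' : ℕ} (hM : M = n + 1 + s)
    (h : s + ∑ i, (Function.update F 0 ⟨a, x⟩ i).1 = N)
    (hs' : s' = s + a) (hM' : M' = n + s') (h' : s' + ∑ i, (Fin.tail F i).1 = N)
    (hc : M + a = M' + 1) (i : Fin M) (hi : (i : ℕ) = s) (p : T.obj M) :
    T.graftSeq (n + 1) s (Function.update F 0 ⟨a, x⟩) hM h p =
      T.graftSeq n s' (Fin.tail F) hM' h' (T.suspComp hc i p x) := by
  exact graftSeq_of_tail_eq (Function.update_self ..) (Fin.tail_update_zero ..) hM h hs' hM' h' hc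
    i hi p

theorem graftSeq_update_succ {n s : ℕ} (F : Fin (n + 1) → Σ a, T.obj a) (j : Fin n)
    (y : Σ a, T.obj a) {M N M' s' : ℕ} (hM : M = n + 1 + s)
    (h : s + ∑ i, (Function.update F j.succ y i).1 = N)
    (hs' : s' = s + (F 0).1) (hM' : M' = n + s')
    (h' : s' + ∑ i, (Function.update (Fin.tail F) j y i).1 = N)
    (hc : M + (F 0).1 = M' + 1) (i : Fin M) (hi : (i : ℕ) = s) (p : T.obj M) :
    T.graftSeq (n + 1) s (Function.update F j.succ y) hM h p =
      T.graftSeq n s' (Function.update (Fin.tail F) j y) hM' h' (T.suspComp hc i p (F 0).2) := by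
  exact graftSeq_of_tail_eq (Function.update_of_ne (Fin.succ_ne_zero j).symm ..)
    (Fin.tail_update_succ ..) hM h hs' hM' h' hc i hi p

theorem sum_tail_arity {n s : ℕ} {F : Fin (n + 1) → Σ a, T.obj a} {N : ℕ}
    (h : s + ∑ i, (F i).1 = N) : s + (F 0).1 + ∑ i, (Fin.tail F i).1 = N := by
  rw [← h, Fin.sum_univ_succ, add_assoc]; rfl

theorem sum_update_arity {n s : ℕ} {F : Fin n → Σ a, T.obj a} {N N' : ℕ}
    (h : s + ∑ i, (F i).1 = N) (hc : N + 2 = N' + 1) (i : Fin n) (y : Σ a, T.obj a)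
    (hy : y.1 = (F i).1 + 1) : s + ∑ j, (Function.update F i y j).1 = N' := by
  have e : (fun j => (Function.update F i y j).1) =
      Function.update (fun j => (F j).1) i ((F i).1 + 1) := by
    funext j
    by_cases hj : j = i
    · subst hj; simp [hy]
    · simp [hj]
  rw [e, Finset.sum_update_of_mem (Finset.mem_univ i)]
  rw [← Finset.add_sum_erase _ _ (Finset.mem_univ i), ← Finset.sdiff_singleton_eq_erase] at h
  omega

theorem suspComp_reindex_left {m m' n N N' : ℕ} (e : m = m') (e' : N = N') (h : m + n = N + 1)
    (h' : m' + n = N' + 1) (i : Fin m) (i' : Fin m') (hi : (i : ℕ) = i') (p : T.obj m)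
    (q : T.obj n) :
    T.suspComp h' i' (T.reindex e p) q = T.reindex e' (T.suspComp h i p q) := by
  subst e e'
  obtain rfl : i = i' := Fin.ext hi
  rfl

theorem suspComp_reindex_right {m n n' N N' : ℕ} (e : n = n') (e' : N = N') (h : m + n = N + 1)
    (h' : m + n' = N' + 1) (i : Fin m) (p : T.obj m) (q : T.obj n) :
    T.suspComp h' i p (T.reindex e q) = T.reindex e' (T.suspComp h i p q) := by
  subst e e'
  rfl

/-- `q ∘_2 p(f_1, …, f_n) = (q ∘_2 p)(1, f_1, …, f_n)`. -/
theorem suspComp_graftSeq_right {n s : ℕ} (F : Fin n → Σ a, T.obj a) {M N M' N' : ℕ}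
    (hM : M = n + s) (h : s + ∑ i, (F i).1 = N) (hM' : M' = n + (s + 1))
    (h' : s + 1 + ∑ i, (F i).1 = N') (hc : 2 + N = N' + 1) (hc' : 2 + M = M' + 1)
    (q : T.obj 2) (p : T.obj M) :
    T.suspComp hc 1 q (T.graftSeq n s F hM h p) =
      T.graftSeq n (s + 1) F hM' h' (T.suspComp hc' 1 q p) := by
  induction n generalizing s M M' with
  | zero => exact suspComp_reindex_right _ _ _ _ _ _ _
  | succ n ih =>
    have h1 := sum_tail_arity h
    have h2 := sum_tail_arity h'
    rw [graftSeq_succ (s' := s + (F 0).1) (M' := n + (s + (F 0).1)) F hM h rfl rfl h1 (by omega)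
        ⟨s, by omega⟩ rfl,
      graftSeq_succ (s' := s + (F 0).1 + 1) (M' := n + (s + (F 0).1 + 1)) F hM' h' (by omega) rfl
        (by omega) (by omega) ⟨s + 1, by omega⟩ rfl,
      ih (Fin.tail F) rfl h1 rfl (by omega) (by omega)]
    congr 1
    exact (T.suspComp_assoc _ _ _ _ _ _ _ (Nat.add_comm _ _) _ _ _).symm

/-- Insertion into one of the first `s` inputs is moved past `f_1, …, f_n` at the cost of the
Koszul sign. -/
theorem suspComp_graftSeq_left {n s : ℕ} (F : Fin n → Σ a, T.obj a) {M N M' N' : ℕ}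
    (hM : M = n + s) (h : s + ∑ i, (F i).1 = N) (hM' : M' = n + (s + 1))
    (h' : s + 1 + ∑ i, (F i).1 = N') (hc : N + 2 = N' + 1) (hc' : M + 2 = M' + 1)
    (z : Fin N) (hz : (z : ℕ) < s) (w : Fin M) (hw : (w : ℕ) = z) (p : T.obj M) (q : T.obj 2) :
    T.suspComp hc z (T.graftSeq n s F hM h p) q =
      (∏ j, (-1 : k) ^ ((F j).1 + 1)) •
        T.graftSeq n (s + 1) F hM' h' (T.suspComp hc' w p q) := by
  induction n generalizing s M M' with
  | zero =>
    rw [Finset.univ_eq_empty, Finset.prod_empty, one_smul]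
    exact suspComp_reindex_left _ _ _ _ _ _ hw _ _
  | succ n ih =>
    have h1 := sum_tail_arity h
    have h2 := sum_tail_arity h'
    rw [graftSeq_succ (s' := s + (F 0).1) (M' := n + (s + (F 0).1)) F hM h rfl rfl h1 (by omega)
        ⟨s, by omega⟩ rfl,
      graftSeq_succ (s' := s + (F 0).1 + 1) (M' := n + (s + (F 0).1 + 1)) F hM' h' (by omega) rfl
        (by omega) (by omega) ⟨s + 1, by omega⟩ rfl,
      ih (Fin.tail F) rfl h1 rfl (by omega) (by omega) (by omega) ⟨z, by omega⟩ rfl,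
      T.suspComp_comm (L := n + (s + (F 0).1)) hc' (by omega) (by omega) (by omega) w
        ⟨s, by omega⟩ (by rw [Fin.lt_def, hw]; exact hz)
        ⟨s + 1, by omega⟩ rfl ⟨z, by omega⟩ hw.symm, map_smul, smul_smul, Fin.prod_univ_succ]
    congr 1
    rw [mul_right_comm, ← pow_add, neg_one_pow_eq_of_mod (b := 0) (by omega), pow_zero, one_mul]
    rfl

/-- A permutation of the first `s` inputs of `p` permutes the inputs of `p(…, f_1, …, f_n)`. -/
theorem aver_graftSeq_suspAct {n s : ℕ} (F : Fin n → Σ a, T.obj a) {M N : ℕ}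
    (hM : M = n + s) (h : s + ∑ i, (F i).1 = N) (ρ : Equiv.Perm (Fin M))
    (hρ : ∀ x : Fin M, s ≤ x → ρ x = x) (p : T.obj M) :
    T.aver N (T.graftSeq n s F hM h (T.suspAct ρ p)) = T.aver N (T.graftSeq n s F hM h p) := by
  induction n generalizing s M with
  | zero =>
    obtain rfl : M = N := by rw [← h, hM]; simp
    exact T.aver_suspAct ρ p
  | succ n ih =>
    have h1 := sum_tail_arity h
    rw [graftSeq_succ (s' := s + (F 0).1) (M' := n + (s + (F 0).1)) F hM h rfl rfl h1 (by omega)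
        ⟨s, by omega⟩ rfl,
      graftSeq_succ (s' := s + (F 0).1) (M' := n + (s + (F 0).1)) F hM h rfl rfl h1 (by omega)
        ⟨s, by omega⟩ rfl]
    have hs : ρ ⟨s, by omega⟩ = ⟨s, by omega⟩ := hρ _ le_rfl
    obtain ⟨ρ', H⟩ := IsBlockPerm.exists_rel (n := (F 0).1) (N := n + (s + (F 0).1)) (by omega)
      (⟨s, by omega⟩ : Fin M) ρ 1
    have := T.suspComp_suspAct H p (F 0).2
    rw [suspAct_one, hs] at this
    rw [this]
    refine ih _ _ _ _ (fun x hx => ?_) _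
    obtain ⟨y, e⟩ | ⟨w, hw, e⟩ := Slot.cases (m := M) (n := (F 0).1) (by omega) ⟨s, by omega⟩ x
    · exfalso
      have := congrArg Fin.val e
      simp only [Slot.inner] at this
      omega
    · have hw' : s ≤ (w : ℕ) := by
        by_contra hlt
        have e' := congrArg Fin.val e
        simp only [Slot.outer, Fin.lt_def] at e'
        rw [if_pos (by omega)] at e'
        omega
      rw [e, H.outer w hw]
      simp only [hs, hρ w hw']

/-- Up to averaging, permuting the inputs of one of the inserted operations has no effect. -/
theorem aver_graftSeq_update_suspAct {n s : ℕ} (F : Fin n → Σ a, T.obj a) (i : Fin n) {a M N : ℕ}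
    (τ : Equiv.Perm (Fin a)) (x : T.obj a) (hM : M = n + s)
    (h : s + ∑ j, (Function.update F i ⟨a, T.suspAct τ x⟩ j).1 = N)
    (h' : s + ∑ j, (Function.update F i ⟨a, x⟩ j).1 = N) (p : T.obj M) :
    T.aver N (T.graftSeq n s (Function.update F i ⟨a, T.suspAct τ x⟩) hM h p) =
      T.aver N (T.graftSeq n s (Function.update F i ⟨a, x⟩) hM h' p) := by
  induction n generalizing s M with
  | zero => exact i.elim0
  | succ n ih =>
    have h1 := sum_tail_arity h
    have h2 := sum_tail_arity h'
    cases i using Fin.cases with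
    | zero =>
      rw [Function.update_self, Fin.tail_update_zero] at h1 h2
      dsimp only at h1 h2
      rw [graftSeq_update_zero (s' := s + a) (M' := n + (s + a)) F _ hM h rfl rfl h1 (by omega)
          ⟨s, by omega⟩ rfl,
        graftSeq_update_zero (s' := s + a) (M' := n + (s + a)) F _ hM h' rfl rfl h1 (by omega)
          ⟨s, by omega⟩ rfl]
      obtain ⟨ρ', H⟩ := IsBlockPerm.exists_rel (n := a) (N := n + (s + a)) (by omega)
        (⟨s, by omega⟩ : Fin M) 1 τ
      have := T.suspComp_suspAct H p x
      rw [suspAct_one, Equiv.Perm.one_apply] at this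
      rw [this]
      refine aver_graftSeq_suspAct _ _ _ _ (fun x hx => ?_) _
      obtain ⟨y, e⟩ | ⟨w, hw, e⟩ := Slot.cases (m := M) (n := a) (by omega) ⟨s, by omega⟩ x
      · exfalso
        have := congrArg Fin.val e
        simp only [Slot.inner] at this
        omega
      · rw [e, H.outer w hw]
        simp only [Equiv.Perm.one_apply]
    | succ j =>
      rw [Fin.tail_update_succ, Function.update_of_ne (Fin.succ_ne_zero j).symm] at h1 h2
      rw [graftSeq_update_succ (s' := s + (F 0).1) (M' := n + (s + (F 0).1)) F j _ hM h rfl rfl h1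
          (by omega) ⟨s, by omega⟩ rfl,
        graftSeq_update_succ (s' := s + (F 0).1) (M' := n + (s + (F 0).1)) F j _ hM h' rfl rfl h2
          (by omega) ⟨s, by omega⟩ rfl]
      exact ih _ _ _ _ _ _

/-- `p(f_1, …, f_n)` is linear in each `f_i`. -/
theorem exists_graftSeq_update {n s : ℕ} (F : Fin n → Σ a, T.obj a) (i : Fin n) {a M N : ℕ}
    (hM : M = n + s) (h : s + ∑ j, (Function.update F i ⟨a, 0⟩ j).1 = N) (p : T.obj M) :
    ∃ L : T.obj a →ₗ[k] T.obj N, ∀ x (hx : s + ∑ j, (Function.update F i ⟨a, x⟩ j).1 = N),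
      T.graftSeq n s (Function.update F i ⟨a, x⟩) hM hx p = L x := by
  induction n generalizing s M with
  | zero => exact i.elim0
  | succ n ih =>
    have h1 := sum_tail_arity h
    cases i using Fin.cases with
    | zero =>
      rw [Function.update_self, Fin.tail_update_zero] at h1
      dsimp only at h1
      refine ⟨T.graftSeq n (s + a) (Fin.tail F) (M := n + (s + a)) rfl h1 ∘ₗ
        T.suspComp (by omega) ⟨s, by omega⟩ p, fun x hx => ?_⟩
      exact graftSeq_update_zero F _ hM hx rfl rfl h1 (by omega) ⟨s, by omega⟩ rfl p
    | succ j =>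
      rw [Fin.tail_update_succ, Function.update_of_ne (Fin.succ_ne_zero j).symm] at h1
      obtain ⟨L, hL⟩ := ih (Fin.tail F) j (M := n + (s + (F 0).1)) rfl h1
        (T.suspComp (by omega) (⟨s, by omega⟩ : Fin M) p (F 0).2)
      refine ⟨L, fun x hx => ?_⟩
      have h2 := sum_tail_arity hx
      rw [Fin.tail_update_succ, Function.update_of_ne (Fin.succ_ne_zero j).symm] at h2
      rw [← hL x h2]
      exact graftSeq_update_succ F j _ hM hx rfl rfl h2 (by omega) ⟨s, by omega⟩ rfl p

end Operad

/-! ### The bracket with a binary operation and insertions -/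

namespace Operad

variable {k : Type u} [Field k] {T : Operad k}

theorem sum_fin_ite_le {V : Type*} [AddCommMonoid V] {N s a : ℕ} (h : s + a ≤ N) (f : Fin N → V) :
    ∑ z : Fin N, (if s ≤ (z : ℕ) then f z else 0) =
      ∑ y : Fin a, f ⟨s + y, by omega⟩ + ∑ z : Fin N, (if s + a ≤ (z : ℕ) then f z else 0) := by
  have e : ∀ z : Fin N, (if s ≤ (z : ℕ) then f z else 0) =
      (if s ≤ (z : ℕ) ∧ (z : ℕ) < s + a then f z else 0) + if s + a ≤ (z : ℕ) then f z else 0 := by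
    intro z
    split_ifs <;> first | omega | simp
  rw [Finset.sum_congr rfl fun z _ => e z, Finset.sum_add_distrib]
  congr 1
  rw [← Finset.sum_filter]
  symm
  refine Finset.sum_bij (fun y _ => ⟨s + y, by omega⟩) ?_ ?_ ?_ ?_
  · intro y _
    simp
  · intro y _ y' _ e
    simpa [Fin.ext_iff] using e
  · intro z hz
    simp only [Finset.mem_filter, Finset.mem_univ, true_and] at hz
    exact ⟨⟨z - s, by omega⟩, Finset.mem_univ _, by ext; simp; omega⟩
  · intro y _
    rfl

theorem preLie_apply {m n N : ℕ} (h : m + n = N + 1) (p : T.obj m) (q : T.obj n) :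
    T.preLie h p q = ∑ i, T.suspComp h i p q := by
  simp only [preLie, LinearMap.sum_apply]

/-- Insertion of `q` into all inputs that come from the `f_i`: it acts on `p(f_1, …, f_n)` as a
graded derivation. -/
theorem sum_suspComp_graftSeq {n s : ℕ} (F : Fin n → Σ a, T.obj a) {M N N' : ℕ}
    (hM : M = n + s) (h : s + ∑ i, (F i).1 = N) (hc : N + 2 = N' + 1) (p : T.obj M)
    (q : T.obj 2) :
    ∑ z : Fin N, (if s ≤ (z : ℕ) then T.suspComp hc z (T.graftSeq n s F hM h p) q else 0) =
      ∑ i : Fin n, (∏ j : Fin n, if i < j then (-1 : k) ^ ((F j).1 + 1) else 1) •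
        T.graftSeq n s (Function.update F i
          ⟨(F i).1 + 1, T.preLie (n := 2) (N := (F i).1 + 1) rfl (F i).2 q⟩) hM
          (sum_update_arity h hc i _ rfl) p := by
  induction n generalizing s M with
  | zero =>
    rw [Finset.univ_eq_empty (α := Fin 0), Finset.sum_empty]
    refine Finset.sum_eq_zero fun z _ => if_neg ?_
    simp only [Finset.univ_eq_empty, Finset.sum_empty] at h
    omega
  | succ n ih =>
    have h1 := sum_tail_arity h
    have e := graftSeq_succ (s' := s + (F 0).1) (M' := n + (s + (F 0).1)) F hM h rfl rfl h1
      (by omega) ⟨s, by omega⟩ rfl p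
    rw [Fin.sum_univ_succ, sum_fin_ite_le (a := (F 0).1) (by omega)]
    congr 1
    · rw [graftSeq_update_zero (s' := s + ((F 0).1 + 1)) (M' := n + (s + ((F 0).1 + 1))) F _ hM _
        rfl rfl (by omega) (by omega) ⟨s, by omega⟩ rfl, preLie_apply]
      simp only [map_sum, Finset.smul_sum]
      refine Finset.sum_congr rfl fun y _ => ?_
      rw [e, suspComp_graftSeq_left (M' := n + (s + ((F 0).1 + 1))) (Fin.tail F) rfl h1
        rfl (by omega) hc (by omega) ⟨s + y, by omega⟩ (by simp) ⟨s + y, by omega⟩ rfl,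
        T.suspComp_assoc (m := M) (n := (F 0).1) (l := 2) (L := (F 0).1 + 1) _ _ rfl (by omega)
          ⟨s, by omega⟩ y _ rfl]
      congr 1
      rw [Fin.prod_univ_succ]
      simp [Fin.tail]
    · rw [e, ih (Fin.tail F) rfl h1]
      refine Finset.sum_congr rfl fun i _ => ?_
      rw [graftSeq_update_succ (s' := s + (F 0).1) (M' := n + (s + (F 0).1)) F i _ hM _ rfl rfl
        (sum_update_arity h1 hc i _ rfl) (by omega) ⟨s, by omega⟩ rfl]
      congr 1
      rw [Fin.prod_univ_succ]
      simp [Fin.tail]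

theorem cycleRange_val {n : ℕ} (i z : Fin n) : (Fin.cycleRange i z : ℕ) =
    if z < i then (z : ℕ) + 1 else if z = i then 0 else z := by
  obtain _ | n := n
  · exact i.elim0
  rcases lt_trichotomy z i with h | h | h
  · rw [if_pos h, Fin.coe_cycleRange_of_lt h]
  · subst h; simp
  · rw [if_neg h.not_gt, if_neg h.ne', Fin.cycleRange_of_gt h]

/-- Insertion into `x c`, for a cycle `c` that shifts the slot of insertion by one. -/
theorem suspComp_suspAct_cycleRange {m n N : ℕ} (h : m + n = N + 1) (i i' j : Fin m) (hij : i < j)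
    (hi : (i' : ℕ) = i + 1) (z : Fin N) (hz : (z : ℕ) + 1 = j + n) (p : T.obj m) (q : T.obj n) :
    T.suspComp h i' (T.suspAct (Fin.cycleRange j) p) q =
      T.suspAct (Fin.cycleRange z) (T.suspComp h i p q) := by
  have hlt : (i : ℕ) < j := hij
  have hi' : Fin.cycleRange j i = i' := by
    ext; rw [cycleRange_val, if_pos hij, hi]
  have H : IsBlockPerm h i (Fin.cycleRange j) 1 (Fin.cycleRange z) := by
    refine ⟨fun y => ?_, fun x hx => ?_⟩
    · ext
      have : Slot.inner h i y < z := by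
        simp only [Slot.inner, Fin.lt_def]; omega
      rw [cycleRange_val, if_pos this, hi']
      simp only [Slot.inner, Equiv.Perm.one_apply]
      omega
    · have hx' : (x : ℕ) ≠ i := fun e => hx (Fin.ext e)
      ext
      rw [cycleRange_val]
      simp only [Slot.outer, Fin.lt_def, cycleRange_val, Fin.ext_iff]
      split_ifs <;> omega
  have := T.suspComp_suspAct H p q
  rwa [suspAct_one, hi'] at this

/-- `p(f_1, …, q ∘_2 f_i, …, f_n)` is obtained by inserting the `f_j` into `p ∘_i q`, leaving out
one of its inputs; that input is made the first one by a cycle. -/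
theorem aver_graftSeq_update_suspComp {n s : ℕ} (F : Fin n → Σ a, T.obj a) (i : Fin n)
    {M M' N N' : ℕ} (hM : M = n + s) (h : s + ∑ i, (F i).1 = N) (hN : N + 2 = N' + 1)
    (hM' : M' = n + (s + 1)) (h' : s + 1 + ∑ i, (F i).1 = N') (hc : M + 2 = M' + 1)
    (z : Fin M) (hz : (z : ℕ) = s + i) (z' : Fin M') (hz' : (z' : ℕ) = s + i)
    (hf : 2 + (F i).1 = (F i).1 + 1 + 1) (p : T.obj M) (q : T.obj 2) :
    T.aver N' (T.graftSeq n s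
        (Function.update F i ⟨(F i).1 + 1, T.suspComp hf 1 q (F i).2⟩) hM
          (sum_update_arity h hN i _ rfl) p) =
      (∏ j : Fin n, if j < i then (-1 : k) ^ ((F j).1 + 1) else 1) •
        T.aver N' (T.graftSeq n (s + 1) F hM' h'
          (T.suspAct (Fin.cycleRange z') (T.suspComp hc z p q))) := by
  induction n generalizing s M M' with
  | zero => exact i.elim0
  | succ n ih =>
    have h1 := sum_tail_arity h
    have h2 := sum_tail_arity h'
    cases i using Fin.cases with
    | zero =>
      rw [aver_graftSeq_suspAct F hM' h', Finset.prod_eq_one, one_smul,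
        graftSeq_update_zero (s' := s + (F 0).1 + 1) (M' := n + (s + (F 0).1 + 1)) F _ hM _
          rfl rfl (by omega) (by omega) z (by simpa using hz),
        graftSeq_succ (s' := s + (F 0).1 + 1) (M' := n + (s + (F 0).1 + 1)) F hM' h' (by omega) rfl
          (by omega) (by omega) ⟨s + 1, by omega⟩ rfl]
      · congr 2
        exact (T.suspComp_assoc _ _ _ _ _ _ _ (by simpa using hz.symm) _ _ _).symm
      · intro j _
        rw [if_neg (Fin.not_lt_zero j)]
      · intro x hx
        simp only [Fin.val_zero] at hz'
        ext
        rw [cycleRange_val, if_neg (by rw [Fin.lt_def]; omega),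
          if_neg (by rw [Fin.ext_iff]; omega)]
    | succ i =>
      have h3 := sum_update_arity h1 hN i ⟨(F i.succ).1 + 1, T.suspComp hf 1 q (F i.succ).2⟩ rfl
      simp only [Fin.val_succ] at hz hz'
      rw [graftSeq_update_succ (s' := s + (F 0).1) (M' := n + (s + (F 0).1)) F i _ hM _ rfl rfl
          h3 (by omega) ⟨s, by omega⟩ rfl,
        graftSeq_succ (s' := s + (F 0).1 + 1) (M' := n + (s + (F 0).1 + 1)) F hM' h' (by omega) rfl
          (by omega) (by omega) ⟨s + 1, by omega⟩ rfl]
      have := ih (Fin.tail F) i (M := n + (s + (F 0).1)) (M' := n + (s + (F 0).1 + 1)) rfl h1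
        rfl (by omega) (by omega) ⟨s + (F 0).1 + i, by omega⟩ rfl ⟨s + (F 0).1 + i, by omega⟩ rfl
        hf (T.suspComp (by omega) ⟨s, by omega⟩ p (F 0).2)
      refine this.trans ?_
      rw [suspComp_suspAct_cycleRange (by omega) ⟨s, by omega⟩ ⟨s + 1, by omega⟩ z'
          (by rw [Fin.lt_def]; simp; omega) rfl ⟨s + (F 0).1 + i, by omega⟩ (by simp; omega),
        T.suspComp_comm (m := M) (L := M') _ (by omega) hc (by omega) ⟨s, by omega⟩ z
          (by rw [Fin.lt_def]; simp; omega) ⟨s + (F 0).1 + i, by omega⟩ (by simp; omega)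
          ⟨s, by omega⟩ rfl]
      simp only [map_smul, smul_smul]
      congr 1
      rw [Fin.prod_univ_succ, if_pos (Fin.succ_pos i),
        neg_one_pow_eq_of_mod (a := ((F 0).1 + 1) * (2 + 1)) (b := (F 0).1 + 1) (by omega),
        mul_comm]
      simp [Fin.tail]

section Binary

/-- For a symmetric binary operation `q`, up to the action of permutations,
`[q, x] = 2 q ∘_2 x - (-1)^{|x|} x ∘ q`. -/
theorem map_bracket {V : Type*} [AddCommGroup V] [Module k V] {n N : ℕ} (h : 2 + n = N + 1)
    (φ : T.obj N →ₗ[k] V) (hφ : ∀ σ x, φ (T.suspAct σ x) = φ x) {q : T.obj 2}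
    (hq : ∀ σ, T.suspAct σ q = q) (x : T.obj n) :
    φ (T.bracket h q x) = (2 : k) • φ (T.suspComp h 1 q x) -
      (-1 : k) ^ (n + 1) • φ (T.preLie ((Nat.add_comm n 2).trans h) x q) := by
  have e : φ (T.suspComp h 0 q x) = φ (T.suspComp h 1 q x) := by
    obtain ⟨ρ, H⟩ := IsBlockPerm.exists_rel h 1 (Equiv.swap 0 1) 1
    have := T.suspComp_suspAct H q x
    rw [hq, suspAct_one, Equiv.swap_apply_right] at this
    rw [this, hφ]
  simp only [bracket, LinearMap.sub_apply, LinearMap.smul_apply, LinearMap.flip_apply, map_sub,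
    map_smul]
  rw [neg_one_pow_eq_of_mod (a := (2 + 1) * (n + 1)) (b := n + 1) (by omega),
    preLie_apply h, Fin.sum_univ_two, map_add, e, two_smul]

theorem aver_bracket_suspAct {n N : ℕ} (h : 2 + n = N + 1) {q : T.obj 2}
    (hq : ∀ σ, T.suspAct σ q = q) (τ : Equiv.Perm (Fin n)) (x : T.obj n) :
    T.aver N (T.bracket h q (T.suspAct τ x)) = T.aver N (T.bracket h q x) := by
  rw [map_bracket h _ (T.aver_suspAct) hq, map_bracket h _ (T.aver_suspAct) hq]
  congr 2
  · obtain ⟨ρ, H⟩ := IsBlockPerm.exists_rel h 1 1 τ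
    have := T.suspComp_suspAct H q x
    rw [hq, Equiv.Perm.one_apply] at this
    rw [this, T.aver_suspAct]
  · rw [preLie_apply, preLie_apply, map_sum, map_sum, ← Equiv.sum_comp τ]
    refine Finset.sum_congr rfl fun i _ => ?_
    obtain ⟨ρ, H⟩ := IsBlockPerm.exists_rel ((Nat.add_comm n 2).trans h) i τ 1
    have := T.suspComp_suspAct H x q
    rw [suspAct_one] at this
    rw [this, T.aver_suspAct]

/-- The element `q ∘_2 t + (-1)^n ∑_i (t ∘_i q) (1 2 ⋯ i)`, the obstruction for insertion into `t`
to be compatible with the bracket with `q`. -/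
def cocycleDefect {n : ℕ} (q : T.obj 2) (t : T.obj n) : T.obj (n + 1) :=
  T.suspComp (N := n + 1) (Nat.add_comm 2 n) 1 q t +
    (-1 : k) ^ n • ∑ j : Fin n, T.suspAct (Fin.cycleRange j.castSucc)
      (T.suspComp (m := n) (n := 2) (N := n + 1) rfl j t q)

theorem prod_neg_one_pow {n : ℕ} (a : Fin n → ℕ) :
    (∏ j, (-1 : k) ^ (a j + 1)) = (-1) ^ (n + ∑ j, a j) := by
  rw [Finset.prod_pow_eq_pow_sum, Finset.sum_add_distrib]
  congr 1
  simp [add_comm]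

theorem neg_one_pow_mul_self (a : ℕ) : (-1 : k) ^ a * (-1) ^ a = 1 := by
  rw [← pow_add, ← two_mul, pow_mul]; simp

/-- The product of the signs behind the `i`-th one, in terms of the others. -/
theorem prod_ite_gt {n : ℕ} (ε : Fin n → k) (hε : ∀ j, ε j * ε j = 1) (i : Fin n) :
    (∏ j, if i < j then ε j else 1) = (∏ j, ε j) * ((∏ j, if j < i then ε j else 1) * ε i) := by
  have h1 : ε i = ∏ j, if j = i then ε j else 1 := by simp
  conv_rhs => rw [h1]
  rw [← Finset.prod_mul_distrib, ← Finset.prod_mul_distrib]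
  refine Finset.prod_congr rfl fun j _ => ?_
  rcases lt_trichotomy j i with h | h | h
  · simp [h, h.not_gt, h.ne, hε]
  · subst h; simp [hε]
  · simp [h, h.not_gt, h.ne']

variable [CharZero k]

/-- The deviation of `Aver t(f_1, …, f_n)` from being compatible with the differential `[q, -]`.
The terms in which `q` is inserted into some `f_i` cancel. -/
theorem aver_bracket_graftSeq {n N N' : ℕ} (F : Fin n → Σ a, T.obj a)
    (h : 0 + ∑ i, (F i).1 = N) (hN : 2 + N = N' + 1) (h' : 0 + 1 + ∑ i, (F i).1 = N')
    {q : T.obj 2} (hq : ∀ σ, T.suspAct σ q = q) (t : T.obj n) :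
    T.aver N' (T.bracket hN q (T.aver N (T.graftSeq n 0 F rfl h t) : T.obj N)) +
      (-1 : k) ^ n • ∑ i : Fin n, (∏ j : Fin n, if j < i then (-1 : k) ^ ((F j).1 + 1) else 1) •
        T.aver N' (T.graftSeq n 0 (Function.update F i ⟨(F i).1 + 1,
          (T.aver _ (T.bracket (N := (F i).1 + 1) (by omega) q (F i).2) : T.obj ((F i).1 + 1))⟩) rfl
          (sum_update_arity h (by omega) i _ rfl) t) =
      (2 : k) • T.aver N' (T.graftSeq n 1 F rfl h' (cocycleDefect q t)) := by
  have hN2 : N + 2 = N' + 1 := by omega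
  rw [T.aver_map_aver _ (aver_bracket_suspAct hN hq), map_bracket hN _ T.aver_suspAct hq]
  -- `[q, f_i] = 2 q ∘_2 f_i - (-1)^{|f_i|} f_i ∘ q`, and the first summand is moved to the
  -- outer operation
  have term : ∀ i : Fin n, T.aver N' (T.graftSeq n 0 (Function.update F i ⟨(F i).1 + 1,
          (T.aver _ (T.bracket (N := (F i).1 + 1) (by omega) q (F i).2) : T.obj ((F i).1 + 1))⟩) rfl
          (sum_update_arity h (by omega) i _ rfl) t) =
      (2 : k) • ((∏ j : Fin n, if j < i then (-1 : k) ^ ((F j).1 + 1) else 1) •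
        T.aver N' (T.graftSeq n 1 F rfl h'
          (T.suspAct (Fin.cycleRange i.castSucc)
            (T.suspComp (N := n + 1) (by omega) i t q)))) -
      (-1 : k) ^ ((F i).1 + 1) • T.aver N' (T.graftSeq n 0
        (Function.update F i ⟨(F i).1 + 1, T.preLie (n := 2) (N := (F i).1 + 1) rfl (F i).2 q⟩) rfl
          (sum_update_arity h hN2 i _ rfl) t) := by
    intro i
    obtain ⟨L, hL⟩ := exists_graftSeq_update F i (a := (F i).1 + 1) (M := n) (N := N') rfl
      (sum_update_arity h hN2 i _ rfl) t
    have hL' : ∀ σ x, T.aver N' (L (T.suspAct σ x)) = T.aver N' (L x) := by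
      intro σ x
      rw [← hL _ (sum_update_arity h hN2 i _ rfl), ← hL _ (sum_update_arity h hN2 i _ rfl)]
      exact aver_graftSeq_update_suspAct (M := n) F i σ x rfl _ _ t
    rw [hL, T.aver_map_aver L hL']
    have := map_bracket (T := T) (n := (F i).1) (N := (F i).1 + 1) (by omega) (T.aver N' ∘ₗ L) hL'
      hq (F i).2
    refine this.trans ?_
    simp only [LinearMap.comp_apply]
    rw [← hL _ (sum_update_arity h hN2 i _ rfl), ← hL _ (sum_update_arity h hN2 i _ rfl),
      aver_graftSeq_update_suspComp (M := n) (M' := n + 1) F i rfl h hN2 rfl h' rfl i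
        (Nat.zero_add _).symm i.castSucc (Nat.zero_add _).symm]
  simp only [term]
  rw [suspComp_graftSeq_right (M := n) (M' := n + 1) F rfl h rfl h' hN (by omega)]
  have hpre : T.preLie ((Nat.add_comm N 2).trans hN) (T.graftSeq n 0 F rfl h t) q =
      ∑ z : Fin N, (if 0 ≤ (z : ℕ) then
        T.suspComp hN2 z (T.graftSeq n 0 F rfl h t) q else 0) := by
    rw [preLie_apply]
    simp
  rw [hpre, sum_suspComp_graftSeq F rfl h hN2]
  simp only [cocycleDefect, map_add, map_smul, map_sum, smul_add, smul_sub, smul_smul,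
    Finset.smul_sum, Finset.sum_sub_distrib]
  rw [sub_add_eq_add_sub, add_sub_assoc, sub_sub, ← Finset.sum_add_distrib]
  refine congrArg₂ _ rfl ?_
  rw [Finset.sum_eq_zero (f := fun x => _ + _), sub_zero]
  · refine Finset.sum_congr rfl fun x _ => ?_
    congr 1
    have hsq : (∏ j : Fin n, if j < x then (-1 : k) ^ ((F j).1 + 1) else 1) *
        (∏ j : Fin n, if j < x then (-1 : k) ^ ((F j).1 + 1) else 1) = 1 := by
      rw [← Finset.prod_mul_distrib]
      refine Finset.prod_eq_one fun j _ => ?_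
      split_ifs
      · exact neg_one_pow_mul_self _
      · simp
    linear_combination (2 * (-1 : k) ^ n) * hsq
  · -- the insertions of `q` into `f_x` occur twice, with opposite signs
    intro x _
    rw [← add_smul, prod_ite_gt (fun j => (-1 : k) ^ ((F j).1 + 1))
      (fun j => neg_one_pow_mul_self _) x, prod_neg_one_pow]
    have e : (-1 : k) ^ (N + 1) * (-1) ^ (n + ∑ j, (F j).1) = -(-1) ^ n := by
      rw [← pow_add, ← mul_neg_one ((-1 : k) ^ n), ← pow_succ]
      exact neg_one_pow_eq_of_mod (by omega)
    rw [← mul_assoc ((-1 : k) ^ (N + 1)), e, neg_mul, add_neg_cancel, zero_smul]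

end Binary

end Operad

/-! ### Decomposable elements of a Hadamard product -/

namespace Operad

variable {k : Type u} [Field k] {P Q : Operad k}

/-- The element `p ⊗ q` of `(P ⊗ Q)(n)`. -/
def tmul {n : ℕ} (p : P.obj n) (q : Q.obj n) : (hadamard P Q).obj n := p ⊗ₜ[k] q

theorem hadamard_induction {n : ℕ} {motive : (hadamard P Q).obj n → Prop} (zero : motive 0)
    (tmul : ∀ p q, motive (tmul p q)) (add : ∀ x y, motive x → motive y → motive (x + y))
    (x : (hadamard P Q).obj n) : motive x :=
  TensorProduct.induction_on (motive := motive) x zero tmul add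

theorem act_tmul {n : ℕ} (σ : Equiv.Perm (Fin n)) (p : P.obj n) (q : Q.obj n) :
    (hadamard P Q).act σ (tmul p q) = tmul (P.act σ p) (Q.act σ q) := rfl

theorem comp_tmul {m n N : ℕ} (h : m + n = N + 1) (i : Fin m) (p : P.obj m) (q : Q.obj m)
    (p' : P.obj n) (q' : Q.obj n) :
    (hadamard P Q).comp h i (tmul p q) (tmul p' q') = tmul (P.comp h i p p') (Q.comp h i q q') :=
  rfl

theorem smul_tmul_left {n : ℕ} (c : k) (p : P.obj n) (q : Q.obj n) :
    tmul (c • p) q = c • tmul p q := TensorProduct.smul_tmul' c p q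

theorem smul_tmul_right {n : ℕ} (c : k) (p : P.obj n) (q : Q.obj n) :
    tmul p (c • q) = c • tmul p q := TensorProduct.tmul_smul c p q

end Operad

/-! ### The differential of a cup product -/

namespace QuadraticData

open Operad

variable {k : Type u} [Field k] (D : QuadraticData k)

theorem genMap_swap {E : BinaryGenerators k} (S : OpTerm E 3 → Prop) (e : E.carrier) :
    genMap S (E.swap e) = (presentedOperad S).act (Equiv.swap (0 : Fin 2) 1) (genMap S e) :=
  OpTerm.Quo.sound (.gen_swap e)

theorem map_swap_coevaluation (E : BinaryGenerators k) :
    TensorProduct.map E.swap E.swap.dualMap (coevaluation k E.carrier 1) =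
      coevaluation k E.carrier 1 := by
  set b := Module.Basis.ofVectorSpace k E.carrier with hb
  rw [coevaluation_apply_one]
  simp only [map_sum, TensorProduct.map_tmul, ← hb]
  have e : ∀ i, E.swap (b i) ⊗ₜ[k] E.swap.dualMap (b.coord i) =
      ∑ j, b j ⊗ₜ[k] (b.coord j (E.swap (b i)) • E.swap.dualMap (b.coord i)) := by
    intro i
    conv_lhs => rw [← b.sum_repr (E.swap (b i))]
    rw [TensorProduct.sum_tmul]
    simp only [TensorProduct.smul_tmul, Module.Basis.coord_apply]
  rw [Finset.sum_congr rfl fun i _ => e i, Finset.sum_comm]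
  refine Finset.sum_congr rfl fun j _ => ?_
  rw [← TensorProduct.tmul_sum]
  congr 1
  refine LinearMap.ext fun v => ?_
  simp only [LinearMap.sum_apply, LinearMap.smul_apply, LinearMap.dualMap_apply, smul_eq_mul]
  have : E.swap (E.swap v) = ∑ i, b.coord i (E.swap v) • E.swap (b i) := by
    conv_lhs => rw [← b.sum_repr (E.swap v)]
    simp only [map_sum, map_smul, Module.Basis.coord_apply]
  conv_rhs => rw [← E.swap_swap v, this]
  simp only [map_sum, map_smul, smul_eq_mul]
  exact Finset.sum_congr rfl fun i _ => mul_comm _ _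

/-- The image of `E ⊗ E^∨` in the binary part of a Hadamard product. -/
def genTensor {E : BinaryGenerators k} (S : OpTerm E 3 → Prop) (S' : OpTerm E.dual 3 → Prop) :
    E.carrier ⊗[k] Module.Dual k E.carrier →ₗ[k]
      (hadamard (presentedOperad S) (presentedOperad S')).obj 2 :=
  TensorProduct.map (genMap S) (genMap S')

/-- The sign of the transposition in the suspension cancels the one in the definition
of `E^∨`. -/
theorem suspAct_genTensor {E : BinaryGenerators k} (S : OpTerm E 3 → Prop)
    (S' : OpTerm E.dual 3 → Prop) (x : E.carrier ⊗[k] Module.Dual k E.carrier) :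
    (hadamard (presentedOperad S) (presentedOperad S')).suspAct (Equiv.swap 0 1)
      (genTensor S S' x) = genTensor S S' (TensorProduct.map E.swap E.swap.dualMap x) := by
  refine LinearMap.congr_fun (f := ((hadamard (presentedOperad S) (presentedOperad S')).suspAct
    (Equiv.swap 0 1)) ∘ₗ genTensor S S')
    (g := genTensor S S' ∘ₗ TensorProduct.map E.swap E.swap.dualMap)
    (TensorProduct.ext' fun e φ => ?_) x
  change (((Equiv.Perm.sign (Equiv.swap (0 : Fin 2) 1) : ℤˣ) : ℤ) : k) •
    tmul ((presentedOperad S).act (Equiv.swap 0 1) (genMap S e))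
      ((presentedOperad S').act (Equiv.swap 0 1) (genMap S' φ)) =
    tmul (genMap S (E.swap e)) (genMap S' (E.swap.dualMap φ))
  have h3 : E.swap.dualMap φ = (-1 : k) • E.dual.swap φ := by
    rw [neg_one_smul]
    exact (neg_neg (E.swap.dualMap φ)).symm
  have h4 : genMap S' (E.swap.dualMap φ) = (-1 : k) • genMap S' (E.dual.swap φ) := by
    rw [h3]
    exact (genMap S').map_smul _ _
  have h5 : (presentedOperad S').act (Equiv.swap 0 1) (genMap S' φ) = genMap S' (E.dual.swap φ) :=
    (genMap_swap S' φ).symm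
  rw [h4, genMap_swap S, h5, smul_tmul_right, Equiv.Perm.sign_swap (by decide)]
  simp

/-- The canonical element is `Σ₂`-invariant in `𝔰(P ⊗ P^!)(2)`. -/
theorem suspAct_chi (σ : Equiv.Perm (Fin 2)) : D.tensorDual.suspAct σ D.chi = D.chi := by
  have hσ : σ = 1 ∨ σ = Equiv.swap 0 1 := by
    revert σ; decide
  obtain rfl | rfl := hσ
  · exact D.tensorDual.suspAct_one D.chi
  · refine (suspAct_genTensor _ _ (coevaluation k D.gens.carrier 1)).trans ?_
    rw [map_swap_coevaluation]
    rfl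

variable (A : OpAlgebra D.operad)

theorem structureMap_tmul {n : ℕ} (p : D.operad.obj n) (q : D.dualOperad.obj n) :
    D.structureMap A n (tmul p q) = tmul (A.str.map n p) q := rfl

theorem structureMap_suspAct {n : ℕ} (σ : Equiv.Perm (Fin n)) (x : D.tensorDual.obj n) :
    D.structureMap A n (D.tensorDual.suspAct σ x) =
      (D.coeff A).suspAct σ (D.structureMap A n x) := by
  simp only [suspAct, LinearMap.smul_apply, map_smul]
  congr 1
  induction x using hadamard_induction with
  | zero => simp only [map_zero]
  | add x y hx hy => simp only [map_add, hx, hy]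
  | tmul p q => simp only [act_tmul, structureMap_tmul, A.str.map_act]

theorem structureMap_suspComp {m n N : ℕ} (h : m + n = N + 1) (i : Fin m)
    (x : D.tensorDual.obj m) (y : D.tensorDual.obj n) :
    D.structureMap A N (D.tensorDual.suspComp h i x y) =
      (D.coeff A).suspComp h i (D.structureMap A m x) (D.structureMap A n y) := by
  simp only [suspComp_apply, map_smul]
  congr 1
  induction x using hadamard_induction with
  | zero => simp only [map_zero, LinearMap.zero_apply]
  | add x y hx hy => simp only [map_add, LinearMap.add_apply, hx, hy]
  | tmul p q =>
    induction y using hadamard_induction with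
    | zero => simp only [map_zero]
    | add x y hx hy => simp only [map_add, hx, hy]
    | tmul p' q' => simp only [comp_tmul, structureMap_tmul, A.str.map_comp]

theorem structureMap_cocycleDefect {n : ℕ} (t : D.tensorDual.obj n) :
    D.structureMap A (n + 1) (cocycleDefect D.chi t) =
      cocycleDefect (D.structureMap A 2 D.chi) (D.structureMap A n t) := by
  simp only [cocycleDefect, map_add, map_smul, map_sum, structureMap_suspAct,
    structureMap_suspComp]

theorem suspAct_structureMap_chi (σ : Equiv.Perm (Fin 2)) :
    (D.coeff A).suspAct σ (D.structureMap A 2 D.chi) = D.structureMap A 2 D.chi := by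
  rw [← structureMap_suspAct, suspAct_chi]

variable {D A}

/-- A cochain of degree `m` as an operation of arity `m + 1`. -/
def Cochain.toOp (G : Σ m, D.Cochain A m) : Σ a, (D.coeff A).obj a :=
  ⟨G.1 + 1, (G.2 : (D.coeff A).obj (G.1 + 1))⟩

theorem cup_apply {n : ℕ} (hn : 1 ≤ n) (t : D.tensorDual.obj n)
    (G : Fin n → Σ m, D.Cochain A m) {M : ℕ} (hM : ∑ i, (G i).1 + (n - 1) = M)
    (h : 0 + ∑ i, (Cochain.toOp (G i)).1 = M + 1) :
    D.cup hn t A (fun i => D.incl A (G i).1 (G i).2) =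
      D.incl A M ((D.coeff A).aver (M + 1) ((D.coeff A).graftSeq n 0
        (fun i => Cochain.toOp (G i)) rfl h (D.structureMap A n t))) := by
  subst hM
  refine (MultilinearMap.fromDFinsuppEquiv_single _ (fun i => (G i).1) (fun i => (G i).2)).trans ?_
  simp only [LinearMap.compMultilinearMap_apply, LinearMap.comp_apply,
    MultilinearMap.compLinearMap_apply, suspGamma]
  rw [graft_apply]
  rfl

theorem totalDifferential_incl (m : ℕ) (f : D.Cochain A m) :
    D.totalDifferential A (D.incl A m f) = D.incl A (m + 1) (D.differential A m f) := by
  simp [totalDifferential, incl]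

theorem signMap_incl (m : ℕ) (f : D.Cochain A m) :
    D.signMap A (D.incl A m f) = (-1 : k) ^ m • D.incl A m f := by
  simp [signMap, incl]

theorem delta_apply {n d : ℕ} (U : D.Operation n) (v : Fin n → D.Cochains A) :
    D.delta d U A v = D.totalDifferential A (U A v) - (-1 : k) ^ d • ∑ i : Fin n, U A (fun j =>
      (if j < i then D.signMap A else if j = i then D.totalDifferential A else LinearMap.id)
        (v j)) := by
  simp only [delta, sub_apply, smul_apply, sum_apply, LinearMap.compMultilinearMap_apply,
    MultilinearMap.compLinearMap_apply]

variable [CharZero k]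

/-- `δ(cup(t))(f_1, …, f_n) = 2 Aver(X(1, f_1, …, f_n))`, where
`X = χ ∘_2 t + (-1)^n ∑_i (t ∘_i χ)(1 2 ⋯ i)`. -/
theorem delta_cup_apply {n : ℕ} (hn : 1 ≤ n) (t : D.tensorDual.obj n)
    (G : Fin n → Σ m, D.Cochain A m) {M : ℕ} (hM : ∑ i, (G i).1 + (n - 1) = M)
    (h : 0 + 1 + ∑ i, (Cochain.toOp (G i)).1 = M + 1 + 1) :
    D.delta (n - 1) (D.cup hn t) A (fun i => D.incl A (G i).1 (G i).2) =
      D.incl A (M + 1) ((2 : k) • (D.coeff A).aver (M + 1 + 1) ((D.coeff A).graftSeq n 1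
        (fun i => Cochain.toOp (G i)) rfl h
          (D.structureMap A (n + 1) (cocycleDefect D.chi t)))) := by
  have h0 : 0 + ∑ i, (Cochain.toOp (G i)).1 = M + 1 := by omega
  rw [structureMap_cocycleDefect, ← aver_bracket_graftSeq _ h0 (by omega) h
    (D.suspAct_structureMap_chi A), map_add, map_smul, map_sum]
  rw [delta_apply, cup_apply hn t G hM h0, totalDifferential_incl]
  have hsign : ∀ x y : D.Cochains A, x - (-1 : k) ^ (n - 1) • y = x + (-1 : k) ^ n • y := by
    intro x y
    have : (-1 : k) ^ n = -(-1 : k) ^ (n - 1) := by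
      rw [← mul_neg_one ((-1 : k) ^ (n - 1)), ← pow_succ, Nat.sub_add_cancel hn]
    rw [this, sub_eq_add_neg]
    exact congrArg (x + ·) (neg_smul _ _).symm
  refine (hsign _ _).trans ?_
  congr 2
  refine Finset.sum_congr rfl fun i _ => ?_
  set G' : Fin n → Σ m, D.Cochain A m :=
    Function.update G i ⟨(G i).1 + 1, D.differential A (G i).1 (G i).2⟩ with hG'
  have e : (fun j => (if j < i then D.signMap A else if j = i then D.totalDifferential A
      else LinearMap.id) (D.incl A (G j).1 (G j).2)) =
      fun j => (if j < i then (-1 : k) ^ ((Cochain.toOp (G j)).1 + 1) else 1) •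
        D.incl A (G' j).1 (G' j).2 := by
    funext j
    rcases lt_trichotomy j i with hj | hj | hj
    · rw [if_pos hj, if_pos hj, signMap_incl, hG', Function.update_of_ne hj.ne,
        neg_one_pow_eq_of_mod]
      simp only [Cochain.toOp]
      omega
    · subst hj
      rw [if_neg (lt_irrefl _), if_neg (lt_irrefl _), if_pos rfl, hG', Function.update_self,
        one_smul, totalDifferential_incl]
    · rw [if_neg hj.not_gt, if_neg hj.not_gt, if_neg hj.ne', hG', Function.update_of_ne hj.ne',
        one_smul, LinearMap.id_apply]
  have hG'F : (fun j => Cochain.toOp (G' j)) =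
      Function.update (fun j => Cochain.toOp (G j)) i (Cochain.toOp (G' i)) := by
    funext j
    by_cases hj : j = i
    · subst hj; simp
    · rw [Function.update_of_ne hj, hG', Function.update_of_ne hj]
  have hi : Cochain.toOp (G' i) = ⟨(Cochain.toOp (G i)).1 + 1,
      ((D.coeff A).aver _ ((D.coeff A).bracket (N := (Cochain.toOp (G i)).1 + 1) (by omega)
        (D.structureMap A 2 D.chi) (Cochain.toOp (G i)).2) :
          (D.coeff A).obj ((Cochain.toOp (G i)).1 + 1))⟩ := by
    rw [hG', Function.update_self]
    rfl
  have h2 := sum_update_arity (N' := M + 1 + 1) h0 (by omega) i (Cochain.toOp (G' i))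
    (by rw [hi])
  rw [e, MultilinearMap.map_smul_univ, map_smul, cup_apply hn t G' (M := M + 1) _ (by
    rw [← h2, ← hG'F])]
  · congr 3
    refine graftSeq_congr ?_ _ _ _ _
    rw [hG'F, hi]
  · rw [← hG'F] at h2
    simp only [Cochain.toOp, Finset.sum_add_distrib, Finset.sum_const, Finset.card_univ,
      Fintype.card_fin, smul_eq_mul] at h2
    omega

theorem delta_cup_eq_zero {n : ℕ} (hn : 1 ≤ n) (t : D.tensorDual.obj n)
    (ht : cocycleDefect D.chi t = 0) : D.delta (n - 1) (D.cup hn t) = 0 := by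
  funext A
  refine MultilinearMap.dfinsupp_ext fun m => ?_
  refine MultilinearMap.ext fun f => ?_
  refine (delta_cup_apply hn t (fun i => ⟨m i, f i⟩) rfl ?_).trans ?_
  · simp only [Cochain.toOp, Finset.sum_add_distrib, Finset.sum_const, Finset.card_univ,
      Fintype.card_fin, smul_eq_mul]
    omega
  · rw [ht]
    simp only [map_zero, smul_zero]
    rfl

end QuadraticData

/-! ### Nullary and unary operations of a quadratic operad -/

section Presented

variable {k : Type u} [Field k] {E : BinaryGenerators k} {S : OpTerm E 3 → Prop}

/-- Every operation of a presented operad is obtained from generators by the operad structure. -/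
theorem presentedOperad_induction {motive : ∀ {n : ℕ}, (presentedOperad S).obj n → Prop}
    (gen : ∀ e, motive (genMap S e)) (one : motive (presentedOperad S).one)
    (zero : ∀ n, motive (0 : (presentedOperad S).obj n))
    (add : ∀ {n : ℕ} (x y : (presentedOperad S).obj n), motive x → motive y → motive (x + y))
    (smul : ∀ {n : ℕ} (c : k) (x : (presentedOperad S).obj n), motive x → motive (c • x))
    (act : ∀ {n : ℕ} (σ : Equiv.Perm (Fin n)) (x : (presentedOperad S).obj n), motive x →
      motive ((presentedOperad S).act σ x))
    (comp : ∀ {m n N : ℕ} (h : m + n = N + 1) (i : Fin m) (x : (presentedOperad S).obj m)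
      (y : (presentedOperad S).obj n), motive x → motive y →
        motive ((presentedOperad S).comp h i x y))
    {n : ℕ} (x : (presentedOperad S).obj n) : motive x := by
  revert x
  refine Quot.ind fun x => ?_
  induction x with
  | gen e => exact gen e
  | one => exact one
  | zero n => exact zero n
  | add x y hx hy => exact add _ _ hx hy
  | smul c x hx => exact smul c _ hx
  | act σ x hx => exact act σ _ hx
  | comp h i x y hx hy => exact comp h i _ _ hx hy

theorem presentedOperad_arity_le_one {n : ℕ} (x : (presentedOperad S).obj n) :
    (n = 0 → x = 0) ∧ ∀ h : 1 = n, ∃ c : k,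
      x = c • (presentedOperad S).reindex h (presentedOperad S).one := by
  induction x using presentedOperad_induction with
  | gen e => exact ⟨fun h => by omega, fun h => by omega⟩
  | one => exact ⟨fun h => by omega, fun _ => ⟨1, (one_smul k _).symm⟩⟩
  | zero n => exact ⟨fun _ => rfl, fun h => ⟨0, (zero_smul k _).symm⟩⟩
  | add x y hx hy =>
    refine ⟨fun h => by rw [hx.1 h, hy.1 h, add_zero], fun h => ?_⟩
    obtain ⟨c, hc⟩ := hx.2 h
    obtain ⟨d, hd⟩ := hy.2 h
    exact ⟨c + d, by rw [add_smul, hc, hd]⟩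
  | smul c x hx =>
    refine ⟨fun h => by rw [hx.1 h, smul_zero], fun h => ?_⟩
    obtain ⟨d, hd⟩ := hx.2 h
    exact ⟨c * d, by rw [mul_smul, hd]⟩
  | act σ x hx =>
    refine ⟨fun h => by rw [hx.1 h, map_zero], fun h => ?_⟩
    subst h
    obtain rfl : σ = 1 := Subsingleton.elim _ _
    rw [(presentedOperad S).act_one]
    exact hx.2 rfl
  | @comp m n N h i x y hx hy =>
    have hm := i.2
    refine ⟨fun h0 => by rw [hy.1 (by omega), map_zero], fun h1 => ?_⟩
    rcases Nat.eq_zero_or_pos n with hn | hn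
    · exact ⟨0, by rw [hy.1 hn, map_zero, zero_smul]⟩
    · obtain rfl : 1 = m := by omega
      obtain rfl : 1 = n := by omega
      subst h1
      obtain ⟨c, rfl⟩ := hx.2 rfl
      obtain ⟨d, rfl⟩ := hy.2 rfl
      refine ⟨c * d, ?_⟩
      obtain rfl : i = 0 := Subsingleton.elim _ _
      simp only [Operad.reindex_rfl, map_smul, LinearMap.smul_apply, smul_smul]
      rw [(presentedOperad S).one_comp h, mul_comm]

theorem presentedOperad_unary (x : (presentedOperad S).obj 1) :
    ∃ c : k, x = c • (presentedOperad S).one :=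
  (presentedOperad_arity_le_one x).2 rfl

end Presented

/-! ### Cup products are natural operations -/

namespace Operad

variable {k : Type u} [Field k]

theorem graft_succ (T : Operad k) {n s : ℕ} (a : Fin (n + 1) → ℕ) {N : ℕ}
    (h : s + ∑ i, a i = N) (h' : s + a 0 + ∑ i : Fin n, a i.succ = N) (p : T.obj (n + 1 + s))
    (f : ∀ i, T.obj (a i)) :
    T.graft (n + 1) s a h p f = T.graft n (s + a 0) (fun i => a i.succ) h'
      (T.suspComp (N := n + (s + a 0)) (by omega) ⟨s, by omega⟩ p (f 0)) (fun i => f i.succ) := rfl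

/-- The exponent of the sign by which successive insertion in `𝔰T` differs from successive
insertion in `T`. -/
def graftSign : ∀ (n _ : ℕ) (_ : Fin n → ℕ), ℕ
  | 0, _, _ => 0
  | n + 1, s, a => s * (a 0 + 1) + graftSign n (s + a 0) (fun i => a i.succ)

theorem graft_tmul {P Q : Operad k} {n s : ℕ} (a : Fin n → ℕ) {N : ℕ} (h : s + ∑ i, a i = N)
    (p : P.obj (n + s)) (q : Q.obj (n + s)) (φ : ∀ i, P.obj (a i)) (ψ : ∀ i, Q.obj (a i)) :
    (hadamard P Q).graft n s a h (tmul p q) (fun i => tmul (φ i) (ψ i)) =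
      (-1 : k) ^ graftSign n s a • tmul (P.graft n s a h p φ) (Q.graft n s a h q ψ) := by
  induction n generalizing s with
  | zero =>
    rw [graftSign, pow_zero, one_smul]
    obtain rfl : 0 + s = N := by rw [← h]; simp
    rfl
  | succ n ih =>
    have h' : s + a 0 + ∑ i : Fin n, a i.succ = N := by
      rw [← h, Fin.sum_univ_succ, add_assoc]
    rw [graft_succ _ a h h', graft_succ _ a h h', graft_succ _ a h h']
    simp only [suspComp_apply, map_smul, smul_apply, comp_tmul, ih, smul_tmul_left,
      smul_tmul_right, smul_smul, graftSign]
    congr 1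
    rw [pow_add]
    linear_combination (-(-1 : k) ^ (s * (a 0 + 1)) *
      (-1 : k) ^ graftSign n (s + a 0) fun i => a i.succ) *
        neg_one_pow_mul_self (k := k) (s * (a 0 + 1))

end Operad

section EndGraft

open Operad

variable {k : Type u} [Field k] {A : Type u} [AddCommGroup A] [Module k A]

/-- The value of the `i`-th one of the operations `φ` at its share of the arguments `w`, the first
`s` of which are left out. -/
def blockValue {n : ℕ} (a : Fin n → ℕ) (φ : ∀ i, MultilinearMap k (fun _ : Fin (a i) => A) A)
    (w : ℕ → A) (s : ℕ) (i : Fin n) : A :=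
  φ i (fun c => w (s + (∑ j : Fin (i : ℕ), a (Fin.castLE i.2.le j)) + c))

theorem blockValue_zero {n : ℕ} (a : Fin (n + 1) → ℕ)
    (φ : ∀ i, MultilinearMap k (fun _ : Fin (a i) => A) A) (w : ℕ → A) (s : ℕ) :
    blockValue a φ w s 0 = φ 0 (fun c => w (s + c)) := by
  unfold blockValue
  congr 1

theorem blockValue_succ {n : ℕ} (a : Fin (n + 1) → ℕ)
    (φ : ∀ i, MultilinearMap k (fun _ : Fin (a i) => A) A) (w : ℕ → A) (s : ℕ) (i : Fin n) :
    blockValue a φ w s i.succ =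
      blockValue (fun i => a i.succ) (fun i => φ i.succ) w (s + a 0) i := by
  unfold blockValue
  congr 1
  funext c
  congr 1
  have := Fin.sum_univ_succ (n := (i : ℕ)) (fun j => a (Fin.castLE i.succ.2.le j))
  simp only [Fin.val_succ]
  rw [this]
  simp only [Fin.castLE_zero, Fin.castLE_succ]
  omega

/-- The arguments of the outer map in `p(…, φ_1, …, φ_n)`, evaluated at `w`. -/
def graftArgs {n : ℕ} (a : Fin n → ℕ) (φ : ∀ i, MultilinearMap k (fun _ : Fin (a i) => A) A)
    (w : ℕ → A) (s : ℕ) (x : Fin (n + s)) : A :=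
  if h : (x : ℕ) < s then w x else blockValue a φ w s ⟨x - s, by omega⟩

theorem graft_endOperad_apply {n s : ℕ} (a : Fin n → ℕ) {N : ℕ} (h : s + ∑ i, a i = N)
    (p : MultilinearMap k (fun _ : Fin (n + s) => A) A)
    (φ : ∀ i, MultilinearMap k (fun _ : Fin (a i) => A) A) (w : ℕ → A) :
    (show MultilinearMap k (fun _ : Fin N => A) A from (endOperad k A).graft n s a h p φ)
      (fun z => w z) = (-1 : k) ^ graftSign n s a • p (graftArgs a φ w s) := by
  induction n generalizing s with
  | zero =>
    rw [graftSign, pow_zero, one_smul]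
    obtain rfl : 0 + s = N := by rw [← h]; simp
    change p _ = p _
    congr 1
    funext x
    simp [graftArgs, show (x : ℕ) < s by omega]
  | succ n ih =>
    have h' : s + a 0 + ∑ i : Fin n, a i.succ = N := by
      rw [← h, Fin.sum_univ_succ, add_assoc]
    have e := graft_succ (endOperad k A) a h h' p φ
    have hc : n + 1 + s + a 0 = n + (s + a 0) + 1 := by omega
    have e' : (endOperad k A).suspComp hc ⟨s, by omega⟩ p (φ 0) =
        (-1 : k) ^ (s * (a 0 + 1)) • (EndOp.compFun hc ⟨s, by omega⟩ p (φ 0) :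
          MultilinearMap k (fun _ : Fin (n + (s + a 0)) => A) A) := rfl
    have key := ih (fun i => a i.succ) h' ((-1 : k) ^ (s * (a 0 + 1)) •
      (EndOp.compFun hc ⟨s, by omega⟩ p (φ 0) :
          MultilinearMap k (fun _ : Fin (n + (s + a 0)) => A) A)) (fun i => φ i.succ)
    refine Eq.trans ?_ (key.trans ?_)
    · exact congrArg (fun f : MultilinearMap k (fun _ : Fin N => A) A => f (fun z => w z)) e
    · rw [smul_apply, smul_smul, ← pow_add, graftSign, add_comm]
      congr 1
      rw [EndOp.compFun_apply]
      congr 1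
      funext x
      by_cases hx : x = ⟨s, by omega⟩
      · subst hx
        simp only [EndOp.args, dite_true, graftArgs, lt_irrefl, dite_false]
        rw [show (⟨s - s, by omega⟩ : Fin (n + 1)) = 0 from Fin.ext (by simp), blockValue_zero]
        congr 1
        funext y
        rw [dif_pos (by simp [Slot.inner])]
        rfl
      · have hx' : (x : ℕ) ≠ s := fun e => hx (Fin.ext e)
        simp only [EndOp.args, dif_neg hx, graftArgs]
        by_cases hlt : (x : ℕ) < s
        · rw [dif_pos hlt, dif_pos (by simp [Slot.outer, Fin.lt_def, hlt]; omega)]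
          simp [Slot.outer, Fin.lt_def, hlt]
        · have hout : (Slot.outer hc ⟨s, by omega⟩ x hx : ℕ) = x + a 0 - 1 := by
            simp [Slot.outer, Fin.lt_def, hlt]
          rw [dif_neg hlt, dif_neg (by omega), ← blockValue_succ]
          congr 1
          ext
          simp only [Fin.val_succ, hout]
          omega

theorem suspGamma_endOperad_apply {n : ℕ} (a : Fin n → ℕ) {N : ℕ} (h : ∑ i, a i = N)
    (p : MultilinearMap k (fun _ : Fin n => A) A)
    (φ : ∀ i, MultilinearMap k (fun _ : Fin (a i) => A) A) (v : Fin N → A) :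
    (-1 : k) ^ graftSign n 0 a • (show MultilinearMap k (fun _ : Fin N => A) A from
      (endOperad k A).suspGamma a h p φ) v =
        p (fun i => φ i (fun c => v ((finSigmaFinEquiv.trans (finCongr h)) ⟨i, c⟩))) := by
  set w : ℕ → A := fun z => if hz : z < N then v ⟨z, hz⟩ else 0 with hw
  have hv : v = fun z : Fin N => w z := by
    funext z
    simp [hw]
  have key := graft_endOperad_apply a ((Nat.zero_add _).trans h) p φ w
  rw [← hv] at key
  refine (congrArg _ key).trans ?_
  rw [smul_smul, neg_one_pow_mul_self, one_smul]
  congr 1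
  funext i
  refine (dif_neg (Nat.not_lt_zero _)).trans ?_
  change φ i (fun c => w (0 + (∑ j : Fin (i : ℕ), a (Fin.castLE i.2.le j)) + c)) = _
  congr 1
  funext c
  have e : (((finSigmaFinEquiv.trans (finCongr h)) ⟨i, c⟩ : Fin N) : ℕ) =
      (∑ j : Fin (i : ℕ), a (Fin.castLE i.2.le j)) + c := by
    simp [finSigmaFinEquiv_apply]
  rw [Nat.zero_add, ← e]
  exact (congrFun hv _).symm

end EndGraft

namespace QuadraticData

open Operad

variable {k : Type u} [Field k] {D : QuadraticData k}

/-- The components of `cup(t)`. -/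
def cupComponent {n : ℕ} (m : Fin n → ℕ) {M : ℕ} (h : ∑ i, (m i + 1) = M + 1)
    (t : D.tensorDual.obj n) : D.HomogeneousOperation m M := fun A =>
  ((D.coeff A).aver (M + 1)).compMultilinearMap
    (((D.coeff A).suspGamma (fun i => m i + 1) h (D.structureMap A n t)).compLinearMap
      (fun i => ((D.coeff A).invariants (m i + 1)).subtype))

/-- If `T` is a tree along which `φ_1, …, φ_n` compose to `p(φ_1, …, φ_n)`, then the components
of `cup(p ⊗ q)` are `U_{(T,Φ)}` for the map `Φ` given by composition with `q`. -/
theorem isTreeOperation_cupComponent {n : ℕ} (m : Fin n → ℕ) {M : ℕ}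
    (h : ∑ i, (m i + 1) = M + 1) (p : D.operad.obj n) (q : D.dualOperad.obj n)
    (T : DecTree D.operad (fun i => m i + 1) (M + 1)) (hT : T.Proper)
    (hp : ∀ (A : OpAlgebra D.operad) (φ : ∀ i, MultilinearMap k
      (fun _ : Fin (m i + 1) => A.carrier) A.carrier) (x : Fin (M + 1) → A.carrier),
      T.eval A φ x = (show MultilinearMap k (fun _ : Fin n => A.carrier) A.carrier from
        A.str.map n p)
        (fun i => φ i (fun c => x ((finSigmaFinEquiv.trans (finCongr h)) ⟨i, c⟩)))) :
    D.IsTreeOperation m M (cupComponent m h (tmul p q)) := by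
  refine ⟨T, D.dualOperad.suspGamma (fun i => m i + 1) h q, hT, fun A => ?_⟩
  refine ⟨(-1 : k) ^ graftSign n 0 (fun i => m i + 1) •
      (endOperad k A.carrier).suspGamma (fun i => m i + 1) h (A.str.map n p),
    (D.coeff A).suspGamma (fun i => m i + 1) h (D.structureMap A n (tmul p q)), ?_, ?_, ?_⟩
  · intro φ x
    rw [hp]
    exact suspGamma_endOperad_apply _ h _ φ x
  · intro φ ψ
    refine (graft_tmul (fun i => m i + 1) ((Nat.zero_add _).trans h) (A.str.map n p) q φ ψ).trans ?_
    exact (smul_tmul_left _ _ _).symm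
  · intro f
    rfl

theorem cupComponent_mem_span {n : ℕ} (hn : 1 ≤ n) (m : Fin n → ℕ) {M : ℕ}
    (h : ∑ i, (m i + 1) = M + 1) (t : D.tensorDual.obj n) :
    cupComponent m h t ∈ Submodule.span k {V | D.IsTreeOperation m M V} := by
  have hsmul : ∀ (c : k) (t : D.tensorDual.obj n),
      cupComponent m h (c • t) = c • cupComponent m h t := by
    intro c t
    funext A
    ext f
    simp [cupComponent, suspGamma]
  have hadd : ∀ t t' : D.tensorDual.obj n,
      cupComponent m h (t + t') = cupComponent m h t + cupComponent m h t' := by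
    intro t t'
    funext A
    ext f
    simp [cupComponent, suspGamma]
  induction t using hadamard_induction with
  | zero =>
    have := hsmul 0 0
    rw [zero_smul, zero_smul] at this
    rw [this]
    exact Submodule.zero_mem _
  | add x y hx hy =>
    rw [hadd]
    exact Submodule.add_mem _ hx hy
  | tmul p q =>
    have leg : ∀ j : Fin (M + 1), ∑ i : Fin n, ∑ c : Fin (m i + 1),
        (if finSigmaFinEquiv.trans (finCongr h) ⟨i, c⟩ = j then 1 else 0) = 1 := by
      intro j
      rw [← Fintype.sum_sigma' (fun i c => if finSigmaFinEquiv.trans (finCongr h) ⟨i, c⟩ = j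
        then 1 else 0)]
      exact (Equiv.sum_comp (finSigmaFinEquiv.trans (finCongr h))
        (fun z => if z = j then 1 else 0)).trans (Fintype.sum_ite_eq' j _)
    by_cases h2 : 2 ≤ n
    · refine Submodule.subset_span (isTreeOperation_cupComponent m h p q
        (.black n h2 p (fun i => .white i (fun c =>
          .leg (finSigmaFinEquiv.trans (finCongr h) ⟨i, c⟩)))) ⟨fun j => ?_, fun i => ?_⟩ ?_)
      · simpa only [DecTree.legCount] using leg j
      · simp [DecTree.whiteCount]
      · intro A φ x
        rfl
    · -- black vertices are at least binary: a unary operation is a multiple of the unit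
      obtain rfl : n = 1 := by omega
      obtain ⟨c, hc⟩ := presentedOperad_unary p
      obtain rfl : p = c • D.operad.one := hc
      rw [smul_tmul_left, hsmul]
      refine Submodule.smul_mem _ _ (Submodule.subset_span (isTreeOperation_cupComponent m h _ q
        (.white 0 (fun c => .leg (finSigmaFinEquiv.trans (finCongr h) ⟨0, c⟩)))
          ⟨fun j => ?_, fun i => ?_⟩ ?_))
      · have := leg j
        rw [Fin.sum_univ_one] at this
        simpa only [DecTree.legCount] using this
      · simp [DecTree.whiteCount, Subsingleton.elim i 0]
      · intro A φ x
        rw [A.str.map_one]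
        rfl

theorem cup_mem_naturalOperations {n : ℕ} (hn : 1 ≤ n) (t : D.tensorDual.obj n) :
    D.cup hn t ∈ D.naturalOperations n (n - 1) := by
  intro m
  have h : ∑ i, (m i + 1) = ∑ i, m i + (n - 1) + 1 := by
    rw [Finset.sum_add_distrib]; simp; omega
  refine ⟨cupComponent m h t, cupComponent_mem_span hn m h t, fun A f => ?_⟩
  exact MultilinearMap.fromDFinsuppEquiv_single _ m f

end QuadraticData

/-! ### The universal property of a presented operad -/

section Lift

open Operad

variable {k : Type u} [Field k] {E : BinaryGenerators k} (Q : Operad k)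
  (g : E.carrier →ₗ[k] Q.obj 2)

/-- The value in `Q` of a formal expression, when the generators are interpreted by `g`. -/
def OpTerm.value : ∀ {n : ℕ}, OpTerm E n → Q.obj n
  | _, .gen e => g e
  | _, .one => Q.one
  | _, .zero _ => 0
  | _, .add x y => x.value + y.value
  | _, .smul c x => c • x.value
  | _, .act σ x => Q.act σ x.value
  | _, .comp h i x y => Q.comp h i x.value y.value

variable {Q g} {S : OpTerm E 3 → Prop}

theorem OpTerm.value_eq_of_rel (hg : ∀ e, g (E.swap e) = Q.act (Equiv.swap 0 1) (g e))
    (hS : ∀ x, S x → x.value Q g = 0) {n : ℕ} {x y : OpTerm E n} (h : OpTerm.Rel S x y) :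
    x.value Q g = y.value Q g := by
  induction h with
  | rel x hx => exact hS x hx
  | gen_add e e' => exact map_add g e e'
  | gen_smul c e => exact map_smul g c e
  | gen_swap e => exact hg e
  | refl x => rfl
  | symm _ ih => exact ih.symm
  | trans _ _ ih ih' => exact ih.trans ih'
  | add_congr _ _ ih ih' => simp only [OpTerm.value, ih, ih']
  | smul_congr c _ ih => simp only [OpTerm.value, ih]
  | act_congr σ _ ih => simp only [OpTerm.value, ih]
  | comp_congr h i _ _ ih ih' => simp only [OpTerm.value, ih, ih']
  | add_assoc x y z => exact _root_.add_assoc _ _ _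
  | add_comm x y => exact _root_.add_comm _ _
  | zero_add x => exact _root_.zero_add _
  | zero_smul x => exact _root_.zero_smul k _
  | one_smul x => exact _root_.one_smul k _
  | mul_smul c d x => exact (smul_smul c d _).symm
  | smul_add c x y => exact _root_.smul_add c _ _
  | add_smul c d x => exact _root_.add_smul c d _
  | act_add σ x y => exact map_add _ _ _
  | act_smul σ c x => exact map_smul _ _ _
  | comp_add_left h i x x' y => simp only [OpTerm.value, map_add, LinearMap.add_apply]
  | comp_smul_left h i c x y => simp only [OpTerm.value, map_smul, LinearMap.smul_apply]
  | comp_add_right h i x y y' => exact map_add _ _ _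
  | comp_smul_right h i c x y => exact map_smul _ _ _
  | act_one x => exact Q.act_one _
  | act_mul σ τ x => exact Q.act_mul _ _ _
  | one_comp h x => exact Q.one_comp h _
  | comp_one i x => exact Q.comp_one i _
  | comp_assoc h₁ h₂ h₃ h₄ i j x y z => exact Q.comp_assoc h₁ h₂ h₃ h₄ i j _ _ _
  | comp_comm h₁ h₂ h₃ h₄ i j hij x y z => exact Q.comp_comm h₁ h₂ h₃ h₄ i j hij _ _ _
  | comp_act h i σ τ ρ h1 h2 x y => exact Q.comp_act h i σ τ ρ h1 h2 _ _

/-- The homomorphism out of a presented operad that is given by `g` on generators. -/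
def presentedLift (hg : ∀ e, g (E.swap e) = Q.act (Equiv.swap 0 1) (g e))
    (hS : ∀ x, S x → x.value Q g = 0) : Operad.Hom (presentedOperad S) Q where
  map n :=
    { toFun := Quot.lift (fun x : OpTerm E n => x.value Q g)
        (fun _ _ h => OpTerm.value_eq_of_rel hg hS h)
      map_add' := by
        rintro ⟨x⟩ ⟨y⟩
        rfl
      map_smul' := by
        rintro c ⟨x⟩
        rfl }
  map_one := rfl
  map_act := by
    rintro n σ ⟨x⟩
    rfl
  map_comp := by
    rintro m n N h i ⟨x⟩ ⟨y⟩
    rfl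

end Lift

/-! ### Labelled operations -/

namespace Operad

variable {k : Type u} [Field k] (P : Operad k) (X : Type)

/-- The relations `(p σ)(x_{w 1}, …, x_{w m}) = p(x_{w (σ 1)}, …, x_{w (σ m)})`. -/
def wordRelations : Submodule k (Π₀ w : Σ m, Fin m → X, P.obj w.1) :=
  letI := Classical.decEq (Σ m, Fin m → X)
  Submodule.span k {x | ∃ (m : ℕ) (w : Fin m → X) (σ : Equiv.Perm (Fin m)) (p : P.obj m),
    x = DFinsupp.lsingle (R := k) (M := fun w : Σ m, Fin m → X => P.obj w.1) ⟨m, w⟩ (P.act σ p) -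
      DFinsupp.lsingle (R := k) (M := fun w : Σ m, Fin m → X => P.obj w.1) ⟨m, w ∘ σ⟩ p}

/-- The space of operations of `P` with inputs labelled by elements of `X`, i.e. the free
`P`-algebra `⨁_m P(m) ⊗_{Σ_m} V^{⊗ m}` on the vector space `V` with basis `X`. -/
def LabelledOps : Type u := (Π₀ w : Σ m, Fin m → X, P.obj w.1) ⧸ P.wordRelations X

instance : AddCommGroup (P.LabelledOps X) :=
  inferInstanceAs (AddCommGroup ((Π₀ w : Σ m, Fin m → X, P.obj w.1) ⧸ P.wordRelations X))

instance : Module k (P.LabelledOps X) :=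
  inferInstanceAs (Module k ((Π₀ w : Σ m, Fin m → X, P.obj w.1) ⧸ P.wordRelations X))

variable {X}

/-- The operation `p` with its inputs labelled by `w`. -/
def label {m : ℕ} (w : Fin m → X) : P.obj m →ₗ[k] P.LabelledOps X :=
  letI := Classical.decEq (Σ m, Fin m → X)
  (P.wordRelations X).mkQ ∘ₗ
    DFinsupp.lsingle (R := k) (M := fun w : Σ m, Fin m → X => P.obj w.1) ⟨m, w⟩

variable {P}

theorem label_act {m : ℕ} {w w' : Fin m → X} {σ : Equiv.Perm (Fin m)} (h : ∀ z, w (σ z) = w' z)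
    (p : P.obj m) : P.label w (P.act σ p) = P.label w' p := by
  obtain rfl : w' = w ∘ σ := funext fun z => (h z).symm
  rw [← sub_eq_zero]
  let _ := Classical.decEq (Σ m, Fin m → X)
  refine (Submodule.Quotient.mk_eq_zero (P.wordRelations X)).2 (Submodule.subset_span ?_)
  exact ⟨m, w, σ, p, rfl⟩

section Desc

variable {V : Type*} [AddCommGroup V] [Module k V]

/-- Linear maps out of the space of labelled operations. -/
def desc (L : ∀ {m : ℕ} (_ : Fin m → X), P.obj m →ₗ[k] V)
    (hL : ∀ {m : ℕ} (w : Fin m → X) (σ : Equiv.Perm (Fin m)) (p : P.obj m),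
      L w (P.act σ p) = L (w ∘ σ) p) : P.LabelledOps X →ₗ[k] V :=
  letI := Classical.decEq (Σ m, Fin m → X)
  (P.wordRelations X).liftQ (DFinsupp.lsum k (fun w : Σ m, Fin m → X => L w.2)) (by
    rw [wordRelations, Submodule.span_le]
    rintro x ⟨m, w, σ, p, rfl⟩
    simp [hL])

theorem desc_label (L : ∀ {m : ℕ} (_ : Fin m → X), P.obj m →ₗ[k] V)
    (hL : ∀ {m : ℕ} (w : Fin m → X) (σ : Equiv.Perm (Fin m)) (p : P.obj m),
      L w (P.act σ p) = L (w ∘ σ) p) {m : ℕ} (w : Fin m → X) (p : P.obj m) :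
    desc (fun {_} w => L w) hL (P.label w p) = L w p := by
  let _ := Classical.decEq (Σ m, Fin m → X)
  refine (Submodule.liftQ_apply _ _ _).trans ?_
  simp

theorem labelledOps_hom_ext {f g : P.LabelledOps X →ₗ[k] V}
    (h : ∀ {m : ℕ} (w : Fin m → X) (p : P.obj m), f (P.label w p) = g (P.label w p)) : f = g := by
  let _ := Classical.decEq (Σ m, Fin m → X)
  refine Submodule.linearMap_qext _ (DFinsupp.lhom_ext' fun w => LinearMap.ext fun p => ?_)
  exact h w.2 p

end Desc

/-! ### Binary products of labelled operations -/

/-- Concatenation of words. -/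
def concat {r s N : ℕ} (h : r + s = N) (u : Fin r → X) (v : Fin s → X) (z : Fin N) : X :=
  if hz : (z : ℕ) < r then u ⟨z, hz⟩ else v ⟨z - r, by omega⟩

theorem concat_left {r s N : ℕ} (h : r + s = N) (u : Fin r → X) (v : Fin s → X) (z : Fin N)
    (y : Fin r) (hz : (z : ℕ) = y) : concat h u v z = u y := by
  rw [concat, dif_pos (by omega)]
  congr 1
  exact Fin.ext hz

theorem concat_right {r s N : ℕ} (h : r + s = N) (u : Fin r → X) (v : Fin s → X) (z : Fin N)
    (y : Fin s) (hz : (z : ℕ) = r + y) : concat h u v z = v y := by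
  rw [concat, dif_neg (by omega)]
  congr 1
  exact Fin.ext (by simp; omega)

variable (P) in
/-- The composition `c(a, b)` of a binary operation with two operations. -/
def binary {r s N : ℕ} (h : r + s = N) (c : P.obj 2) : P.obj r →ₗ[k] P.obj s →ₗ[k] P.obj N :=
  (P.comp (m := 1 + s) (n := r) (N := N) (by omega) ⟨0, by omega⟩ ∘ₗ
    P.comp (m := 2) (n := s) (N := 1 + s) (by omega) 1 c).flip

theorem binary_apply {r s N : ℕ} (h : r + s = N) (c : P.obj 2) (a : P.obj r) (b : P.obj s) :
    P.binary h c a b = P.comp (m := 1 + s) (n := r) (N := N) (by omega) ⟨0, by omega⟩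
      (P.comp (m := 2) (n := s) (N := 1 + s) (by omega) 1 c b) a := rfl

end Operad

namespace IsBlockPerm

variable {m n N : ℕ} {h : m + n = N + 1} {i : Fin m} {σ : Equiv.Perm (Fin m)}
  {τ : Equiv.Perm (Fin n)} {ρ : Equiv.Perm (Fin N)}

theorem val_inner (H : IsBlockPerm h i σ τ ρ) (z : Fin N) (y : Fin n) (hz : (z : ℕ) = i + y) :
    (ρ z : ℕ) = σ i + τ y := by
  obtain rfl : z = Slot.inner h i y := Fin.ext hz
  rw [H.inner]
  rfl

theorem val_outer (H : IsBlockPerm h i σ τ ρ) (z : Fin N) (x : Fin m) (hx : x ≠ i)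
    (hz : (z : ℕ) = if (x : ℕ) < i then (x : ℕ) else x + n - 1) :
    (ρ z : ℕ) = if (σ x : ℕ) < σ i then (σ x : ℕ) else σ x + n - 1 := by
  obtain rfl : z = Slot.outer h i x hx := Fin.ext hz
  rw [H.outer]
  rfl

end IsBlockPerm

namespace Operad

variable {k : Type u} [Field k] {P : Operad k} {X : Type}

theorem comp_act_of_isBlockPerm {m n N : ℕ} {h : m + n = N + 1} {i : Fin m}
    {σ : Equiv.Perm (Fin m)} {τ : Equiv.Perm (Fin n)} {ρ : Equiv.Perm (Fin N)}
    (H : IsBlockPerm h i σ τ ρ) {i' : Fin m} (hi : σ i = i') (p : P.obj m) (q : P.obj n) :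
    P.comp h i' (P.act σ p) (P.act τ q) = P.act ρ (P.comp h i p q) := by
  subst hi
  exact P.comp_act h i σ τ ρ H.inner H.outer p q

theorem comp_act_left {m n N : ℕ} {h : m + n = N + 1} {i : Fin m}
    {σ : Equiv.Perm (Fin m)} {ρ : Equiv.Perm (Fin N)}
    (H : IsBlockPerm h i σ 1 ρ) {i' : Fin m} (hi : σ i = i') (p : P.obj m) (q : P.obj n) :
    P.comp h i' (P.act σ p) q = P.act ρ (P.comp h i p q) := by
  have := comp_act_of_isBlockPerm H hi p q
  rwa [P.act_one] at this

theorem comp_act_right {m n N : ℕ} {h : m + n = N + 1} {i : Fin m}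
    {τ : Equiv.Perm (Fin n)} {ρ : Equiv.Perm (Fin N)}
    (H : IsBlockPerm h i 1 τ ρ) (p : P.obj m) (q : P.obj n) :
    P.comp h i p (P.act τ q) = P.act ρ (P.comp h i p q) := by
  have := comp_act_of_isBlockPerm H rfl p q
  rwa [P.act_one] at this

/-- Sequential associativity, with the slot given by its number. -/
theorem comp_assoc' {m n l M L N : ℕ} (h₁ : m + n = M + 1) (h₂ : M + l = N + 1)
    (h₃ : n + l = L + 1) (h₄ : m + L = N + 1) (i : Fin m) (j : Fin n) (z : Fin M)
    (hz : (z : ℕ) = i + j) (p : P.obj m) (q : P.obj n) (r : P.obj l) :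
    P.comp h₂ z (P.comp h₁ i p q) r = P.comp h₄ i p (P.comp h₃ j q r) := by
  obtain rfl : z = Slot.inner h₁ i j := Fin.ext hz
  exact P.comp_assoc h₁ h₂ h₃ h₄ i j p q r

/-- Parallel associativity, with the slots given by their numbers. -/
theorem comp_comm' {m n l M L N : ℕ} (h₁ : m + n = M + 1) (h₂ : M + l = N + 1)
    (h₃ : m + l = L + 1) (h₄ : L + n = N + 1) (i j : Fin m) (hij : (i : ℕ) < j) (z : Fin M)
    (hz : (z : ℕ) + 1 = j + n) (w : Fin L) (hw : (w : ℕ) = i)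
    (p : P.obj m) (q : P.obj n) (r : P.obj l) :
    P.comp h₂ z (P.comp h₁ i p q) r = P.comp h₄ w (P.comp h₃ j p r) q := by
  have hlt : i < j := hij
  obtain rfl : z = Slot.outer h₁ i j hlt.ne' := by
    simp only [Slot.outer, Fin.ext_iff, Fin.lt_def]
    split_ifs <;> omega
  obtain rfl : w = Slot.outer h₃ j i hlt.ne := by
    simp only [Slot.outer, Fin.ext_iff, Fin.lt_def]
    split_ifs; omega
  exact P.comp_comm h₁ h₂ h₃ h₄ i j hlt.ne p q r

theorem label_binary_act_left {r s N : ℕ} (h : r + s = N) (c : P.obj 2) (a : P.obj r) (b : P.obj s)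
    (u : Fin r → X) (v : Fin s → X) (σ : Equiv.Perm (Fin r)) :
    P.label (concat h u v) (P.binary h c (P.act σ a) b) =
      P.label (concat h (u ∘ σ) v) (P.binary h c a b) := by
  obtain ⟨ρ, H⟩ := IsBlockPerm.exists_rel (m := 1 + s) (n := r) (N := N) (by omega)
    ⟨0, by omega⟩ 1 σ
  rw [binary_apply, binary_apply, comp_act_right H]
  refine label_act (fun z => ?_) _
  by_cases hz : (z : ℕ) < r
  · have := H.val_inner z ⟨z, hz⟩ (by simp)
    rw [concat_left h u v _ (σ ⟨z, hz⟩) (by simpa using this), concat_left h _ _ _ ⟨z, hz⟩ rfl]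
    rfl
  · have := H.val_outer z ⟨z - r + 1, by omega⟩ (by simp [Fin.ext_iff]) (by simp; omega)
    simp only [Equiv.Perm.one_apply, Nat.not_lt_zero, if_false] at this
    rw [concat_right h u v _ ⟨z - r, by omega⟩ (by simp; omega),
      concat_right h _ _ _ ⟨z - r, by omega⟩ (by simp; omega)]

theorem label_binary_act_right {r s N : ℕ} (h : r + s = N) (c : P.obj 2) (a : P.obj r)
    (b : P.obj s) (u : Fin r → X) (v : Fin s → X) (τ : Equiv.Perm (Fin s)) :
    P.label (concat h u v) (P.binary h c a (P.act τ b)) =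
      P.label (concat h u (v ∘ τ)) (P.binary h c a b) := by
  obtain ⟨ρ₁, H₁⟩ := IsBlockPerm.exists_rel (m := 2) (n := s) (N := 1 + s) (by omega) 1 1 τ
  obtain ⟨ρ, H⟩ := IsBlockPerm.exists_rel (m := 1 + s) (n := r) (N := N) (by omega)
    ⟨0, by omega⟩ ρ₁ 1
  have h0 : ρ₁ ⟨0, by omega⟩ = ⟨0, by omega⟩ :=
    Fin.ext (by simpa using H₁.val_outer ⟨0, by omega⟩ 0 (by simp) (by simp))
  rw [binary_apply, binary_apply, comp_act_right H₁, comp_act_left H h0]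
  refine label_act (fun z => ?_) _
  by_cases hz : (z : ℕ) < r
  · have := H.val_inner z ⟨z, hz⟩ (by simp)
    rw [h0] at this
    rw [concat_left h u v _ ⟨z, hz⟩ (by simpa using this), concat_left h _ _ _ ⟨z, hz⟩ rfl]
  · have := H.val_outer z ⟨z - r + 1, by omega⟩ (by simp [Fin.ext_iff]) (by simp; omega)
    have e := H₁.val_inner ⟨z - r + 1, by omega⟩ ⟨z - r, by omega⟩ (by simp; omega)
    rw [h0, e] at this
    simp only [Equiv.Perm.one_apply, Nat.not_lt_zero, if_false, Fin.val_one] at this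
    rw [concat_right h u v _ (τ ⟨z - r, by omega⟩) (by omega),
      concat_right h _ _ _ ⟨z - r, by omega⟩ (by simp; omega)]
    rfl

theorem label_binary_swap {r s N : ℕ} (h : r + s = N) (h' : s + r = N) (c : P.obj 2) (a : P.obj r)
    (b : P.obj s) (u : Fin r → X) (v : Fin s → X) :
    P.label (concat h u v) (P.binary h (P.act (Equiv.swap 0 1) c) a b) =
      P.label (concat h' v u) (P.binary h' c b a) := by
  obtain ⟨ρ₁, H₁⟩ := IsBlockPerm.exists_rel (m := 2) (n := s) (N := 1 + s) (by omega) 0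
    (Equiv.swap 0 1) 1
  obtain ⟨ρ, H⟩ := IsBlockPerm.exists_rel (m := 1 + s) (n := r) (N := N) (by omega)
    ⟨s, by omega⟩ ρ₁ 1
  have h0 : ρ₁ ⟨s, by omega⟩ = ⟨0, by omega⟩ :=
    Fin.ext (by simpa using H₁.val_outer ⟨s, by omega⟩ 1 (by simp) (by simp))
  rw [binary_apply, binary_apply, comp_act_left H₁ (Equiv.swap_apply_left 0 1),
    comp_act_left H h0, comp_comm' (m := 2) (L := 1 + r) _ _ (by omega) (by omega) 0 1 (by simp) _
      (by simp; omega) ⟨0, by omega⟩ rfl]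
  refine label_act (fun z => ?_) _
  by_cases hz : (z : ℕ) < s
  · have := H.val_outer z ⟨z, by omega⟩ (by simp [Fin.ext_iff]; omega) (by simp [hz])
    have e := H₁.val_inner ⟨z, by omega⟩ ⟨z, hz⟩ (by simp)
    rw [h0, e] at this
    simp only [Equiv.Perm.one_apply, Nat.not_lt_zero, if_false, Equiv.swap_apply_left,
      Fin.val_one] at this
    rw [concat_right h u v _ ⟨z, hz⟩ (by simp; omega), concat_left h' _ _ _ ⟨z, hz⟩ rfl]
  · have := H.val_inner z ⟨z - s, by omega⟩ (by simp; omega)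
    rw [h0] at this
    rw [concat_left h u v _ ⟨z - s, by omega⟩ (by simpa using this),
      concat_right h' _ _ _ ⟨z - s, by omega⟩ (by simp; omega)]

/-- The product `c(x, y)` of labelled operations, for fixed `c` and for `x = a` labelled by `u`. -/
def labelMul (c : P.obj 2) {r : ℕ} (u : Fin r → X) (a : P.obj r) :
    P.LabelledOps X →ₗ[k] P.LabelledOps X :=
  desc (fun {_} v => P.label (concat rfl u v) ∘ₗ P.binary rfl c a)
    (fun v τ b => label_binary_act_right rfl c a b u v τ)

theorem labelMul_label (c : P.obj 2) {r s : ℕ} (u : Fin r → X) (a : P.obj r) (v : Fin s → X)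
    (b : P.obj s) : labelMul c u a (P.label v b) =
      P.label (concat rfl u v) (P.binary rfl c a b) :=
  desc_label _ (fun v τ b => label_binary_act_right rfl c a b u v τ) _ _

/-- The product `c(x, y)` of labelled operations, as a function of the operation `x = a`. -/
def labelMulₗ (c : P.obj 2) {r : ℕ} (u : Fin r → X) :
    P.obj r →ₗ[k] P.LabelledOps X →ₗ[k] P.LabelledOps X where
  toFun := labelMul c u
  map_add' a a' := labelledOps_hom_ext fun v b => by
    simp only [LinearMap.add_apply, labelMul_label, map_add]
  map_smul' d a := labelledOps_hom_ext fun v b => by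
    simp only [LinearMap.smul_apply, labelMul_label, map_smul, RingHom.id_apply]

theorem labelMulₗ_act (c : P.obj 2) {r : ℕ} (u : Fin r → X) (σ : Equiv.Perm (Fin r))
    (a : P.obj r) : labelMulₗ c u (P.act σ a) = labelMulₗ c (u ∘ σ) a :=
  labelledOps_hom_ext fun v b =>
    ((labelMul_label c u _ v b).trans (label_binary_act_left rfl c a b u v σ)).trans
      (labelMul_label c _ a v b).symm

/-- The product `c(x, y)` of labelled operations, for fixed `c`. -/
def mul (c : P.obj 2) : P.LabelledOps X →ₗ[k] P.LabelledOps X →ₗ[k] P.LabelledOps X :=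
  desc (fun {_} u => labelMulₗ c u) (fun u σ a => labelMulₗ_act c u σ a)

theorem mul_label (c : P.obj 2) {r s N : ℕ} (h : r + s = N) (u : Fin r → X) (a : P.obj r)
    (v : Fin s → X) (b : P.obj s) :
    mul c (P.label u a) (P.label v b) = P.label (concat h u v) (P.binary h c a b) := by
  subst h
  have := desc_label (fun {m} (u : Fin m → X) => labelMulₗ c u)
    (fun u σ a => labelMulₗ_act c u σ a) u a
  exact (LinearMap.congr_fun this _).trans (labelMul_label c u a v b)

/-- The product `c(x, y)` of labelled operations, as a bilinear operation depending linearly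
on `c`. -/
def mulOp : P.obj 2 →ₗ[k] (endOperad k (P.LabelledOps X)).obj 2 where
  toFun c := (MultilinearMap.mk' (fun v => mul c (v 0) (v 1))
    (by
      intro v i a b
      fin_cases i <;> simp)
    (by
      intro v i d a
      fin_cases i <;> simp) : MultilinearMap k (fun _ : Fin 2 => P.LabelledOps X) _)
  map_add' c c' := by
    have : mul (X := X) (c + c') = mul c + mul c' :=
      labelledOps_hom_ext fun u a => labelledOps_hom_ext fun v b => by
        simp only [LinearMap.add_apply, mul_label _ rfl, binary_apply, map_add]
    refine MultilinearMap.ext fun v => ?_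
    change mul (c + c') (v 0) (v 1) = mul c (v 0) (v 1) + mul c' (v 0) (v 1)
    rw [this]
    rfl
  map_smul' d c := by
    have : mul (X := X) (d • c) = d • mul c :=
      labelledOps_hom_ext fun u a => labelledOps_hom_ext fun v b => by
        simp only [LinearMap.smul_apply, mul_label _ rfl, binary_apply, map_smul]
    refine MultilinearMap.ext fun v => ?_
    change mul (d • c) (v 0) (v 1) = d • mul c (v 0) (v 1)
    rw [this]
    rfl

theorem mulOp_apply (c : P.obj 2) (v : Fin 2 → P.LabelledOps X) :
    (show MultilinearMap k (fun _ : Fin 2 => P.LabelledOps X) _ from mulOp c) v =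
      mul c (v 0) (v 1) := rfl

theorem mulOp_swap (c : P.obj 2) :
    mulOp (X := X) (P.act (Equiv.swap 0 1) c) =
      (endOperad k (P.LabelledOps X)).act (Equiv.swap 0 1) (mulOp c) := by
  have : mul (X := X) (P.act (Equiv.swap 0 1) c) = (mul c).flip :=
    labelledOps_hom_ext fun {r} u a => labelledOps_hom_ext fun {s} v b => by
      rw [LinearMap.flip_apply, mul_label _ rfl, mul_label _ (Nat.add_comm s r)]
      exact label_binary_swap _ _ _ _ _ _ _
  refine MultilinearMap.ext fun v => ?_
  change mul (P.act (Equiv.swap 0 1) c) (v 0) (v 1) =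
    mul c (v (Equiv.swap 0 1 0)) (v (Equiv.swap 0 1 1))
  rw [this, Equiv.swap_apply_left, Equiv.swap_apply_right, LinearMap.flip_apply]

end Operad

/-! ### Ternary compositions of labelled operations -/

namespace Operad

variable {k : Type u} [Field k] {X : Type}

theorem binary_endOperad_apply {A : Type u} [AddCommGroup A] [Module k A] {r s N : ℕ}
    (h : r + s = N) (f : MultilinearMap k (fun _ : Fin 2 => A) A)
    (a : MultilinearMap k (fun _ : Fin r => A) A) (b : MultilinearMap k (fun _ : Fin s => A) A)
    (v : Fin N → A) :
    (show MultilinearMap k (fun _ : Fin N => A) A from (endOperad k A).binary h f a b) v =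
      f ![a (fun y => v ⟨y, by omega⟩), b (fun y => v ⟨r + y, by omega⟩)] := by
  change f (EndOp.args (m := 2) (n := s) (N := 1 + s) (by omega) 1 b
    (EndOp.args (m := 1 + s) (n := r) (N := N) (by omega) ⟨0, by omega⟩ a v)) = _
  congr 1
  funext x
  fin_cases x
  · simp [EndOp.args, Slot.outer, Slot.inner]
  · simp only [EndOp.args, Slot.outer, Slot.inner]
    simp [Fin.ext_iff]
    congr 1
    funext y
    congr 2
    omega

theorem Hom.map_binary {P Q : Operad k} (α : Hom P Q) {r s N : ℕ} (h : r + s = N) (c : P.obj 2)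
    (a : P.obj r) (b : P.obj s) :
    α.map N (P.binary h c a b) = Q.binary h (α.map 2 c) (α.map r a) (α.map s b) := by
  simp only [binary_apply, α.map_comp]

section Ternary

variable {P : Operad k}

variable (P) in
/-- The composition `p(a, b, c)` of a ternary operation with three operations. -/
def ternary {r s t N : ℕ} (h : r + s + t = N) (p : P.obj 3) (a : P.obj r) (b : P.obj s)
    (c : P.obj t) : P.obj N :=
  P.comp (m := 1 + s + t) (n := r) (N := N) (by omega) ⟨0, by omega⟩
    (P.comp (m := 2 + t) (n := s) (N := 1 + s + t) (by omega) ⟨1, by omega⟩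
      (P.comp (m := 3) (n := t) (N := 2 + t) (by omega) 2 p c) b) a

/-- `(e ∘_1 f)(a, b, c) = e(f(a, b), c)`. -/
theorem ternary_comp_zero {r s t N : ℕ} (h : r + s + t = N) (e f : P.obj 2) (a : P.obj r)
    (b : P.obj s) (c : P.obj t) :
    P.ternary h (P.comp (n := 2) (N := 3) rfl 0 e f) a b c =
      P.binary h e (P.binary rfl f a b) c := by
  have e1 := comp_comm' (P := P) (m := 2) (n := 2) (l := t) (M := 3) (L := 1 + t) (N := 2 + t)
    rfl (by omega) (by omega) (by omega) 0 1 (by simp) 2 rfl ⟨0, by omega⟩ rfl e f c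
  have e2 := comp_assoc' (P := P) (m := 1 + t) (n := 2) (l := s) (M := 2 + t) (L := 1 + s)
    (N := 1 + s + t) (by omega) (by omega) (by omega) (by omega) ⟨0, by omega⟩ 1 ⟨1, by omega⟩
    (by simp) (P.comp (N := 1 + t) (by omega) 1 e c) f b
  have e3 := comp_assoc' (P := P) (m := 1 + t) (n := 1 + s) (l := r) (M := 1 + s + t) (L := r + s)
    (N := N) (by omega) (by omega) (by omega) (by omega) ⟨0, by omega⟩ ⟨0, by omega⟩ ⟨0, by omega⟩
    (by simp) (P.comp (N := 1 + t) (by omega) 1 e c)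
    (P.comp (N := 1 + s) (by omega) 1 f b) a
  rw [ternary, e1, e2, e3]
  rfl

/-- `(e ∘_2 f)(a, b, c) = e(a, f(b, c))`. -/
theorem ternary_comp_one {r s t N : ℕ} (h : r + s + t = N) (h' : r + (s + t) = N) (e f : P.obj 2)
    (a : P.obj r) (b : P.obj s) (c : P.obj t) :
    P.ternary h (P.comp (n := 2) (N := 3) rfl 1 e f) a b c =
      P.binary h' e a (P.binary rfl f b c) := by
  have e1 := comp_assoc' (P := P) (m := 2) (n := 2) (l := t) (M := 3) (L := 1 + t) (N := 2 + t)
    rfl (by omega) (by omega) (by omega) 1 1 2 rfl e f c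
  have e2 := comp_assoc' (P := P) (m := 2) (n := 1 + t) (l := s) (M := 2 + t) (L := s + t)
    (N := 1 + s + t) (by omega) (by omega) (by omega) (by omega) 1 ⟨0, by omega⟩ ⟨1, by omega⟩
    rfl e (P.comp (N := 1 + t) (by omega) 1 f c) b
  rw [ternary, e1, e2]
  have e3 : ∀ (M : ℕ) (eM : M = 1 + (s + t)) (h₁ : 2 + (s + t) = M + 1) (h₂ : M + r = N + 1)
      (hM : 0 < M), P.comp h₂ ⟨0, hM⟩ (P.comp h₁ 1 e (P.binary rfl f b c)) a =
        P.binary h' e a (P.binary rfl f b c) := by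
    rintro M rfl h₁ h₂ hM
    rfl
  exact e3 (1 + s + t) (by omega) (by omega) (by omega) (by omega)

/-- A transposition of the inputs of `p` permutes the blocks of inputs of `p(a, b, c)`, so that it
exchanges the labelled operations `b` and `c`. -/
theorem label_ternary_swap_one_two {r s t N : ℕ} (h : r + s + t = N) (h' : r + t + s = N)
    (p : P.obj 3) (a : P.obj r) (b : P.obj s) (c : P.obj t) (u : Fin r → X) (v : Fin s → X)
    (w : Fin t → X) :
    P.label (concat h (concat rfl u v) w) (P.ternary h (P.act (Equiv.swap 1 2) p) a b c) =
      P.label (concat h' (concat rfl u w) v) (P.ternary h' p a c b) := by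
  obtain ⟨ρ₁, H₁⟩ := IsBlockPerm.exists_rel (m := 3) (n := t) (N := 2 + t) (by omega) 1
    (Equiv.swap 1 2) 1
  obtain ⟨ρ₂, H₂⟩ := IsBlockPerm.exists_rel (m := 2 + t) (n := s) (N := 1 + s + t) (by omega)
    ⟨1 + t, by omega⟩ ρ₁ 1
  obtain ⟨ρ₃, H₃⟩ := IsBlockPerm.exists_rel (m := 1 + s + t) (n := r) (N := N) (by omega)
    ⟨0, by omega⟩ ρ₂ 1
  have h1 : ρ₁ ⟨1 + t, by omega⟩ = ⟨1, by omega⟩ :=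
    Fin.ext (by simpa using H₁.val_outer ⟨1 + t, by omega⟩ 2 (by decide) (by simp))
  have h10 : (ρ₁ ⟨0, by omega⟩ : ℕ) = 0 := by
    have := H₁.val_outer ⟨0, by omega⟩ 0 (by decide) (by simp)
    rw [Equiv.swap_apply_of_ne_of_ne (by decide) (by decide)] at this
    simpa using this
  have h2 : ρ₂ ⟨0, by omega⟩ = ⟨0, by omega⟩ := by
    have := H₂.val_outer ⟨0, by omega⟩ ⟨0, by omega⟩ (by simp [Fin.ext_iff]; omega) (by simp)
    rw [h1, h10] at this
    exact Fin.ext (by simpa using this)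
  rw [ternary, ternary, comp_act_left H₁ (Equiv.swap_apply_left 1 2), comp_act_left H₂ h1,
    comp_act_left H₃ h2, comp_comm' (m := 3) (L := 2 + s) _ _ (by omega) (by omega) 1 2
      (by decide) _ (by simp; omega) ⟨1, by omega⟩ rfl]
  have e1 : 1 + s + t = 1 + t + s := by omega
  have e2 : ∀ (M : ℕ) (eM : M = 1 + s + t) (h₁ : 2 + s + t = M + 1) (h₂ : M + r = N + 1)
      (hM : 0 < M), P.comp h₂ ⟨0, hM⟩ (P.comp h₁ ⟨1, by omega⟩
        (P.comp (m := 3) (n := s) (N := 2 + s) (by omega) 2 p b) c) a =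
      P.comp (m := 1 + s + t) (N := N) (by omega) ⟨0, by omega⟩
        (P.comp (m := 2 + s) (N := 1 + s + t) (by omega) ⟨1, by omega⟩
        (P.comp (m := 3) (n := s) (N := 2 + s) (by omega) 2 p b) c) a := by
    rintro M rfl h₁ h₂ hM
    rfl
  rw [e2 (1 + t + s) (by omega) (by omega) (by omega) (by omega)]
  refine label_act (fun z => ?_) _
  by_cases hz : (z : ℕ) < r
  · have := H₃.val_inner z ⟨z, hz⟩ (by simp)
    rw [h2] at this
    rw [concat_left h _ w _ ⟨z, by omega⟩ (by simpa using this),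
      concat_left rfl u v _ ⟨z, hz⟩ (by simp),
      concat_left h' _ v _ ⟨z, by omega⟩ rfl, concat_left rfl u w _ ⟨z, hz⟩ rfl]
  · have e3 := H₃.val_outer z ⟨z - r + 1, by omega⟩ (by simp [Fin.ext_iff]) (by simp; omega)
    rw [h2] at e3
    simp only [Nat.not_lt_zero, if_false] at e3
    by_cases hz' : (z : ℕ) < r + t
    · have e4 := H₂.val_outer ⟨z - r + 1, by omega⟩ ⟨z - r + 1, by omega⟩
        (by simp [Fin.ext_iff]; omega) (by simp; omega)
      have e5 := H₁.val_inner ⟨z - r + 1, by omega⟩ ⟨z - r, by omega⟩ (by simp; omega)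
      rw [Equiv.swap_apply_left] at e5
      simp only [Equiv.Perm.one_apply, Fin.val_two] at e5
      rw [h1, e5, if_neg (by simp)] at e4
      rw [concat_right h _ w _ ⟨z - r, by omega⟩ (by simp; omega),
        concat_left h' _ v _ ⟨z, by omega⟩ rfl, concat_right rfl u w _ ⟨z - r, by omega⟩
          (by simp; omega)]
    · have e4 := H₂.val_inner ⟨z - r + 1, by omega⟩ ⟨z - r - t, by omega⟩ (by simp; omega)
      rw [h1] at e4
      simp only [Equiv.Perm.one_apply] at e4
      rw [concat_left h _ w _ ⟨r + (z - r - t), by omega⟩ (by simp; omega),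
        concat_right rfl u v _ ⟨z - r - t, by omega⟩ (by simp),
        concat_right h' _ v _ ⟨z - r - t, by omega⟩ (by simp; omega)]

/-- As in `label_ternary_swap_one_two`, for the first two inputs. -/
theorem label_ternary_swap_zero_one {r s t N : ℕ} (h : r + s + t = N) (h' : s + r + t = N)
    (p : P.obj 3) (a : P.obj r) (b : P.obj s) (c : P.obj t) (u : Fin r → X) (v : Fin s → X)
    (w : Fin t → X) :
    P.label (concat h (concat rfl u v) w) (P.ternary h (P.act (Equiv.swap 0 1) p) a b c) =
      P.label (concat h' (concat rfl v u) w) (P.ternary h' p b a c) := by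
  obtain ⟨ρ₁, H₁⟩ := IsBlockPerm.exists_rel (m := 3) (n := t) (N := 2 + t) (by omega) 2
    (Equiv.swap 0 1) 1
  obtain ⟨ρ₂, H₂⟩ := IsBlockPerm.exists_rel (m := 2 + t) (n := s) (N := 1 + s + t) (by omega)
    ⟨0, by omega⟩ ρ₁ 1
  obtain ⟨ρ₃, H₃⟩ := IsBlockPerm.exists_rel (m := 1 + s + t) (n := r) (N := N) (by omega)
    ⟨s, by omega⟩ ρ₂ 1
  have hs2 : Equiv.swap (0 : Fin 3) 1 2 = 2 := by decide
  have h10 : ρ₁ ⟨0, by omega⟩ = ⟨1, by omega⟩ := by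
    have := H₁.val_outer ⟨0, by omega⟩ 0 (by decide) (by simp)
    rw [Equiv.swap_apply_left, hs2] at this
    exact Fin.ext (by simpa using this)
  have h11 : (ρ₁ ⟨1, by omega⟩ : ℕ) = 0 := by
    have := H₁.val_outer ⟨1, by omega⟩ 1 (by decide) (by simp)
    rw [Equiv.swap_apply_right, hs2] at this
    simpa using this
  have h1 : ∀ (y : ℕ) (hy : y < t), (ρ₁ ⟨2 + y, by omega⟩ : ℕ) = 2 + y := by
    intro y hy
    have := H₁.val_inner ⟨2 + y, by omega⟩ ⟨y, hy⟩ (by simp)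
    rw [hs2] at this
    simpa using this
  have h2 : ρ₂ ⟨s, by omega⟩ = ⟨0, by omega⟩ := by
    have := H₂.val_outer ⟨s, by omega⟩ ⟨1, by omega⟩ (by simp [Fin.ext_iff]) (by simp)
    rw [h10, h11] at this
    exact Fin.ext (by simpa using this)
  rw [ternary, ternary, comp_act_left H₁ hs2, comp_act_left H₂ h10,
    comp_act_left H₃ h2, comp_comm' (m := 2 + t) (L := 1 + r + t) _ _ (by omega) (by omega)
      ⟨0, by omega⟩ ⟨1, by omega⟩ (by simp) _ (by simp; omega) ⟨0, by omega⟩ rfl]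
  refine label_act (fun z => ?_) _
  by_cases hz : (z : ℕ) < s
  · have e3 := H₃.val_outer z ⟨z, by omega⟩ (by simp [Fin.ext_iff]; omega) (by simp [hz])
    have e4 := H₂.val_inner ⟨z, by omega⟩ ⟨z, hz⟩ (by simp)
    rw [h10] at e4
    simp only [Equiv.Perm.one_apply] at e4
    rw [h2, e4] at e3
    simp only [Nat.not_lt_zero, if_false] at e3
    rw [concat_left h _ w _ ⟨r + z, by omega⟩ (by simp; omega),
      concat_right rfl u v _ ⟨z, hz⟩ (by simp),
      concat_left h' _ w _ ⟨z, by omega⟩ rfl, concat_left rfl v u _ ⟨z, hz⟩ rfl]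
  · by_cases hz' : (z : ℕ) < s + r
    · have e3 := H₃.val_inner z ⟨z - s, by omega⟩ (by simp; omega)
      rw [h2] at e3
      simp only [Equiv.Perm.one_apply] at e3
      rw [concat_left h _ w _ ⟨z - s, by omega⟩ (by simp; omega),
        concat_left rfl u v _ ⟨z - s, by omega⟩ rfl,
        concat_left h' _ w _ ⟨z, by omega⟩ rfl,
        concat_right rfl v u _ ⟨z - s, by omega⟩ (by simp; omega)]
    · have e3 := H₃.val_outer z ⟨z - r + 1, by omega⟩ (by simp [Fin.ext_iff]; omega) (by
        change (z : ℕ) = if (z : ℕ) - r + 1 < s then _ else (z : ℕ) - r + 1 + r - 1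
        rw [if_neg (by omega)]
        omega)
      have e4 := H₂.val_outer ⟨z - r + 1, by omega⟩ ⟨2 + (z - r - s), by omega⟩
        (by simp [Fin.ext_iff]) (by simp; omega)
      rw [h10, h1 _ (by omega), if_neg (by simp)] at e4
      rw [h2, e4] at e3
      simp only [Nat.not_lt_zero, if_false] at e3
      rw [concat_right h _ w _ ⟨z - r - s, by omega⟩ (by simp; omega),
        concat_right h' _ w _ ⟨z - r - s, by omega⟩ (by simp; omega)]

end Ternary

end Operad

/-! ### The free algebra of a presented operad -/

namespace Operad

variable {k : Type u} [Field k] {P : Operad k} {X : Type}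

theorem concat_assoc {r s t M L N : ℕ} (h₁ : r + s = M) (h₂ : M + t = N) (h₃ : s + t = L)
    (h₄ : r + L = N) (u : Fin r → X) (v : Fin s → X) (w : Fin t → X) :
    concat h₂ (concat h₁ u v) w = concat h₄ u (concat h₃ v w) := by
  funext z
  by_cases hz : (z : ℕ) < r
  · rw [concat_left h₂ _ _ _ ⟨z, by omega⟩ rfl, concat_left h₁ _ _ _ ⟨z, hz⟩ rfl,
      concat_left h₄ _ _ _ ⟨z, hz⟩ rfl]
  · rw [concat_right h₄ _ _ z ⟨z - r, by omega⟩ (by simp; omega)]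
    by_cases hz' : (z : ℕ) < r + s
    · rw [concat_left h₂ _ _ _ ⟨z, by omega⟩ rfl,
        concat_right h₁ _ _ _ ⟨z - r, by omega⟩ (by simp; omega),
        concat_left h₃ _ _ _ ⟨z - r, by omega⟩ rfl]
    · rw [concat_right h₂ _ _ _ ⟨z - (r + s), by omega⟩ (by simp; omega),
        concat_right h₃ _ _ _ ⟨z - (r + s), by omega⟩ (by simp; omega)]

/-- Multilinear operations that agree on labelled operations are equal. -/
theorem multilinear_label_ext {V : Type*} [AddCommGroup V] [Module k V] {n : ℕ}
    {f g : MultilinearMap k (fun _ : Fin n => P.LabelledOps X) V}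
    (h : ∀ (r : Fin n → ℕ) (w : ∀ i, Fin (r i) → X) (p : ∀ i, P.obj (r i)),
      f (fun i => P.label (w i) (p i)) = g (fun i => P.label (w i) (p i))) : f = g := by
  induction n with
  | zero =>
    refine MultilinearMap.ext fun v => ?_
    have e := h (fun i => i.elim0) (fun i => i.elim0) (fun i => i.elim0)
    rwa [Subsingleton.elim v]
  | succ n ih =>
    have e : f.curryLeft = g.curryLeft :=
      labelledOps_hom_ext fun {m} w p => ih fun r w' p' => by
        rw [MultilinearMap.curryLeft_apply, MultilinearMap.curryLeft_apply]
        have := h (Fin.cons m r)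
          (Fin.cons (α := fun i => Fin (Fin.cons (α := fun _ => ℕ) m r i) → X) w w')
          (Fin.cons (α := fun i => P.obj (Fin.cons (α := fun _ => ℕ) m r i)) p p')
        convert this using 2 <;>
        · funext i
          refine Fin.cases ?_ (fun j => ?_) i <;> rfl
    rw [← MultilinearMap.uncurry_curryLeft f, e, MultilinearMap.uncurry_curryLeft]

theorem endOperad_act_apply {A : Type u} [AddCommGroup A] [Module k A] {n : ℕ}
    (σ : Equiv.Perm (Fin n)) (f : (endOperad k A).obj n) (v : Fin n → A) :
    (show MultilinearMap k (fun _ : Fin n => A) A from (endOperad k A).act σ f) v =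
      (show MultilinearMap k (fun _ : Fin n => A) A from f) (fun i => v (σ i)) := rfl

/-- The ternary operation `f` on labelled operations is given by composition with `p`. -/
def RepresentsTernary (f : (endOperad k (P.LabelledOps X)).obj 3) (p : P.obj 3) : Prop :=
  ∀ ⦃r s t N : ℕ⦄ (h : r + s + t = N) (u : Fin r → X) (a : P.obj r) (v : Fin s → X) (b : P.obj s)
    (w : Fin t → X) (c : P.obj t),
    (show MultilinearMap k (fun _ : Fin 3 => P.LabelledOps X) (P.LabelledOps X) from f)
      ![P.label u a, P.label v b, P.label w c] =
      P.label (concat h (concat rfl u v) w) (P.ternary h p a b c)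

theorem RepresentsTernary.eq_zero
    {f : (endOperad k (P.LabelledOps X)).obj 3}
    (h : RepresentsTernary f 0) : f = 0 :=
  multilinear_label_ext fun r w p => by
    have e : (fun i => P.label (w i) (p i)) =
        ![P.label (w 0) (p 0), P.label (w 1) (p 1), P.label (w 2) (p 2)] := by
      funext i
      fin_cases i <;> rfl
    rw [e]
    refine (h rfl _ _ _ _ _ _).trans ?_
    simp only [ternary, map_zero, LinearMap.zero_apply]
    rfl

theorem RepresentsTernary.act
    {f : (endOperad k (P.LabelledOps X)).obj 3} {p : P.obj 3}
    (h : RepresentsTernary f p) (σ : Equiv.Perm (Fin 3)) :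
    RepresentsTernary ((endOperad k (P.LabelledOps X)).act σ f) (P.act σ p) := by
  have hσ : σ ∈ Submonoid.closure (Set.range fun i : Fin 2 => Equiv.swap i.castSucc i.succ) := by
    rw [Equiv.Perm.mclosure_swap_castSucc_succ]; trivial
  induction hσ using Submonoid.closure_induction_left with
  | one =>
    rw [Operad.act_one, Operad.act_one]
    exact h
  | mul_left σ hσ τ _ ih =>
    obtain ⟨i, rfl⟩ := hσ
    rw [Operad.act_mul, Operad.act_mul]
    intro r s t N hN u a v b w c
    set f' := (endOperad k (P.LabelledOps X)).act τ f with hf'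
    fin_cases i
    · refine Eq.trans ?_ (label_ternary_swap_zero_one hN (by omega) (P.act τ p) a b c u v w).symm
      rw [← ih (by omega : s + r + t = N)]
      refine (endOperad_act_apply _ f' _).trans
        (congrArg (DFunLike.coe
          (show MultilinearMap k (fun _ : Fin 3 => P.LabelledOps X) _ from f')) ?_)
      funext x
      fin_cases x <;> rfl
    · refine Eq.trans ?_ (label_ternary_swap_one_two hN (by omega) (P.act τ p) a b c u v w).symm
      rw [← ih (by omega : r + t + s = N)]
      refine (endOperad_act_apply _ f' _).trans
        (congrArg (DFunLike.coe
          (show MultilinearMap k (fun _ : Fin 3 => P.LabelledOps X) _ from f')) ?_)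
      funext x
      fin_cases x <;> rfl

/-- The operation `f` on labelled operations is given by composition with `p`. Only arities up to
`3` matter for the relations of a quadratic operad, and there is no condition in the others. There
are no nullary operations, and the unary ones are multiples of the unit. -/
def Represents : ∀ {n : ℕ}, (endOperad k (P.LabelledOps X)).obj n → P.obj n → Prop
  | 0, f, p => f = 0 ∧ p = 0
  | 1, f, p => ∃ c : k, f = c • (endOperad k (P.LabelledOps X)).one ∧ p = c • P.one
  | 2, f, p => f = mulOp p
  | 3, f, p => RepresentsTernary f p
  | _ + 4, _, _ => True

namespace Represents

theorem smul {n : ℕ} {f : (endOperad k (P.LabelledOps X)).obj n} {p : P.obj n} (c : k)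
    (h : Represents f p) : Represents (c • f) (c • p) := by
  match n, f, p, h with
  | 0, _, _, ⟨h, h'⟩ => exact ⟨by rw [h, smul_zero], by rw [h', smul_zero]⟩
  | 1, _, _, ⟨d, h, h'⟩ => exact ⟨c * d, by rw [h, mul_smul], by rw [h', mul_smul]⟩
  | 2, f, p, h =>
    change c • f = mulOp (c • p)
    rw [map_smul]
    exact congrArg _ h
  | 3, f, p, h =>
    intro r s t N hN u a v b w d
    refine (congrArg (c • ·) (h hN u a v b w d)).trans ?_
    simp only [ternary, map_smul, LinearMap.smul_apply]
  | _ + 4, _, _, _ => trivial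

theorem add {n : ℕ} {f f' : (endOperad k (P.LabelledOps X)).obj n} {p p' : P.obj n}
    (h : Represents f p) (h' : Represents f' p') : Represents (f + f') (p + p') := by
  match n, f, p, f', p', h, h' with
  | 0, _, _, _, _, ⟨h, e⟩, ⟨h', e'⟩ => exact ⟨by rw [h, h', add_zero], by rw [e, e', add_zero]⟩
  | 1, _, _, _, _, ⟨d, h, e⟩, ⟨d', h', e'⟩ =>
    exact ⟨d + d', by rw [h, h', add_smul], by rw [e, e', add_smul]⟩
  | 2, f, p, f', p', h, h' =>
    change f + f' = mulOp (p + p')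
    rw [map_add]
    exact congrArg₂ _ h h'
  | 3, f, p, f', p', h, h' =>
    intro r s t N hN u a v b w d
    refine (congrArg₂ (· + ·) (h hN u a v b w d) (h' hN u a v b w d)).trans ?_
    simp only [ternary, map_add, LinearMap.add_apply]
  | _ + 4, _, _, _, _, _, _ => trivial

theorem zero (n : ℕ) : Represents (0 : (endOperad k (P.LabelledOps X)).obj n) 0 := by
  match n with
  | 0 => exact ⟨rfl, rfl⟩
  | 1 => exact ⟨0, by rw [zero_smul], by rw [zero_smul]⟩
  | 2 => exact (map_zero mulOp).symm
  | 3 =>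
    intro r s t N hN u a v b w d
    simp only [ternary, map_zero, LinearMap.zero_apply]
    rfl
  | _ + 4 => trivial

theorem act {n : ℕ} {f : (endOperad k (P.LabelledOps X)).obj n} {p : P.obj n}
    (σ : Equiv.Perm (Fin n)) (h : Represents f p) :
    Represents ((endOperad k (P.LabelledOps X)).act σ f) (P.act σ p) := by
  match n, f, p, σ, h with
  | 0, _, _, _, ⟨h, h'⟩ => exact ⟨by rw [h, map_zero], by rw [h', map_zero]⟩
  | 1, f, p, σ, h =>
    obtain rfl : σ = 1 := Subsingleton.elim _ _
    rw [Operad.act_one, Operad.act_one]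
    exact h
  | 2, f, p, σ, h =>
    have hσ : σ = 1 ∨ σ = Equiv.swap 0 1 := by
      revert σ; decide
    obtain rfl | rfl := hσ
    · rw [Operad.act_one, Operad.act_one]
      exact h
    · have h' : f = mulOp p := h
      rw [h']
      exact (mulOp_swap p).symm
  | 3, f, p, σ, h => exact RepresentsTernary.act h σ
  | _ + 4, _, _, _, _ => trivial

theorem comp_mulOp (i : Fin 2) (p q : P.obj 2) :
    RepresentsTernary ((endOperad k (P.LabelledOps X)).comp (m := 2) (n := 2) (N := 3) rfl i
      (mulOp p) (mulOp q)) (P.comp (m := 2) (n := 2) (N := 3) rfl i p q) := by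
  intro r s t N hN u a v b w c
  have e : ∀ v : Fin 3 → P.LabelledOps X,
      (show MultilinearMap k (fun _ : Fin 3 => P.LabelledOps X) _ from
        (endOperad k (P.LabelledOps X)).comp (m := 2) (n := 2) (N := 3) rfl i
          (mulOp p) (mulOp q)) v =
      mul p (EndOp.args (m := 2) (n := 2) (N := 3) rfl i (fun w => mul q (w 0) (w 1)) v 0)
        (EndOp.args (m := 2) (n := 2) (N := 3) rfl i (fun w => mul q (w 0) (w 1)) v 1) :=
    fun v => rfl
  refine (e _).trans ?_
  fin_cases i
  · refine Eq.trans ?_ (congrArg _ (ternary_comp_zero hN p q a b c).symm)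
    refine Eq.trans ?_ (mul_label p hN _ _ _ _)
    rw [← mul_label q rfl]
    rfl
  · refine Eq.trans ?_ (congrArg _ (ternary_comp_one hN (by omega) p q a b c).symm)
    rw [concat_assoc rfl hN rfl (by omega)]
    refine Eq.trans ?_ (mul_label p _ _ _ _ _)
    rw [← mul_label q rfl]
    rfl

theorem comp {m n N : ℕ} (h : m + n = N + 1) (i : Fin m)
    {f : (endOperad k (P.LabelledOps X)).obj m} {p : P.obj m}
    {g : (endOperad k (P.LabelledOps X)).obj n} {q : P.obj n} (hf : Represents f p)
    (hg : Represents g q) :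
    Represents ((endOperad k (P.LabelledOps X)).comp h i f g) (P.comp h i p q) := by
  match m, n, h, i, f, p, g, q, hf, hg with
  | m, 0, h, i, f, p, g, q, hf, ⟨hg, hq⟩ =>
    rw [hg, hq, map_zero, map_zero]
    exact zero N
  | 1, n, h, i, f, p, g, q, ⟨c, hf, hp⟩, hg =>
    obtain rfl : n = N := by omega
    obtain rfl : i = 0 := Subsingleton.elim _ _
    rw [hf, hp, map_smul, map_smul, LinearMap.smul_apply, LinearMap.smul_apply, Operad.one_comp,
      Operad.one_comp]
    exact hg.smul c
  | m, 1, h, i, f, p, g, q, hf, ⟨c, hg, hq⟩ =>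
    obtain rfl : m = N := by omega
    rw [hg, hq, map_smul, map_smul, Operad.comp_one, Operad.comp_one]
    exact hf.smul c
  | 2, 2, h, i, f, p, g, q, hf, hg =>
    obtain rfl : 3 = N := by omega
    have hf : f = mulOp p := hf
    have hg : g = mulOp q := hg
    rw [hf, hg]
    exact comp_mulOp i p q
  | 2, n + 3, h, i, f, p, g, q, hf, hg =>
    obtain ⟨N, rfl⟩ : ∃ N', N = N' + 4 := ⟨N - 4, by omega⟩
    trivial
  | m + 3, n + 2, h, i, f, p, g, q, hf, hg =>
    obtain ⟨N, rfl⟩ : ∃ N', N = N' + 4 := ⟨N - 4, by omega⟩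
    trivial

end Represents

end Operad

section FreeAlgebra

open Operad

variable {k : Type u} [Field k] {E : BinaryGenerators k} (S : OpTerm E 3 → Prop) (X : Type)

/-- The generators act on labelled operations by their products. -/
def genMul : E.carrier →ₗ[k] (endOperad k ((presentedOperad S).LabelledOps X)).obj 2 :=
  mulOp ∘ₗ genMap S

variable {X}

/-- The formal expressions act on labelled operations by composition. -/
theorem represents_value {n : ℕ} (x : OpTerm E n) :
    Represents (x.value _ (genMul S X)) (OpTerm.Quo.mk S x : (presentedOperad S).obj n) := by
  induction x with
  | gen e => exact (rfl : genMul S X e = mulOp (genMap S e))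
  | one => exact ⟨1, (one_smul k _).symm, (one_smul k _).symm⟩
  | zero n => exact Represents.zero n
  | add x y hx hy => exact hx.add hy
  | smul c x hx => exact hx.smul c
  | act σ x hx => exact hx.act σ
  | comp h i x y hx hy => exact hx.comp h i hy

variable (X)

/-- The free algebra on the set `X`. The generators act by `genMul`; a relation acts by composition
with its class, which is `0`. -/
def freeAlgebra : OpAlgebra (presentedOperad S) where
  carrier := (presentedOperad S).LabelledOps X
  str := presentedLift (g := genMul S X)
    (fun e => (congrArg mulOp (QuadraticData.genMap_swap S e)).trans (mulOp_swap _))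
    (fun x hx => by
      have h : RepresentsTernary (x.value _ (genMul S X))
          (OpTerm.Quo.mk S x : (presentedOperad S).obj 3) := represents_value S x
      have e : (OpTerm.Quo.mk S x : (presentedOperad S).obj 3) = 0 := OpTerm.Quo.sound (.rel x hx)
      rw [e] at h
      exact h.eq_zero)

end FreeAlgebra

/-! ### Evaluation of the free algebra at its generators -/

namespace Operad

variable {k : Type u} [Field k]

/-- The operations that are obtained from the unit by linear combinations, permutations of inputs
and compositions `c(a, b)` with binary operations `c`. -/
inductive IsBinaryComposite (P : Operad k) : ∀ {n : ℕ}, P.obj n → Prop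
  | one : IsBinaryComposite P P.one
  | zero (n : ℕ) : IsBinaryComposite P (0 : P.obj n)
  | add {n : ℕ} {x y : P.obj n} : IsBinaryComposite P x → IsBinaryComposite P y →
      IsBinaryComposite P (x + y)
  | smul {n : ℕ} (c : k) {x : P.obj n} : IsBinaryComposite P x → IsBinaryComposite P (c • x)
  | act {n : ℕ} (σ : Equiv.Perm (Fin n)) {x : P.obj n} : IsBinaryComposite P x →
      IsBinaryComposite P (P.act σ x)
  | binary {r s N : ℕ} (h : r + s = N) (c : P.obj 2) {a : P.obj r} {b : P.obj s} :
      IsBinaryComposite P a → IsBinaryComposite P b → IsBinaryComposite P (P.binary h c a b)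

variable {P : Operad k}

theorem comp_binary_left {r s l L N N' : ℕ} (h : r + s = N) (hc : N + l = N' + 1)
    (hL : r + l = L + 1) (h' : L + s = N') (c : P.obj 2) (a : P.obj r) (b : P.obj s) (y : P.obj l)
    (i : Fin N) (j : Fin r) (hi : (i : ℕ) = j) :
    P.comp hc i (P.binary h c a b) y = P.binary h' c (P.comp hL j a y) b := by
  rw [binary_apply, binary_apply]
  exact comp_assoc' _ _ _ _ _ _ _ (by simpa using hi) _ _ _

theorem comp_binary_right {r s l L N N' : ℕ} (h : r + s = N) (hc : N + l = N' + 1)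
    (hL : s + l = L + 1) (h' : r + L = N') (c : P.obj 2) (a : P.obj r) (b : P.obj s) (y : P.obj l)
    (i : Fin N) (j : Fin s) (hi : (i : ℕ) = r + j) :
    P.comp hc i (P.binary h c a b) y = P.binary h' c a (P.comp hL j b y) := by
  rw [binary_apply, binary_apply]
  refine (comp_comm' (m := 1 + s) (n := r) (l := l) (M := N) (L := 1 + L) (N := N')
    (by omega) hc (by omega) (by omega) ⟨0, by omega⟩ ⟨1 + j, by omega⟩ (by simp) i
    (by simp; omega) ⟨0, by omega⟩ rfl _ a y).trans ?_
  rw [comp_assoc' (m := 2) (n := s) (l := l) (M := 1 + s) (L := L) (N := 1 + L)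
    (by omega) (by omega) hL (by omega) 1 j ⟨1 + j, by omega⟩ rfl c b y]

theorem IsBinaryComposite.comp {m n N : ℕ} (h : m + n = N + 1) (i : Fin m) {x : P.obj m}
    {y : P.obj n} (hx : IsBinaryComposite P x) (hy : IsBinaryComposite P y) :
    IsBinaryComposite P (P.comp h i x y) := by
  induction hx generalizing N with
  | one =>
    obtain rfl : n = N := by omega
    obtain rfl : i = 0 := Subsingleton.elim _ _
    rwa [P.one_comp]
  | zero n =>
    rw [map_zero, LinearMap.zero_apply]
    exact .zero _
  | add _ _ ih ih' =>
    rw [map_add, LinearMap.add_apply]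
    exact (ih h i).add (ih' h i)
  | smul c _ ih =>
    rw [map_smul, LinearMap.smul_apply]
    exact (ih h i).smul c
  | act σ _ ih =>
    obtain ⟨ρ, H⟩ := IsBlockPerm.exists_rel h (σ.symm i) σ 1
    rw [comp_act_left H (σ.apply_symm_apply i)]
    exact (ih h _).act ρ
  | @binary r s M hM c a b ha hb iha ihb =>
    by_cases hi : (i : ℕ) < r
    · rw [comp_binary_left hM h (L := r + n - 1) (by omega) (by omega) c a b y i ⟨i, hi⟩ rfl]
      exact .binary _ c (iha _ _) hb
    · rw [comp_binary_right hM h (L := s + n - 1) (by omega) (by omega) c a b y i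
        ⟨i - r, by omega⟩ (by simp; omega)]
      exact .binary _ c ha (ihb _ _)

end Operad

section Variables

open Operad

variable {k : Type u} [Field k] {E : BinaryGenerators k} {S : OpTerm E 3 → Prop} {X : Type}

theorem isBinaryComposite {n : ℕ} (x : (presentedOperad S).obj n) :
    IsBinaryComposite (presentedOperad S) x := by
  induction x using presentedOperad_induction with
  | gen e =>
    have h : (presentedOperad S).binary (N := 2) rfl (genMap S e) (presentedOperad S).one
        (presentedOperad S).one = genMap S e :=
      (binary_apply _ _ _ _).trans (((presentedOperad S).comp_one (n := 2) 0 _).trans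
        ((presentedOperad S).comp_one (n := 2) 1 (genMap S e)))
    rw [← h]
    exact .binary _ _ .one .one
  | one => exact .one
  | zero n => exact .zero n
  | add x y hx hy => exact hx.add hy
  | smul c x hx => exact hx.smul c
  | act σ x hx => exact hx.act σ
  | comp h i x y hx hy => exact hx.comp h i hy

theorem freeAlgebra_str_binary (c : (presentedOperad S).obj 2) :
    (freeAlgebra S X).str.map 2 c = mulOp c := by
  revert c
  exact Quot.ind fun x => represents_value (X := X) S x

/-- Every operation is recovered from its value at variables in the free algebra. -/
theorem freeAlgebra_str_apply_variables {n : ℕ} (p : (presentedOperad S).obj n) (w : Fin n → X) :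
    (show MultilinearMap k (fun _ : Fin n => (presentedOperad S).LabelledOps X)
      ((presentedOperad S).LabelledOps X) from (freeAlgebra S X).str.map n p)
        (fun i => (presentedOperad S).label (fun _ => w i) (presentedOperad S).one) =
      (presentedOperad S).label w p := by
  have hp := isBinaryComposite p
  induction hp with
  | one =>
    rw [(freeAlgebra S X).str.map_one]
    refine congrArg (fun w' => (presentedOperad S).label w' (presentedOperad S).one) ?_
    funext i
    rw [Subsingleton.elim i 0]
  | zero n =>
    rw [map_zero, map_zero]
    rfl
  | add _ _ ih ih' =>
    rw [map_add, map_add]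
    exact congrArg₂ (· + ·) (ih w) (ih' w)
  | smul c _ ih =>
    rw [map_smul, map_smul]
    exact congrArg (fun x : (presentedOperad S).LabelledOps X => c • x) (ih w)
  | act σ _ ih =>
    rw [(freeAlgebra S X).str.map_act]
    refine (endOperad_act_apply (A := (freeAlgebra S X).carrier) σ _ _).trans
      ((ih (w ∘ σ)).trans ?_)
    exact (label_act (fun _ => rfl) _).symm
  | @binary r s N h c a b ha hb iha ihb =>
    have e : (freeAlgebra S X).str.map N ((presentedOperad S).binary h c a b) =
        (endOperad k ((presentedOperad S).LabelledOps X)).binary h (mulOp c)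
          ((freeAlgebra S X).str.map r a) ((freeAlgebra S X).str.map s b) :=
      (Hom.map_binary _ h c a b).trans (by rw [freeAlgebra_str_binary]; rfl)
    rw [e]
    refine (binary_endOperad_apply h _ _ _ _).trans ((mulOp_apply c _).trans ?_)
    have e1 := iha (fun y => w ⟨y, by omega⟩)
    have e2 := ihb (fun y => w ⟨r + y, by omega⟩)
    refine (congrArg₂ (fun x y => mul c x y) e1 e2).trans ?_
    rw [mul_label c h]
    congr 1
    congr 1
    funext z
    by_cases hz : (z : ℕ) < r
    · rw [concat_left h _ _ z ⟨z, hz⟩ rfl]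
    · rw [concat_right h _ _ z ⟨z - r, by omega⟩ (by simp; omega)]
      congr 1
      ext
      simp
      omega

end Variables

namespace Operad

variable {k : Type u} [Field k] {P : Operad k}

open scoped Classical in
/-- The operation labelled by a word without repetition that uses every letter; `0` for the other
words. -/
def bijectivePart (n : ℕ) {m : ℕ} (w : Fin m → Fin n) : P.obj m →ₗ[k] P.obj n :=
  if h : m = n ∧ Function.Bijective w then
    P.act (Equiv.ofBijective (w ∘ Fin.cast h.1.symm)
      (h.2.comp (finCongr h.1.symm).bijective)) ∘ₗ P.reindex h.1 else 0

theorem bijectivePart_act {n m : ℕ} (w : Fin m → Fin n) (σ : Equiv.Perm (Fin m)) (p : P.obj m) :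
    bijectivePart n w (P.act σ p) = bijectivePart n (w ∘ σ) p := by
  unfold bijectivePart
  by_cases h : m = n ∧ Function.Bijective w
  · obtain ⟨rfl, h⟩ := h
    rw [dif_pos ⟨rfl, h⟩, dif_pos ⟨rfl, h.comp σ.bijective⟩]
    simp only [LinearMap.comp_apply, reindex_rfl, ← P.act_mul]
    congr 2
    ext
    rfl
  · rw [dif_neg h, dif_neg (fun h' => h ⟨h'.1, ?_⟩)]
    · rfl
    · simpa using h'.2.comp σ.symm.bijective

theorem bijectivePart_id {n : ℕ} (p : P.obj n) : bijectivePart n id p = p := by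
  unfold bijectivePart
  rw [dif_pos ⟨rfl, Function.bijective_id⟩]
  have : Equiv.ofBijective (id ∘ Fin.cast (rfl : n = n))
      (Function.bijective_id.comp (finCongr (rfl : n = n)).bijective) = 1 := by
    ext; rfl
  simp only [LinearMap.comp_apply, reindex_rfl]
  exact (congrArg (fun σ => P.act σ p) this).trans (P.act_one p)

/-- An operation is determined by the corresponding element of the free algebra. -/
theorem label_id_injective (n : ℕ) : Function.Injective (P.label (id : Fin n → Fin n)) :=
  Function.LeftInverse.injective (g := desc (fun {_} w => bijectivePart n w) bijectivePart_act)
    fun p => (desc_label _ bijectivePart_act id p).trans (bijectivePart_id p)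

variable {X : Type}

open scoped Classical in
/-- The operation labelled by a constant word with value `x`; `0` for the other words. -/
def letterPart (x : X) {m : ℕ} (w : Fin m → X) : P.obj m →ₗ[k] P.LabelledOps X :=
  if ∀ z, w z = x then P.label w else 0

theorem letterPart_act (x : X) {m : ℕ} (w : Fin m → X) (σ : Equiv.Perm (Fin m)) (p : P.obj m) :
    letterPart x w (P.act σ p) = letterPart x (w ∘ σ) p := by
  unfold letterPart
  by_cases h : ∀ z, w z = x
  · have h' : ∀ z, (w ∘ σ) z = x := fun z => h (σ z)
    rw [if_pos h, if_pos h', label_act (fun _ => rfl)]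
    rfl
  · rw [if_neg h, if_neg (fun h' => h fun z => by simpa using h' (σ.symm z))]
    rfl

/-- The projection of labelled operations to those all of whose labels are `x`. -/
def projLetter (x : X) : P.LabelledOps X →ₗ[k] P.LabelledOps X :=
  desc (fun {_} w => letterPart x w) (letterPart_act x)

theorem projLetter_variable_self (x : X) :
    projLetter x (P.label (fun _ => x) P.one) = P.label (fun _ => x) P.one := by
  refine (desc_label _ (letterPart_act x) _ _).trans ?_
  rw [letterPart, if_pos fun _ => rfl]

theorem projLetter_variable_of_ne {x y : X} (h : y ≠ x) :
    projLetter x (P.label (fun _ => y) P.one) = 0 := by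
  refine (desc_label _ (letterPart_act x) _ _).trans ?_
  rw [letterPart, if_neg fun h' => h (h' 0)]
  rfl

end Operad

/-! ### The free algebra detects cocycles -/

namespace Operad

variable {k : Type u} [Field k]

theorem suspComp_one {T : Operad k} {m N : ℕ} (h : m + 1 = N + 1) (h' : m = N) (i : Fin m)
    (p : T.obj m) : T.suspComp h i p T.one = T.reindex h' p := by
  subst h'
  rw [suspComp_apply, T.comp_one, neg_one_pow_eq_of_mod (b := 0) (by omega), pow_zero, one_smul]
  rfl

theorem graft_one (T : Operad k) {n s N : ℕ} (h : s + ∑ _i : Fin n, 1 = N) (h' : n + s = N)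
    (p : T.obj (n + s)) :
    T.graft n s (fun _ => 1) h p (fun _ => T.one) = T.reindex h' p := by
  induction n generalizing s with
  | zero => rfl
  | succ n ih =>
    have h1 : s + 1 + ∑ _i : Fin n, 1 = N := by
      rw [← h]; simp; omega
    rw [graft_succ _ _ h h1, suspComp_one _ (by omega), ih h1 (by omega)]
    subst h'
    generalize_proofs h₁ h₂
    revert h₁ h₂
    generalize n + (s + 1) = M
    rintro rfl _
    rfl

section

variable {A : Type u} [AddCommGroup A] [Module k A] {n : ℕ}
  (φ : Fin n → MultilinearMap k (fun _ : Fin 1 => A) A) (w : ℕ → A)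

theorem graftArgs_one_zero : graftArgs (fun _ => 1) φ w 1 0 = w 0 := rfl

theorem graftArgs_one_succ (i : Fin n) :
    graftArgs (fun _ => 1) φ w 1 i.succ = φ i (fun _ => w (i + 1)) := by
  refine (dif_neg (by simp)).trans ?_
  have e : ∀ (j : Fin n) (_ : j = i),
      blockValue (fun _ => 1) φ w 1 j = φ i (fun _ => w (i + 1)) := by
    rintro j rfl
    unfold blockValue
    congr 1
    funext c
    congr 1
    simp
    omega
  exact e _ (Fin.ext (by simp))

end

end Operad

namespace QuadraticData

open Operad

variable {k : Type u} [Field k] (D : QuadraticData k)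

/-- The free `P`-algebra on `X`. -/
def freeOpAlgebra (X : Type) : OpAlgebra D.operad := freeAlgebra _ X

variable {D} {N : ℕ}

/-- The variable `x` of the free algebra. -/
def variableOf {X : Type} (x : X) : (D.freeOpAlgebra X).carrier :=
  D.operad.label (fun _ : Fin 1 => x) D.operad.one

/-- The linear endomorphism of the free algebra that fixes the variable `x` and kills the others,
as an operation of arity `1`. -/
def projOp {X : Type} (x : X) : (endOperad k (D.freeOpAlgebra X).carrier).obj 1 :=
  MultilinearMap.ofSubsingleton k (D.freeOpAlgebra X).carrier (D.freeOpAlgebra X).carrier 0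
    (projLetter (P := D.operad) x)

/-- The cochain `pr_x ⊗ 1` of degree `0`. -/
def projCochain {X : Type} (x : X) : D.Cochain (D.freeOpAlgebra X) 0 :=
  ⟨tmul (projOp x) D.dualOperad.one, fun σ => by
    obtain rfl : σ = 1 := Subsingleton.elim (α := Equiv.Perm (Fin 1)) _ _
    exact (D.coeff _).suspAct_one _⟩

/-- Evaluation at the variables, in the factor `End_A` of `End_A ⊗ P^!`. -/
def evalVariables (N : ℕ) : (D.coeff (D.freeOpAlgebra (Fin N))).obj N →ₗ[k]
    D.operad.LabelledOps (Fin N) ⊗[k] D.dualOperad.obj N :=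
  TensorProduct.map
    { toFun := fun f => (show MultilinearMap k (fun _ : Fin N => (D.freeOpAlgebra (Fin N)).carrier)
        (D.freeOpAlgebra (Fin N)).carrier from f) variableOf
      map_add' := fun _ _ => rfl
      map_smul' := fun _ _ => rfl } LinearMap.id

/-- Evaluated at permuted variables, the operation `p(1, pr_1, …, pr_n)` gives `0`, and it gives
`± p` for the identical permutation. -/
theorem graft_projOp_apply {n : ℕ} (h : 1 + ∑ _i : Fin n, 1 = n + 1)
    (p : D.operad.obj (n + 1)) (σ : Equiv.Perm (Fin (n + 1))) :
    (show MultilinearMap k (fun _ : Fin (n + 1) => (D.freeOpAlgebra (Fin (n + 1))).carrier)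
        (D.freeOpAlgebra (Fin (n + 1))).carrier from
      (endOperad k (D.freeOpAlgebra (Fin (n + 1))).carrier).graft n 1 (fun _ => 1) h
        ((D.freeOpAlgebra (Fin (n + 1))).str.map (n + 1) p) (fun i => projOp i.succ))
          (fun z => variableOf (σ z)) =
      (-1 : k) ^ graftSign n 1 (fun _ => 1) •
        if σ = 1 then D.operad.label id p else 0 := by
  set A := D.freeOpAlgebra (Fin (n + 1)) with hA
  set w : ℕ → A.carrier := fun z => if hz : z < n + 1 then variableOf (σ ⟨z, hz⟩) else 0 with hw
  have hv : (fun z => variableOf (σ z)) = fun z : Fin (n + 1) => w z := by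
    funext z
    simp only [hw, z.2, dite_true, Fin.eta]
  rw [hv]
  refine (graft_endOperad_apply (fun _ => 1) h (A.str.map (n + 1) p) (fun i => projOp i.succ)
    w).trans ?_
  congr 1
  have hzero : graftArgs (fun _ => 1) (fun i : Fin n => projOp (D := D) i.succ) w 1 0 =
      variableOf (σ 0) :=
    (graftArgs_one_zero _ w).trans (dif_pos (Nat.succ_pos n))
  have hsucc : ∀ i : Fin n, graftArgs (fun _ => 1) (fun i => projOp i.succ) w 1 i.succ =
      projLetter (P := D.operad) i.succ (variableOf (D := D) (σ i.succ)) := by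
    intro i
    refine (graftArgs_one_succ _ w i).trans ?_
    exact congrArg (projLetter (P := D.operad) i.succ) (dif_pos i.succ.2)
  by_cases hσ : σ = 1
  · subst hσ
    rw [if_pos rfl]
    refine Eq.trans ?_ (freeAlgebra_str_apply_variables p id)
    refine congrArg (DFunLike.coe (show MultilinearMap k (fun _ : Fin (n + 1) => A.carrier)
      A.carrier from A.str.map (n + 1) p)) ?_
    funext x
    refine Fin.cases ?_ (fun i => ?_) x
    · exact hzero
    · exact (hsucc i).trans (projLetter_variable_self _)
  · rw [if_neg hσ]
    obtain ⟨i, hi⟩ : ∃ i : Fin n, σ i.succ ≠ i.succ := by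
      by_contra! hfix
      refine hσ (Equiv.ext fun x => ?_)
      refine Fin.cases ?_ hfix x
      -- a permutation that fixes all points but one is the identity
      obtain ⟨y, hy⟩ := σ.surjective 0
      revert hy
      refine Fin.cases (fun hy => hy) (fun j hy => ?_) y
      rw [hfix j] at hy
      exact absurd hy (Fin.succ_ne_zero j)
    exact MultilinearMap.map_coord_zero (show MultilinearMap k
      (fun _ : Fin (n + 1) => A.carrier) A.carrier from A.str.map (n + 1) p) i.succ
        ((hsucc i).trans (projLetter_variable_of_ne hi))

/-- The map from `P ⊗ P^!` that labels the inputs of `p` in `p ⊗ q` by their numbers. -/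
def labelTensor (N : ℕ) : D.tensorDual.obj N →ₗ[k]
    D.operad.LabelledOps (Fin N) ⊗[k] D.dualOperad.obj N :=
  TensorProduct.map (D.operad.label id) LinearMap.id

theorem labelTensor_tmul (p : D.operad.obj N) (q : D.dualOperad.obj N) :
    labelTensor N (tmul p q) = D.operad.label id p ⊗ₜ[k] q := rfl

theorem labelTensor_injective (N : ℕ) : Function.Injective (labelTensor (D := D) N) :=
  Module.Flat.rTensor_preserves_injective_linearMap _ (label_id_injective N)

/-- Evaluated at variables, only the trivial summand of the average of `x(1, pr_1, …, pr_n)`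
survives, and it is `x`. -/
theorem evalVariables_suspAct_graft {n : ℕ} (h : 1 + ∑ _i : Fin n, 1 = n + 1)
    (x : D.tensorDual.obj (n + 1)) (σ : Equiv.Perm (Fin (n + 1))) :
    evalVariables (n + 1) ((D.coeff (D.freeOpAlgebra (Fin (n + 1)))).suspAct σ
      ((D.coeff (D.freeOpAlgebra (Fin (n + 1)))).graft n 1 (fun _ => 1) h
        (D.structureMap (D.freeOpAlgebra (Fin (n + 1))) (n + 1) x)
          (fun i => tmul (projOp i.succ) D.dualOperad.one))) =
      if σ = 1 then labelTensor (n + 1) x else 0 := by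
  induction x using hadamard_induction with
  | zero => simp
  | add x y hx hy =>
    simp only [map_add, add_apply, hx, hy]
    split_ifs
    · rfl
    · exact add_zero _
  | tmul p q =>
    rw [structureMap_tmul, graft_tmul, graft_one _ _ (by omega), map_smul, map_smul,
      reindex_rfl]
    set f := (endOperad k (D.freeOpAlgebra (Fin (n + 1))).carrier).graft n 1 (fun _ => 1) h
      ((D.freeOpAlgebra (Fin (n + 1))).str.map (n + 1) p) (fun i => projOp i.succ) with hf
    have e : evalVariables (n + 1) ((D.coeff (D.freeOpAlgebra (Fin (n + 1)))).suspAct σ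
        (tmul f q)) = ((Equiv.Perm.sign σ : ℤ) : k) •
        (((-1 : k) ^ graftSign n 1 (fun _ => 1) • if σ = 1 then D.operad.label id p else 0) ⊗ₜ[k]
          D.dualOperad.act σ q) := by
      rw [← graft_projOp_apply h p σ]
      rfl
    rw [e, labelTensor_tmul]
    by_cases hσ : σ = 1
    · subst hσ
      rw [if_pos rfl, if_pos rfl, ← TensorProduct.smul_tmul', D.dualOperad.act_one,
        Equiv.Perm.sign_one, Units.val_one, Int.cast_one, one_smul, smul_smul,
        neg_one_pow_mul_self, one_smul]
    · rw [if_neg hσ, if_neg hσ, smul_zero, TensorProduct.zero_tmul, smul_zero, smul_zero]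

/-- The cochains `pr_1, …, pr_n` of the free algebra on variables `0, …, n` detect the obstruction
for `cup(t)` to be a cocycle. -/
theorem cocycleDefect_eq_zero [CharZero k] {n : ℕ} (hn : 1 ≤ n) (t : D.tensorDual.obj n)
    (ht : D.delta (n - 1) (D.cup hn t) = 0) : cocycleDefect D.chi t = 0 := by
  obtain ⟨n, rfl⟩ : ∃ n', n = n' + 1 := ⟨n - 1, by omega⟩
  set A := D.freeOpAlgebra (Fin (n + 1 + 1)) with hA
  have h1 : 1 + ∑ _i : Fin (n + 1), 1 = n + 1 + 1 := by simp; omega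
  set x := cocycleDefect D.chi t with hx
  set Y := (D.coeff A).graft (n + 1) 1 (fun _ => 1) h1
    (D.structureMap A (n + 1 + 1) x) (fun i => tmul (projOp i.succ) D.dualOperad.one) with hY
  have key : D.delta (n + 1 - 1) (D.cup hn t) A (fun i => D.incl A 0 (projCochain i.succ)) =
      D.incl A (n + 1) ((2 : k) • (D.coeff A).aver (n + 1 + 1) Y) := by
    refine (delta_cup_apply (A := A) hn t (fun i => ⟨0, projCochain i.succ⟩) (M := n) (by simp)
      (by simp [Cochain.toOp]; omega)).trans ?_
    rw [hY, graft_apply]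
    rfl
  rw [ht] at key
  have h2 : (2 : k) • (D.coeff A).aver (n + 1 + 1) Y = 0 :=
    DirectSum.of_injective (β := fun m => D.Cochain A m) (n + 1)
      (key.symm.trans (map_zero (D.incl A (n + 1))).symm)
  have h3 : (D.coeff A).aver (n + 1 + 1) Y = 0 := (smul_eq_zero.1 h2).resolve_left two_ne_zero
  have h4 : ∑ σ : Equiv.Perm (Fin (n + 1 + 1)), (D.coeff A).suspAct σ Y = 0 := by
    have h5 := congrArg Subtype.val h3
    rw [coe_aver] at h5
    exact (smul_eq_zero.1 h5).resolve_left
      (inv_ne_zero (by exact_mod_cast (n + 1 + 1).factorial_ne_zero))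
  -- of this sum only the summand of the identity survives the evaluation at the variables
  refine labelTensor_injective (n + 1 + 1) ?_
  rw [map_zero]
  have h6 := congrArg (evalVariables (n + 1 + 1)) h4
  rw [map_sum, map_zero, Finset.sum_congr rfl fun σ _ => evalVariables_suspAct_graft h1 x σ,
    Finset.sum_ite_eq' Finset.univ 1 (fun _ => labelTensor (n + 1 + 1) x),
    if_pos (Finset.mem_univ _)] at h6
  exact h6

end QuadraticData

end

theorem mainTheorem4 {k : Type u} [Field k] [CharZero k] (D : QuadraticData k)
    (n : ℕ) (hn : 1 ≤ n) (t : D.tensorDual.obj n) :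
    t ∈ D.cocycles hn ↔
      D.tensorDual.suspComp (N := n + 1) (by omega) 1 D.chi t +
        (-1 : k) ^ n • ∑ j : Fin n, D.tensorDual.suspAct (Fin.cycleRange j.castSucc)
          (D.tensorDual.suspComp (N := n + 1) (by omega) j t D.chi) = 0 :=
  ⟨fun h => QuadraticData.cocycleDefect_eq_zero hn t h.2, fun h =>
    ⟨QuadraticData.cup_mem_naturalOperations hn t, QuadraticData.delta_cup_eq_zero hn t h⟩⟩
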